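/- Let $C,A,Z,Y$ be discrete random variables (pre-treatment covariates, treatment, mediator, real outcome) with countable sets of values $\mathcal C,\mathcal A,\mathcal Z,\mathcal Y\subset\mathbb R$, with potential mediators $Z(a)$, potential outcomes $Y(a,z)$ and $Y(a)=Y(a,Z(a))$, and with the consistency relations $Z=Z(A)$, $Y=Y(A)$. Consider the causal model of all laws of these variables such that - positivity: $P(Y(a)=y,\,A=a',\,Z=z,\,C=c)>0$ for all $a,a'\in\mathcal A$, $y\in\mathcal Y$, $z\in\mathcal Z$, $c\in\mathcal C$; - BD (no unmeasured confounding of treatment and outcome): $(Y(a),Y(a'))\perp A\mid C$ and $Y(a,z)\perp A\mid C$ for all $a,a',z$; - FD: $Y(a,z)=Y(a',z)$ almost surely, $Z(a')\perp A$, and $Y(a,z)\perp Z(a')\mid A$ for all $a,a',z$; - TD: $Y(a,z)=Y(a',z)$ almost surely, $Z(a')\perp A\mid C$, and $Y(a,z)\perp Z(a')\mid A,C$ for all $a,a',z$; - $Z(a)\perp C\mid A$ for all $a$. Let $a^*\neq a$ be two treatment levels, $\theta=E\,Y(a^*)-E\,Y(a)$, and let $P$ be a law in the model with $E\,Y(a^*)^2<\infty$,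 $E\,Y(a)^2<\infty$ and $$\sum_{z,c}(p(z|a^*)-p(z|a))^2\,\frac{p(c)\,\mathrm{var}(Y|z,c)}{\sum_{\bar a}p(\bar a|c)p(z|\bar a)}<\infty$$ (the last condition holds automatically if the sets of values are finite). A regular submodel through $P$ is a curve $t\mapsto Q_t$ of laws of all the variables which, for $t$ near $0$, lies in the model, has at $t=0$ the observed-data law of $P$, and is such that: the mass function of $X=(C,A,Z,Y)$ is differentiable in quadratic mean at $t=0$, with score $S\in L^2$; for $b\in\{a^*,a\}$ the mass function of $(C,Z(b),Y(b))$ is differentiable in quadratic mean at $t=0$; and $E_{Q_t}Y(b)^2$ is bounded near $t=0$. The tangent space is the closure in $L^2$ (of the observed-data law) of the linear span of the scores $S$. An influence function is a $\varphi\in L^2$ with $\frac{d}{dt}\theta(Q_t)|_{t=0}=E(\varphi S)$ along all regular submodels. The efficient influence function is the orthogonal projection of an influence function onto the tangent space. The semiparametric efficiency bound is the supremum of the Cramér–Rao bounds $(\frac{d}{dt}\theta(Q_t)|_{t=0})^2/E S^2$ over the regular submodels with $ES^2>0$ along which $\theta$ is differentiable at $t=0$. Then: 1. The observed density factorizes: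 $p(c,a,z,y)=p(c)\,p(a|c)\,p(z|a)\,p(y|z,c)$. 2. The efficient influence function for $\theta$ exists and is $$\varphi_{bd,fd,td}=\frac{(Y-E(Y|Z,C))(p(Z|a^*)-p(Z|a))}{\sum_{\bar a}p(\bar a|C)p(Z|\bar a)}+\sum_c\Big(E(Y|Z,c)-\sum_zE(Y|z,c)p(z|A)\Big)\frac{(I(A=a^*)-I(A=a))\,p(c)}{\sum_{c'}p(c')p(A|c')}+\sum_zE(Y|z,C)(p(z|a^*)-p(z|a))-\theta .$$ 3. The semiparametric efficiency bound equals $$\begin{aligned}\mathrm{var}\,\varphi_{bd,fd,td}={}&\sum_z(p(z|a^*)-p(z|a))^2\sum_c\frac{p(c)\,\mathrm{var}(Y|z,c)}{\sum_{\bar a}p(\bar a|c)p(z|\bar a)}\\&+\sum_{b\in\{a^*,a\}}\Big[\sum_z\frac{p(z|b)}{p(b)}\Big(\sum_cp(c)E(Y|z,c)\Big)^2-\frac{\big(\sum_{z,c}E(Y|z,c)p(z|b)p(c)\big)^2}{p(b)}\Big]\\&+\sum_cp(c)\Big(\sum_zE(Y|z,c)(p(z|a^*)-p(z|a))\Big)^2-\theta^2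 .\end{aligned}$$ 4. It coincides with the Rotnitzky–Smucler efficient influence function for the DAG with edges $C\to A$, $C\to Y$, $A\to Z$, $Z\to Y$: $\varphi_{bd,fd,td}=\chi_{a^*}-\chi_a$, where, with $T_b=I(A=b)Y/p(b|C)$ and $m_b(C)=E(Y|A=b,C)$, $$\chi_b=m_b(C)-E\,m_b(C)+E(T_b|Z,A)-E(T_b|A)+E(T_b|Y,Z,C)-E(T_b|Z,C).$$ -/

import Mathlib

open MeasureTheory ProbabilityTheory Filter Topology Asymptotics

noncomputable section

namespace Causal

/-! ### Potential outcomes and observed data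

All variables are discrete: `𝒞`, `𝒜`, `𝒵` are the countable sets of values of the covariates, of the
treatment and of the (possibly multivariate) mediator, `𝒴 ⊆ ℝ` is the countable set of values of the
univariate outcome. -/

/-- The sample space of all variables: a point records the value of `C`, the value of `A`, the table
`a ↦ Z(a)` of potential mediators and the table `(a, z) ↦ Y(a, z)` of potential outcomes. -/
abbrev Table (𝒞 𝒜 𝒵 : Type*) (𝒴 : Set ℝ) := 𝒞 × 𝒜 × (𝒜 → 𝒵) × (𝒜 → 𝒵 → 𝒴)

/-- The values of the observed data `X = (C, A, Z, Y)`. -/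
abbrev Obs (𝒞 𝒜 𝒵 : Type*) (𝒴 : Set ℝ) := 𝒞 × 𝒜 × 𝒵 × 𝒴

section variables_of_the_model

variable {𝒞 𝒜 𝒵 : Type*} {𝒴 : Set ℝ}

/-- The covariates `C`. -/
def covC (ω : Table 𝒞 𝒜 𝒵 𝒴) : 𝒞 := ω.1

/-- The treatment `A`. -/
def trtA (ω : Table 𝒞 𝒜 𝒵 𝒴) : 𝒜 := ω.2.1

/-- The potential mediator `Z(a)`. -/
def potZ (a : 𝒜) (ω : Table 𝒞 𝒜 𝒵 𝒴) : 𝒵 := ω.2.2.1 a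

/-- The potential outcome `Y(a, z)`. -/
def potYZ (a : 𝒜) (z : 𝒵) (ω : Table 𝒞 𝒜 𝒵 𝒴) : 𝒴 := ω.2.2.2 a z

/-- The potential outcome `Y(a) = Y(a, Z(a))`. -/
def potY (a : 𝒜) (ω : Table 𝒞 𝒜 𝒵 𝒴) : 𝒴 := potYZ a (potZ a ω) ω

/-- The observed mediator: `Z = Z(a)` when `A = a` (consistency). -/
def medZ (ω : Table 𝒞 𝒜 𝒵 𝒴) : 𝒵 := potZ (trtA ω) ω

/-- The observed outcome: `Y = Y(a)` when `A = a`, and hence `Y = Y(a, z)` when `A = a` and `Z = z`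
(consistency). -/
def outY (ω : Table 𝒞 𝒜 𝒵 𝒴) : 𝒴 := potY (trtA ω) ω

/-- The observed data `X = (C, A, Z, Y)`. -/
def observed (ω : Table 𝒞 𝒜 𝒵 𝒴) : Obs 𝒞 𝒜 𝒵 𝒴 := (covC ω, trtA ω, medZ ω, outY ω)

end variables_of_the_model

/-- `X ⊥ Y | W` for a discrete variable `W`: for each value `w`, the variables `X` and `Y` are
independent under the conditional law given `W = w` (which is the zero measure, so that nothing is
required, if `W = w` has probability zero). -/
def CondIndepGiven {Ω α β γ : Type*} [MeasurableSpace Ω] [MeasurableSpace α] [MeasurableSpace β]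
    (P : Measure Ω) (X : Ω → α) (Y : Ω → β) (W : Ω → γ) : Prop :=
  ∀ w : γ, IndepFun X Y (P[|W ⁻¹' {w}])

section causal_assumptions

variable {𝒞 𝒜 𝒵 : Type*} [MeasurableSpace 𝒞] [MeasurableSpace 𝒜] [MeasurableSpace 𝒵] {𝒴 : Set ℝ}

/-- The back-door assumption **BD** (no unmeasured confounding of treatment and outcome):
`Y(a), Y(a') ⊥ A | C` and `Y(a, z) ⊥ A | C` for all `a`, `a'`, `z`. -/
structure BackDoor (P : Measure (Table 𝒞 𝒜 𝒵 𝒴)) : Prop where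
  pair : ∀ a a' : 𝒜, CondIndepGiven P (fun ω => (potY a ω, potY a' ω)) trtA covC
  joint : ∀ (a : 𝒜) (z : 𝒵), CondIndepGiven P (potYZ a z) trtA covC

/-- The front-door assumption **FD**. -/
structure FrontDoor (P : Measure (Table 𝒞 𝒜 𝒵 𝒴)) : Prop where
  fd1 : ∀ (a a' : 𝒜) (z : 𝒵), ∀ᵐ ω ∂P, potYZ a z ω = potYZ a' z ω
  fd2 : ∀ a : 𝒜, IndepFun (potZ a) trtA P
  fd3 : ∀ (a a' : 𝒜) (z : 𝒵), CondIndepGiven P (potYZ a z) (potZ a') trtA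

/-- The two-door assumption **TD**. -/
structure TwoDoor (P : Measure (Table 𝒞 𝒜 𝒵 𝒴)) : Prop where
  td1 : ∀ (a a' : 𝒜) (z : 𝒵), ∀ᵐ ω ∂P, potYZ a z ω = potYZ a' z ω
  td2 : ∀ a : 𝒜, CondIndepGiven P (potZ a) trtA covC
  td3 : ∀ (a a' : 𝒜) (z : 𝒵),
    CondIndepGiven P (potYZ a z) (potZ a') (fun ω => (trtA ω, covC ω))

/-- The causal model: the laws of the potential outcomes that satisfy the standing positivity
assumption `p(Y(a), A, Z, C) > 0`, **BD**, **FD**, **TD**, and `Z(a) ⊥ C | A`. -/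
structure InModel (P : Measure (Table 𝒞 𝒜 𝒵 𝒴)) : Prop where
  isProbabilityMeasure : IsProbabilityMeasure P
  positivity : ∀ (a : 𝒜) (y : 𝒴) (a' : 𝒜) (z : 𝒵) (c : 𝒞),
    0 < P {ω | potY a ω = y ∧ trtA ω = a' ∧ medZ ω = z ∧ covC ω = c}
  backDoor : BackDoor P
  frontDoor : FrontDoor P
  twoDoor : TwoDoor P
  med_indep_cov : ∀ a : 𝒜, CondIndepGiven P (potZ a) covC trtA

/-- The average causal effect `θ = E Y(a⋆) - E Y(a)`. -/
def ace (as a : 𝒜) (P : Measure (Table 𝒞 𝒜 𝒵 𝒴)) : ℝ :=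
  (∫ ω, (potY as ω : ℝ) ∂P) - ∫ ω, (potY a ω : ℝ) ∂P

/-- The law of the observed data `X = (C, A, Z, Y)`. -/
def obsLaw (P : Measure (Table 𝒞 𝒜 𝒵 𝒴)) : Measure (Obs 𝒞 𝒜 𝒵 𝒴) := P.map observed

/-- The law of `(C, Z(b), Y(b))`. -/
def potLaw (b : 𝒜) (P : Measure (Table 𝒞 𝒜 𝒵 𝒴)) : Measure (𝒞 × 𝒵 × 𝒴) :=
  P.map fun ω => (covC ω, potZ b ω, potY b ω)

end causal_assumptions

/-! ### Semiparametric efficiency -/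

/-- The curve `t ↦ p t` of probability mass functions is differentiable in quadratic mean at
`t = 0`, with the square integrable score `s`. -/
structure IsQMD {α : Type*} (p : ℝ → α → ℝ) (s : α → ℝ) : Prop where
  summable : Summable fun x => s x ^ 2 * p 0 x
  isLittleO : (fun t : ℝ => ∑' x, (√(p t x) - √(p 0 x) - t / 2 * s x * √(p 0 x)) ^ 2)
    =o[𝓝 0] fun t : ℝ => t ^ 2

section efficiency

variable {𝒞 𝒜 𝒵 : Type*} [MeasurableSpace 𝒞] [MeasurableSpace 𝒜] [MeasurableSpace 𝒵] {𝒴 : Set ℝ}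

/-- `t ↦ Q t` is a regular one-parameter submodel of the causal model through the true observed-data
law `μ`, with observed-data score `S`: near `t = 0` it stays in the model, the mass function of the
observed data is differentiable in quadratic mean with score `S`, and, for the two treatment levels
compared, the mass functions of `(C, Z(b), Y(b))` are differentiable in quadratic mean and the second
moments of `Y(b)` are locally bounded. -/
structure IsRegularSubmodel (as a : 𝒜) (μ : Measure (Obs 𝒞 𝒜 𝒵 𝒴))
    (Q : ℝ → Measure (Table 𝒞 𝒜 𝒵 𝒴)) (S : Obs 𝒞 𝒜 𝒵 𝒴 → ℝ) : Prop where
  inModel : ∀ᶠ t in 𝓝 (0 : ℝ), InModel (Q t)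
  base : obsLaw (Q 0) = μ
  score : IsQMD (fun t x => (obsLaw (Q t)).real {x}) S
  potential : ∀ b : 𝒜, b = as ∨ b = a → ∃ s, IsQMD (fun t v => (potLaw b (Q t)).real {v}) s
  moment : ∀ b : 𝒜, b = as ∨ b = a → ∃ K : ℝ, ∀ᶠ t in 𝓝 (0 : ℝ),
    MemLp (fun ω => (potY b ω : ℝ)) 2 (Q t) ∧ ∫ ω, (potY b ω : ℝ) ^ 2 ∂(Q t) ≤ K

/-- The tangent space at `μ`: the mean square closure of all linear combinations of scores of regular
submodels. -/
def tangentSpace (as a : 𝒜) (μ : Measure (Obs 𝒞 𝒜 𝒵 𝒴)) : Submodule ℝ (Lp ℝ 2 μ) :=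
  (Submodule.span ℝ {f : Lp ℝ 2 μ |
    ∃ Q S, IsRegularSubmodel as a μ Q S ∧ f =ᵐ[μ] S}).topologicalClosure

/-- The square integrable function `φ` is a gradient (influence function) of `θ` at `μ`: along every
regular submodel, the derivative of `θ` at the truth exists and equals `E(φ S)`. -/
def IsGradient (as a : 𝒜) (μ : Measure (Obs 𝒞 𝒜 𝒵 𝒴)) (φ : Lp ℝ 2 μ) : Prop :=
  ∀ Q S, IsRegularSubmodel as a μ Q S →
    HasDerivAt (fun t => ace as a (Q t)) (∫ x, φ x * S x ∂μ) 0

/-- `φ` is the efficient influence function of `θ` at `μ`: the parameter is pathwise differentiable,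
and `φ` is the orthogonal projection of an influence function onto the tangent space. -/
def IsEfficientInfluenceFunction (as a : 𝒜) (μ : Measure (Obs 𝒞 𝒜 𝒵 𝒴)) (φ : Lp ℝ 2 μ) : Prop :=
  ∃ φ₀ : Lp ℝ 2 μ, IsGradient as a μ φ₀ ∧
    φ ∈ tangentSpace as a μ ∧ φ₀ - φ ∈ (tangentSpace as a μ)ᗮ

/-- The Cramér–Rao bounds for `θ` in the regular submodels with nonzero information. -/
def cramerRaoBounds (as a : 𝒜) (μ : Measure (Obs 𝒞 𝒜 𝒵 𝒴)) : Set ℝ :=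
  {v | ∃ Q S d, IsRegularSubmodel as a μ Q S ∧ 0 < ∫ x, S x ^ 2 ∂μ ∧
    HasDerivAt (fun t => ace as a (Q t)) d 0 ∧ v = d ^ 2 / ∫ x, S x ^ 2 ∂μ}

/-- `B` is the semiparametric efficiency bound for `θ` at `μ`: the supremum of the Cramér–Rao bounds
for the regular parametric submodels. -/
def IsEfficiencyBound (as a : 𝒜) (μ : Measure (Obs 𝒞 𝒜 𝒵 𝒴)) (B : ℝ) : Prop :=
  IsLUB (cramerRaoBounds as a μ) B

end efficiency

/-! ### Functionals of the observed-data law -/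

section functionals

variable {𝒞 𝒜 𝒵 : Type*} [MeasurableSpace 𝒞] [MeasurableSpace 𝒜] [MeasurableSpace 𝒵] {𝒴 : Set ℝ}

/-- The event `C = c`. -/
def evC (c : 𝒞) : Set (Obs 𝒞 𝒜 𝒵 𝒴) := {x | x.1 = c}

/-- The event `A = a`. -/
def evA (a : 𝒜) : Set (Obs 𝒞 𝒜 𝒵 𝒴) := {x | x.2.1 = a}

/-- The event `Z = z`. -/
def evZ (z : 𝒵) : Set (Obs 𝒞 𝒜 𝒵 𝒴) := {x | x.2.2.1 = z}

/-- The event `Y = y`. -/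
def evY (y : 𝒴) : Set (Obs 𝒞 𝒜 𝒵 𝒴) := {x | x.2.2.2 = y}

/-- The outcome, as a real number. -/
def valY (x : Obs 𝒞 𝒜 𝒵 𝒴) : ℝ := (x.2.2.2 : ℝ)

/-- `p(c)`. -/
def pC (μ : Measure (Obs 𝒞 𝒜 𝒵 𝒴)) (c : 𝒞) : ℝ := μ.real (evC c)

/-- `p(a)`. -/
def pA (μ : Measure (Obs 𝒞 𝒜 𝒵 𝒴)) (a : 𝒜) : ℝ := μ.real (evA a)

/-- `p(a | c)`. -/
def pAC (μ : Measure (Obs 𝒞 𝒜 𝒵 𝒴)) (a : 𝒜) (c : 𝒞) : ℝ := (μ[|evC c]).real (evA a)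

/-- `p(z | a)`. -/
def pZA (μ : Measure (Obs 𝒞 𝒜 𝒵 𝒴)) (z : 𝒵) (a : 𝒜) : ℝ := (μ[|evA a]).real (evZ z)

/-- `p(y | z, c)`. -/
def pYZC (μ : Measure (Obs 𝒞 𝒜 𝒵 𝒴)) (y : 𝒴) (z : 𝒵) (c : 𝒞) : ℝ :=
  (μ[|evZ z ∩ evC c]).real (evY y)

/-- `E(Y | z, c)`. -/
def meanY (μ : Measure (Obs 𝒞 𝒜 𝒵 𝒴)) (z : 𝒵) (c : 𝒞) : ℝ :=
  ∫ x, valY x ∂(μ[|evZ z ∩ evC c])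

/-- `var(Y | z, c)`. -/
def varY (μ : Measure (Obs 𝒞 𝒜 𝒵 𝒴)) (z : 𝒵) (c : 𝒞) : ℝ :=
  variance valY (μ[|evZ z ∩ evC c])

/-- The indicator `I(a' = b)`. -/
def ind (b a' : 𝒜) : ℝ := ({b} : Set 𝒜).indicator 1 a'

/-- The function `φ_{bd,fd,td}`. -/
def phi (as a : 𝒜) (μ : Measure (Obs 𝒞 𝒜 𝒵 𝒴)) (θ : ℝ) : Obs 𝒞 𝒜 𝒵 𝒴 → ℝ :=
  fun (C, A, Z, Y) =>
    ((Y : ℝ) - meanY μ Z C) * (pZA μ Z as - pZA μ Z a) / (∑' b, pAC μ b C * pZA μ Z b)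
    + ∑' c, (meanY μ Z c - ∑' z, meanY μ z c * pZA μ z A) *
        ((ind as A - ind a A) * pC μ c / (∑' c', pC μ c' * pAC μ A c'))
    + ∑' z, meanY μ z C * (pZA μ z as - pZA μ z a) - θ

/-- The summands, over pairs `(z, c)`, of the first term of the efficiency bound:
`(p(z|a⋆) - p(z|a))² p(c) var(Y|z,c) / ∑_b p(b|c) p(z|b)`. -/
def boundSummand (as a : 𝒜) (μ : Measure (Obs 𝒞 𝒜 𝒵 𝒴)) (z : 𝒵) (c : 𝒞) : ℝ :=
  (pZA μ z as - pZA μ z a) ^ 2 * (pC μ c * varY μ z c / (∑' b, pAC μ b c * pZA μ z b))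

/-- The explicit efficiency bound. -/
def bound (as a : 𝒜) (μ : Measure (Obs 𝒞 𝒜 𝒵 𝒴)) (θ : ℝ) : ℝ :=
  ∑' z, (pZA μ z as - pZA μ z a) ^ 2 *
      ∑' c, pC μ c * varY μ z c / (∑' b, pAC μ b c * pZA μ z b)
  + ∑' z, pZA μ z as / pA μ as * (∑' c, pC μ c * meanY μ z c) ^ 2
  - (∑' zc : 𝒵 × 𝒞, meanY μ zc.1 zc.2 * pZA μ zc.1 as * pC μ zc.2) ^ 2 / pA μ as
  + ∑' z, pZA μ z a / pA μ a * (∑' c, pC μ c * meanY μ z c) ^ 2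
  - (∑' zc : 𝒵 × 𝒞, meanY μ zc.1 zc.2 * pZA μ zc.1 a * pC μ zc.2) ^ 2 / pA μ a
  + ∑' c, pC μ c * (∑' z, meanY μ z c * (pZA μ z as - pZA μ z a)) ^ 2
  - θ ^ 2

/-- `T_b = I(A = b) Y / p(b | C)`, the inverse-probability weighted outcome. -/
def ipwY (b : 𝒜) (μ : Measure (Obs 𝒞 𝒜 𝒵 𝒴)) (x : Obs 𝒞 𝒜 𝒵 𝒴) : ℝ :=
  ind b x.2.1 * valY x / pAC μ b x.1

/-- `E(Y | A = b, C = c)`. -/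
def adjMean (b : 𝒜) (μ : Measure (Obs 𝒞 𝒜 𝒵 𝒴)) (c : 𝒞) : ℝ :=
  ∫ x, valY x ∂(μ[|evA b ∩ evC c])

/-- The Rotnitzky–Smucler formula for the efficient influence function of `E Y(b)` in the Bayesian
network of the DAG with the edges `C → A`, `C → Y`, `A → Z`, `Z → Y`. The optimal adjustment set and
the minimal one are both `O = {C}`. Each non-descendant `W` of the treatment that is an ancestor of
the outcome (here `C`, without parents) contributes `E(E(Y|b,O) | W, pa(W)) - E(E(Y|b,O) | pa(W))`,
and each vertex `M` on the directed paths from the treatment to the outcome (here `Z` with parent `A`,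
and `Y` with parents `Z`, `C`) contributes `E(T_b | M, pa(M)) - E(T_b | pa(M))`. -/
def rsTerm (b : 𝒜) (μ : Measure (Obs 𝒞 𝒜 𝒵 𝒴)) : Obs 𝒞 𝒜 𝒵 𝒴 → ℝ :=
  fun (C, A, Z, Y) =>
    (adjMean b μ C - ∫ x, adjMean b μ x.1 ∂μ)
    + ((∫ x, ipwY b μ x ∂(μ[|evZ Z ∩ evA A])) - ∫ x, ipwY b μ x ∂(μ[|evA A]))
    + ((∫ x, ipwY b μ x ∂(μ[|evY Y ∩ (evZ Z ∩ evC C)]))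
      - ∫ x, ipwY b μ x ∂(μ[|evZ Z ∩ evC C]))

/-- The Rotnitzky–Smucler efficient influence function of `E Y(a⋆) - E Y(a)` in that network. -/
def rsEIF (as a : 𝒜) (μ : Measure (Obs 𝒞 𝒜 𝒵 𝒴)) (x : Obs 𝒞 𝒜 𝒵 𝒴) : ℝ :=
  rsTerm as μ x - rsTerm a μ x

end functionals

end Causal

end

open Causal

/-! The causal assumptions make the mediator `Z(b)` independent of `(C, A)` and make the law of
`Y(b, z)` given `C` free of the treatment. Hence the observed mass is p(c,a) p(z|a) p(y|z,c), and
the mass of `(C, Z(b), Y(b))` is p(c) p(z|b) p(y|z,c) with the same factors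
(`InModel.exists_factors`, `InModel.potLaw_real_singleton`). So θ is a functional of the observed
law, and the model puts no other restriction on the three factors: any full-support choice of them
is realized by the independent tables of `tableLaw` (`inModel_tableLaw`).

Differentiability. Along a regular submodel the score of `(C, Z(b), Y(b))` is the sum of the scores
of its factors, each a difference of conditional means of the observed score S. Pairing with `Y(b)`
and regrouping the series turns the derivative of θ into E(φS) (`IsRegularSubmodel.hasDerivAt_ace`).
Here φ splits into parts depending on (C,Z,Y), (A,Z) and C, with conditional mean zero given
(C,A,Z), given (C,A), and given nothing. This nested structure gives the variance by Pythagoras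
(`Factorizes.variance_phi`) and makes the parts recognizable as the Rotnitzky–Smucler terms.

Efficiency. Bounded linear tilts of the three factors are scores of regular submodels
(`IsTilt.exists_isRegularSubmodel`). An L² function orthogonal to all of them, in particular to
centred indicators, is orthogonal to each part of φ, so φ lies in the closure of the tilts
(`Factorizes.phi_mem_closure`). Thus φ is at once a gradient and an element of the tangent space,
that is, the efficient influence function. Cauchy–Schwarz bounds every Cramér–Rao bound by E φ², and
approximating φ by tilts shows that this is the supremum
(`Factorizes.isEfficiencyBound_integral_sq`). -/

noncomputable section

set_option linter.unusedSectionVars false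

namespace Causal

/-! ### Cauchy–Schwarz and weak convergence in ℓ². -/

section square_summable

variable {α : Type*}

/-- Cauchy–Schwarz for series. -/
theorem summable_mul_of_sq {u v : α → ℝ} (hu : Summable fun x => u x ^ 2)
    (hv : Summable fun x => v x ^ 2) : Summable fun x => u x * v x := by
  refine Summable.of_norm_bounded (g := fun x => u x ^ 2 + v x ^ 2) (hu.add hv) fun x => ?_
  rw [Real.norm_eq_abs, abs_le]
  constructor <;> nlinarith [sq_nonneg (u x + v x), sq_nonneg (u x - v x)]

theorem sq_tsum_mul_le {u v : α → ℝ} (hu : Summable fun x => u x ^ 2)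
    (hv : Summable fun x => v x ^ 2) :
    (∑' x, u x * v x) ^ 2 ≤ (∑' x, u x ^ 2) * ∑' x, v x ^ 2 := by
  have h := (summable_mul_of_sq hu hv).hasSum
  refine le_of_tendsto (h.pow 2) (Eventually.of_forall fun s => ?_)
  calc (∑ x ∈ s, u x * v x) ^ 2 ≤ (∑ x ∈ s, u x ^ 2) * ∑ x ∈ s, v x ^ 2 :=
        Finset.sum_mul_sq_le_sq_mul_sq s u v
    _ ≤ _ := mul_le_mul (hu.sum_le_tsum s fun _ _ => sq_nonneg _)
        (hv.sum_le_tsum s fun _ _ => sq_nonneg _) (Finset.sum_nonneg fun _ _ => sq_nonneg _)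
        (tsum_nonneg fun _ => sq_nonneg _)

/-- Bounded sequences in `ℓ²` that converge to zero pointwise converge to zero weakly. -/
theorem tendsto_tsum_mul_zero {ι : Type*} {l : Filter ι} {u : α → ℝ} {v : ι → α → ℝ} {K : ℝ}
    (hu : Summable fun x => u x ^ 2) (hv : ∀ᶠ t in l, Summable fun x => v t x ^ 2)
    (hK : ∀ᶠ t in l, ∑' x, v t x ^ 2 ≤ K) (h0 : ∀ x, Tendsto (fun t => v t x) l (𝓝 0)) :
    Tendsto (fun t => ∑' x, u x * v t x) l (𝓝 0) := by
  rw [Metric.tendsto_nhds]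
  intro ε hε
  set L := |K| + 1 with hL
  have hLpos : 0 < L := by positivity
  have hδ : 0 < (ε / 2) ^ 2 / L := by positivity
  -- Outside a finite set `s` the tail of u² is small enough that Cauchy–Schwarz bounds the tail of
  -- the pairing by ε/2 uniformly in t; on `s` pointwise convergence suffices.
  obtain ⟨s, hs⟩ := ((tendsto_order.1 (tendsto_tsum_compl_atTop_zero fun x => u x ^ 2)).2 _
    hδ).exists
  have hfin : Tendsto (fun t => ∑ x ∈ s, u x * v t x) l (𝓝 0) := by
    have := tendsto_finsetSum s fun x _ => (h0 x).const_mul (u x)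
    simpa using this
  filter_upwards [hv, hK, (Metric.tendsto_nhds.1 hfin) (ε / 2) (by positivity)] with t h1 h2 h3
  have h3' : |∑ x ∈ s, u x * v t x| < ε / 2 := by simpa [Real.dist_eq] using h3
  have hsplit := (summable_mul_of_sq hu h1).sum_add_tsum_subtype_compl s
  have hcs := sq_tsum_mul_le (u := fun x : {x // x ∉ s} => u x) (v := fun x : {x // x ∉ s} => v t x)
    (hu.subtype _) (h1.subtype _)
  have hvs : ∑' x : {x // x ∉ s}, v t x ^ 2 ≤ L := by
    have h4 := h1.sum_add_tsum_subtype_compl s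
    have h5 : 0 ≤ ∑ x ∈ s, v t x ^ 2 := Finset.sum_nonneg fun _ _ => sq_nonneg _
    have h6 := le_abs_self K
    linarith
  have hlt : (∑' x : {x // x ∉ s}, u x * v t x) ^ 2 < (ε / 2) ^ 2 := by
    have h8 : 0 ≤ ∑' x : {x // x ∉ s}, u x ^ 2 := tsum_nonneg fun _ => sq_nonneg _
    calc _ ≤ _ := hcs
      _ ≤ (∑' x : {x // x ∉ s}, u x ^ 2) * L := mul_le_mul_of_nonneg_left hvs h8
      _ < (ε / 2) ^ 2 / L * L := mul_lt_mul_of_pos_right hs hLpos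
      _ = _ := div_mul_cancel₀ _ hLpos.ne'
  have habs := abs_lt_of_sq_lt_sq hlt (by positivity)
  rw [Real.dist_eq, sub_zero, ← hsplit]
  calc _ ≤ |∑ x ∈ s, u x * v t x| + |∑' x : {x // x ∉ s}, u x * v t x| := abs_add_le _ _
    _ < ε / 2 + ε / 2 := add_lt_add h3' habs
    _ = ε := add_halves ε

end square_summable

/-! ### Differentiation of expectations along curves that are differentiable in quadratic mean. -/

section quadratic_mean

variable {α : Type*} {p : ℝ → α → ℝ} {s : α → ℝ}

/-- The remainder in the definition of differentiability in quadratic mean. -/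
def qmdRem (p : ℝ → α → ℝ) (s : α → ℝ) (t : ℝ) (x : α) : ℝ :=
  √(p t x) - √(p 0 x) - t / 2 * s x * √(p 0 x)

theorem summable_sq_sub {u v : α → ℝ} (hu : Summable fun x => u x ^ 2)
    (hv : Summable fun x => v x ^ 2) : Summable fun x => (u x - v x) ^ 2 := by
  refine Summable.of_nonneg_of_le (fun x => sq_nonneg _) (fun x => ?_)
    ((hu.mul_left 2).add (hv.mul_left 2))
  nlinarith [sq_nonneg (u x + v x)]

theorem summable_sq_add {u v : α → ℝ} (hu : Summable fun x => u x ^ 2)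
    (hv : Summable fun x => v x ^ 2) : Summable fun x => (u x + v x) ^ 2 := by
  refine Summable.of_nonneg_of_le (fun x => sq_nonneg _) (fun x => ?_)
    ((hu.mul_left 2).add (hv.mul_left 2))
  nlinarith [sq_nonneg (u x - v x)]

theorem tsum_sq_sub_le {u v : α → ℝ} (hu : Summable fun x => u x ^ 2)
    (hv : Summable fun x => v x ^ 2) :
    ∑' x, (u x - v x) ^ 2 ≤ 2 * ∑' x, u x ^ 2 + 2 * ∑' x, v x ^ 2 := by
  rw [← tsum_mul_left, ← tsum_mul_left, ← (hu.mul_left 2).tsum_add (hv.mul_left 2)]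
  refine (summable_sq_sub hu hv).tsum_le_tsum (fun x => ?_) ((hu.mul_left 2).add (hv.mul_left 2))
  nlinarith [sq_nonneg (u x + v x)]

theorem tsum_sq_add_le {u v : α → ℝ} (hu : Summable fun x => u x ^ 2)
    (hv : Summable fun x => v x ^ 2) :
    ∑' x, (u x + v x) ^ 2 ≤ 2 * ∑' x, u x ^ 2 + 2 * ∑' x, v x ^ 2 := by
  rw [← tsum_mul_left, ← tsum_mul_left, ← (hu.mul_left 2).tsum_add (hv.mul_left 2)]
  refine (summable_sq_add hu hv).tsum_le_tsum (fun x => ?_) ((hu.mul_left 2).add (hv.mul_left 2))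
  nlinarith [sq_nonneg (u x - v x)]

variable (hs : IsQMD p s) (hp : ∀ᶠ t in 𝓝 (0 : ℝ), (∀ x, 0 ≤ p t x) ∧ Summable (p t))

include hs hp

/-- A divergent `tsum` is 0 by convention, so the little-o in `IsQMD` says something only together
with this summability. It holds because √(p t), √(p 0) and s√(p 0) all lie in ℓ². -/
theorem IsQMD.summable_qmdRem_sq : ∀ᶠ t in 𝓝 (0 : ℝ), Summable fun x => qmdRem p s t x ^ 2 := by
  have h0 := hp.self_of_nhds
  filter_upwards [hp] with t ht
  refine summable_sq_sub (summable_sq_sub ?_ ?_) ?_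
  · simpa only [Real.sq_sqrt (ht.1 _)] using ht.2
  · simpa only [Real.sq_sqrt (h0.1 _)] using h0.2
  · convert! hs.summable.mul_left ((t / 2) ^ 2) using 2 with x
    rw [mul_pow, mul_pow, Real.sq_sqrt (h0.1 x)]
    ring

/-- One squared term is at most the whole sum of squares, which is o(t²). -/
theorem IsQMD.qmdRem_isLittleO (x : α) : (fun t => qmdRem p s t x) =o[𝓝 0] fun t : ℝ => t := by
  rw [isLittleO_iff]
  intro c hc
  filter_upwards [hs.summable_qmdRem_sq hp, (isLittleO_iff.1 hs.isLittleO) (pow_pos hc 2)]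
    with t h1 h2
  have h3 : qmdRem p s t x ^ 2 ≤ ∑' x, qmdRem p s t x ^ 2 :=
    h1.le_tsum x fun _ _ => sq_nonneg _
  have h4 : ∑' x, qmdRem p s t x ^ 2 ≤ c ^ 2 * t ^ 2 := by
    refine (le_abs_self _).trans (h2.trans_eq ?_)
    rw [Real.norm_eq_abs, abs_of_nonneg (sq_nonneg t)]
  rw [Real.norm_eq_abs, Real.norm_eq_abs]
  refine abs_le_of_sq_le_sq' ?_ (by positivity) |> abs_le.2
  rw [mul_pow, sq_abs]
  exact h3.trans h4

theorem IsQMD.tendsto_sqrt (x : α) : Tendsto (fun t => √(p t x) - √(p 0 x)) (𝓝 0) (𝓝 0) := by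
  have h1 : Tendsto (fun t => qmdRem p s t x) (𝓝 0) (𝓝 0) :=
    (hs.qmdRem_isLittleO hp x).trans_tendsto tendsto_id
  have h2 : Tendsto (fun t : ℝ => t / 2 * s x * √(p 0 x)) (𝓝 0) (𝓝 0) := by
    have : Continuous fun t : ℝ => t / 2 * s x * √(p 0 x) := by fun_prop
    simpa using this.tendsto 0
  have h3 := h1.add h2
  rw [add_zero] at h3
  refine h3.congr fun t => ?_
  rw [qmdRem]
  ring

/-- Along a curve that is differentiable in quadratic mean, the expectation of a function with
locally bounded second moment is differentiable. -/
theorem IsQMD.hasDerivAt_tsum {f : α → ℝ} {K : ℝ}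
    (hf : ∀ᶠ t in 𝓝 (0 : ℝ), Summable fun x => f x ^ 2 * p t x)
    (hK : ∀ᶠ t in 𝓝 (0 : ℝ), ∑' x, f x ^ 2 * p t x ≤ K) :
    HasDerivAt (fun t => ∑' x, f x * p t x) (∑' x, f x * (s x * p 0 x)) 0 := by
  have hp0 := hp.self_of_nhds
  have hf0 := hf.self_of_nhds
  have hK0 := hK.self_of_nhds
  have hsq : ∀ t, (∀ x, 0 ≤ p t x) → ∀ x, (f x * √(p t x)) ^ 2 = f x ^ 2 * p t x :=
    fun t h x => by rw [mul_pow, Real.sq_sqrt (h x)]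
  have hf0' : Summable fun x => (f x * √(p 0 x)) ^ 2 := by
    simpa only [hsq 0 hp0.1] using hf0
  have hs0 : Summable fun x => (s x * √(p 0 x)) ^ 2 := by
    simpa only [mul_pow, Real.sq_sqrt (hp0.1 _)] using hs.summable
  have hfsum : ∀ t, (∀ x, 0 ≤ p t x) → Summable (p t) → (Summable fun x => f x ^ 2 * p t x) →
      Summable fun x => f x * p t x := by
    intro t h1 h2 h3
    have := summable_mul_of_sq (u := fun x => f x * √(p t x)) (v := fun x => √(p t x))
      (by simpa only [hsq t h1] using h3) (by simpa only [Real.sq_sqrt (h1 _)] using h2)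
    refine this.congr fun x => ?_
    rw [mul_assoc, Real.mul_self_sqrt (h1 x)]
  have hfs : Summable fun x => f x * (s x * p 0 x) := by
    refine (summable_mul_of_sq hf0' hs0).congr fun x => ?_
    have := Real.mul_self_sqrt (hp0.1 x)
    linear_combination (f x * s x) * this
  -- As f may be unbounded, f√(p t) is only known to be bounded in ℓ² and to converge pointwise.
  -- That is weak convergence, which is enough when it is paired with the fixed vector s√(p 0).
  have hw : Tendsto (fun t => ∑' x, (s x * √(p 0 x)) * (f x * √(p t x) - f x * √(p 0 x)))
      (𝓝 0) (𝓝 0) := by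
    refine tendsto_tsum_mul_zero (K := 2 * K + 2 * K) hs0 ?_ ?_ fun x => ?_
    · filter_upwards [hp, hf] with t h1 h2
      exact summable_sq_sub (by simpa only [hsq t h1.1] using h2) hf0'
    · filter_upwards [hp, hf, hK] with t h1 h2 h3
      have h4 := tsum_sq_sub_le (u := fun x => f x * √(p t x)) (v := fun x => f x * √(p 0 x))
        (by simpa only [hsq t h1.1] using h2) hf0'
      simp only [hsq t h1.1, hsq 0 hp0.1] at h4
      linarith
    · have := (hs.tendsto_sqrt hp x).const_mul (f x)
      simpa [mul_sub] using this
  rw [hasDerivAt_iff_isLittleO]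
  -- Factor p t − p 0 = (√(p t) + √(p 0))(√(p t) − √(p 0)), replace the second factor by the
  -- remainder plus (t/2) s√(p 0), and write √(p t) + √(p 0) there as 2√(p 0) plus the increment.
  have hmain : ∀ᶠ t in 𝓝 (0 : ℝ), ∑' x, f x * p t x - ∑' x, f x * p 0 x
      - (t - 0) • ∑' x, f x * (s x * p 0 x)
      = ∑' x, (f x * √(p t x) + f x * √(p 0 x)) * qmdRem p s t x
        + t * (1 / 2 * ∑' x, (s x * √(p 0 x)) * (f x * √(p t x) - f x * √(p 0 x))) := by
    filter_upwards [hp, hf, hs.summable_qmdRem_sq hp] with t h1 h2 h3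
    have h2' : Summable fun x => (f x * √(p t x)) ^ 2 := by simpa only [hsq t h1.1] using h2
    rw [sub_zero, smul_eq_mul, ← tsum_mul_left, ← tsum_mul_left, ← tsum_mul_left,
      ← (hfsum t h1.1 h1.2 h2).tsum_sub (hfsum 0 hp0.1 hp0.2 hf0),
      ← ((hfsum t h1.1 h1.2 h2).sub (hfsum 0 hp0.1 hp0.2 hf0)).tsum_sub (hfs.mul_left t),
      ← (summable_mul_of_sq (summable_sq_add h2' hf0') h3).tsum_add
        (((summable_mul_of_sq hs0 (summable_sq_sub h2' hf0')).mul_left _).mul_left _)]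
    refine tsum_congr fun x => ?_
    have e1 := Real.mul_self_sqrt (h1.1 x)
    have e2 := Real.mul_self_sqrt (hp0.1 x)
    rw [qmdRem]
    linear_combination (-f x) * e1 + (f x + t * f x * s x) * e2
  refine IsLittleO.congr' ?_ (hmain.mono fun t h => h.symm)
    (Eventually.of_forall fun t => (sub_zero t).symm)
  refine IsLittleO.add ?_ ?_
  · rw [isLittleO_iff]
    intro c hc
    set L := |K| + 1
    have hL : 0 < L := by positivity
    -- The squared norm of f(√(p t) + √(p 0)) is at most 2K + 2K ≤ 4L, so this constant makes the
    -- Cauchy–Schwarz product equal to c²t².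
    have hc' : 0 < c ^ 2 / (4 * L) := by positivity
    filter_upwards [hp, hf, hK, hs.summable_qmdRem_sq hp, (isLittleO_iff.1 hs.isLittleO) hc']
      with t h1 h2 h3 h4 h5
    have h2' : Summable fun x => (f x * √(p t x)) ^ 2 := by simpa only [hsq t h1.1] using h2
    have h6 := sq_tsum_mul_le (summable_sq_add h2' hf0') h4
    have h7 := tsum_sq_add_le h2' hf0'
    simp only [hsq t h1.1, hsq 0 hp0.1] at h7
    have h8 : ∑' x, (f x * √(p t x) + f x * √(p 0 x)) ^ 2 ≤ 4 * L := by
      have := le_abs_self K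
      linarith
    have h9 : ∑' x, qmdRem p s t x ^ 2 ≤ c ^ 2 / (4 * L) * t ^ 2 := by
      refine (le_abs_self _).trans (h5.trans_eq ?_)
      rw [Real.norm_eq_abs, abs_of_nonneg (sq_nonneg t)]
    rw [Real.norm_eq_abs, Real.norm_eq_abs]
    refine abs_le_of_sq_le_sq' ?_ (by positivity) |> abs_le.2
    rw [mul_pow, sq_abs]
    calc _ ≤ _ := h6
      _ ≤ (4 * L) * (c ^ 2 / (4 * L) * t ^ 2) := mul_le_mul h8 h9
          (tsum_nonneg fun _ => sq_nonneg _) (by positivity)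
      _ = _ := by field_simp
  · have h1 := (hw.const_mul (1 / 2)).congr fun t => rfl
    rw [mul_zero] at h1
    have h2 : (fun t : ℝ => 1 / 2 * ∑' x, (s x * √(p 0 x)) * (f x * √(p t x) - f x * √(p 0 x)))
        =o[𝓝 0] fun _ => (1 : ℝ) := (isLittleO_one_iff ℝ).2 h1
    simpa using (isBigO_refl (fun t : ℝ => t) (𝓝 0)).mul_isLittleO h2

end quadratic_mean

/-! ### Integrals and masses as series over the values of a countable variable. -/

section fibers

variable {Ω α β : Type*} [MeasurableSpace Ω] {μ : Measure Ω}
  [MeasurableSpace α] [DiscreteMeasurableSpace α] {ν : Measure α}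
  [Countable β]

theorem hasSum_setIntegral_fiber (X : α → β) (E : Set α) {f : α → ℝ} (hf : IntegrableOn f E ν) :
    HasSum (fun b => ∫ x in E ∩ X ⁻¹' {b}, f x ∂ν) (∫ x in E, f x ∂ν) := by
  have hU : ⋃ b, E ∩ X ⁻¹' {b} = E := by
    ext x
    simp
  have h := hasSum_integral_iUnion (f := f) (μ := ν) (s := fun b => E ∩ X ⁻¹' {b})
    (fun b => .of_discrete) (fun b b' hb => ?_) (by rwa [hU])
  · rwa [hU] at h
  · refine Set.disjoint_left.2 fun x hx hx' => hb ?_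
    exact hx.2.symm.trans hx'.2

theorem setIntegral_fiber_mul (X : α → β) (g : β → ℝ) (f : α → ℝ) (b : β) :
    ∫ x in X ⁻¹' {b}, g (X x) * f x ∂ν = g b * ∫ x in X ⁻¹' {b}, f x ∂ν := by
  rw [← integral_const_mul]
  refine setIntegral_congr_fun .of_discrete fun x hx => ?_
  rw [Set.mem_preimage, Set.mem_singleton_iff] at hx
  simp only [hx]

theorem hasSum_integral_fiber (X : α → β) (g : β → ℝ) {f : α → ℝ}
    (hf : Integrable (fun x => g (X x) * f x) ν) :
    HasSum (fun b => g b * ∫ x in X ⁻¹' {b}, f x ∂ν) (∫ x, g (X x) * f x ∂ν) := by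
  have h := hasSum_setIntegral_fiber X Set.univ hf.integrableOn
  simpa only [Set.univ_inter, setIntegral_univ, setIntegral_fiber_mul] using h

theorem hasSum_measureReal_fiber [IsFiniteMeasure ν] (X : α → β) (E : Set α) :
    HasSum (fun b => ν.real (E ∩ X ⁻¹' {b})) (ν.real E) := by
  have h := hasSum_setIntegral_fiber (ν := ν) X E (f := fun _ => 1) (integrable_const _)
  simpa using h

variable [MeasurableSpace β] [MeasurableSingletonClass β]

theorem integrable_comp_iff [IsFiniteMeasure μ] {X : Ω → β} (hX : Measurable X) (g : β → ℝ) :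
    Integrable (fun ω => g (X ω)) μ ↔ Summable fun b => g b * μ.real (X ⁻¹' {b}) := by
  have h1 : Integrable (fun ω => g (X ω)) μ ↔ Integrable g (μ.map X) :=
    (integrable_map_measure (Measurable.of_discrete).aestronglyMeasurable hX.aemeasurable).symm
  rw [h1, ← Measure.sum_smul_dirac (μ.map X), integrable_sum_dirac_iff fun b => measure_ne_top _ _]
  refine (summable_congr fun b => ?_).trans summable_abs_iff
  rw [Measure.map_apply hX (measurableSet_singleton b), abs_mul, mul_comm, Real.norm_eq_abs,
    abs_of_nonneg measureReal_nonneg]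
  rfl

/-- No integrability is required: when the series is not absolutely convergent, both sides take the
default value 0. -/
theorem integral_comp_eq_tsum [IsFiniteMeasure μ] {X : Ω → β} (hX : Measurable X) (g : β → ℝ) :
    ∫ ω, g (X ω) ∂μ = ∑' b, g b * μ.real (X ⁻¹' {b}) := by
  rw [← integral_map (f := g) hX.aemeasurable (Measurable.of_discrete).aestronglyMeasurable,
    ← Measure.sum_smul_dirac (μ.map X), integral_sum_dirac fun b => measure_ne_top _ _]
  refine tsum_congr fun b => ?_
  rw [Measure.map_apply hX (measurableSet_singleton b), smul_eq_mul, mul_comm]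
  rfl

/-- The restriction of μ to E is pushed forward to the countable space of values, so E itself need
not be measurable. -/
theorem hasSum_measureReal_inter_fiber [IsFiniteMeasure μ] {X : Ω → β} (hX : Measurable X)
    (E : Set Ω) : HasSum (fun b => μ.real (E ∩ X ⁻¹' {b})) (μ.real E) := by
  have h := hasSum_measureReal_fiber (ν := (μ.restrict E).map X) id Set.univ
  simp only [Set.univ_inter, Set.preimage_id_eq, id] at h
  convert! h using 1
  · ext b
    rw [measureReal_def, measureReal_def, Measure.map_apply hX (measurableSet_singleton b),
      Measure.restrict_apply (hX (measurableSet_singleton b)), Set.inter_comm]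
  · rw [measureReal_def, measureReal_def, Measure.map_apply hX .univ]
    simp

end fibers

/-! ### The causal assumptions as a factorization. -/

section model

/-- Clearing denominators keeps the identity valid when the conditioning event is null: then both
sides vanish. -/
theorem CondIndepGiven.real_mul {Ω α β γ : Type*} [MeasurableSpace Ω] [MeasurableSpace α]
    [MeasurableSpace β] {P : Measure Ω} [IsFiniteMeasure P] {X : Ω → α} {Y : Ω → β} {W : Ω → γ}
    (h : CondIndepGiven P X Y W) {w : γ} (hW : MeasurableSet (W ⁻¹' {w})) {s : Set α} {t : Set β}
    (hs : MeasurableSet s) (ht : MeasurableSet t) :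
    P.real (W ⁻¹' {w} ∩ (X ⁻¹' s ∩ Y ⁻¹' t)) * P.real (W ⁻¹' {w}) =
      P.real (W ⁻¹' {w} ∩ X ⁻¹' s) * P.real (W ⁻¹' {w} ∩ Y ⁻¹' t) := by
  have h1 := congrArg ENNReal.toReal ((h w).measure_inter_preimage_eq_mul s t hs ht)
  rw [ENNReal.toReal_mul, cond_apply hW, cond_apply hW, cond_apply hW, ENNReal.toReal_mul,
    ENNReal.toReal_mul, ENNReal.toReal_mul, ENNReal.toReal_inv] at h1
  simp only [← measureReal_def] at h1
  by_cases h0 : P.real (W ⁻¹' {w}) = 0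
  · have h2 : P.real (W ⁻¹' {w} ∩ X ⁻¹' s) = 0 :=
      le_antisymm ((measureReal_mono Set.inter_subset_left).trans_eq h0) measureReal_nonneg
    rw [h0, h2, mul_zero, zero_mul]
  · field_simp at h1
    linarith

variable {𝒞 𝒜 𝒵 : Type*} {𝒴 : Set ℝ}
    [Countable 𝒞] [MeasurableSpace 𝒞] [MeasurableSingletonClass 𝒞]
    [Countable 𝒜] [MeasurableSpace 𝒜] [MeasurableSingletonClass 𝒜]
    [Countable 𝒵] [MeasurableSpace 𝒵] [MeasurableSingletonClass 𝒵]
    [Countable 𝒴]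

@[fun_prop]
theorem measurable_covC : Measurable (covC : Table 𝒞 𝒜 𝒵 𝒴 → 𝒞) := measurable_fst

@[fun_prop]
theorem measurable_trtA : Measurable (trtA : Table 𝒞 𝒜 𝒵 𝒴 → 𝒜) := measurable_snd.fst

@[fun_prop]
theorem measurable_potZ (a : 𝒜) : Measurable (potZ a : Table 𝒞 𝒜 𝒵 𝒴 → 𝒵) :=
  (measurable_pi_apply a).comp measurable_snd.snd.fst

@[fun_prop]
theorem measurable_potYZ (a : 𝒜) (z : 𝒵) : Measurable (potYZ a z : Table 𝒞 𝒜 𝒵 𝒴 → 𝒴) :=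
  (measurable_pi_apply z).comp ((measurable_pi_apply a).comp measurable_snd.snd.snd)

theorem measurable_eval_countable {Ω ι β : Type*} [MeasurableSpace Ω] [Countable ι]
    [MeasurableSpace ι] [MeasurableSingletonClass ι] [MeasurableSpace β] {f : Ω → ι}
    {g : ι → Ω → β} (hf : Measurable f) (hg : ∀ i, Measurable (g i)) :
    Measurable fun ω => g (f ω) ω := by
  have h : Measurable fun x : ι × Ω => g x.1 x.2 := measurable_from_prod_countable_right hg
  exact h.comp (hf.prodMk measurable_id)

@[fun_prop]
theorem measurable_potY (a : 𝒜) : Measurable (potY a : Table 𝒞 𝒜 𝒵 𝒴 → 𝒴) :=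
  measurable_eval_countable (g := fun z => potYZ a z) (measurable_potZ a) (measurable_potYZ a)

@[fun_prop]
theorem measurable_medZ : Measurable (medZ : Table 𝒞 𝒜 𝒵 𝒴 → 𝒵) :=
  measurable_eval_countable measurable_trtA measurable_potZ

@[fun_prop]
theorem measurable_outY : Measurable (outY : Table 𝒞 𝒜 𝒵 𝒴 → 𝒴) :=
  measurable_eval_countable measurable_trtA measurable_potY

@[fun_prop]
theorem measurable_observed : Measurable (observed : Table 𝒞 𝒜 𝒵 𝒴 → Obs 𝒞 𝒜 𝒵 𝒴) :=
  measurable_covC.prodMk (measurable_trtA.prodMk (measurable_medZ.prodMk measurable_outY))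

theorem obsLaw_real (P : Measure (Table 𝒞 𝒜 𝒵 𝒴)) (E : Set (Obs 𝒞 𝒜 𝒵 𝒴)) :
    (obsLaw P).real E = P.real (observed ⁻¹' E) := by
  rw [obsLaw, measureReal_def, Measure.map_apply measurable_observed .of_discrete]
  rfl

theorem potLaw_real (b : 𝒜) (P : Measure (Table 𝒞 𝒜 𝒵 𝒴)) (E : Set (𝒞 × 𝒵 × 𝒴)) :
    (potLaw b P).real E = P.real ((fun ω => (covC ω, potZ b ω, potY b ω)) ⁻¹' E) := by
  rw [potLaw, measureReal_def, Measure.map_apply (by fun_prop) .of_discrete]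
  rfl

/-- The law of `(C, A, Z, Y)` and the laws of `(C, Z(b), Y(b))` factorize along the graph with the
edges `C → A`, `C → Y`, `A → Z`, `Z → Y`, with common factors. -/
theorem InModel.exists_factors {P : Measure (Table 𝒞 𝒜 𝒵 𝒴)} (hP : InModel P) :
    ∃ (ρ : 𝒞 → 𝒜 → ℝ) (ζ : 𝒜 → 𝒵 → ℝ) (η : 𝒞 → 𝒵 → 𝒴 → ℝ),
      (∀ a, HasSum (ζ a) 1) ∧ (∀ c z, HasSum (η c z) 1) ∧
      (∀ c a z y, (obsLaw P).real {(c, a, z, y)} = ρ c a * ζ a z * η c z y) ∧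
      (∀ c b z y, HasSum (fun a => ρ c a * ζ b z * η c z y) ((potLaw b P).real {(c, z, y)})) := by
  have := hP.isProbabilityMeasure
  obtain ⟨a₀⟩ : Nonempty 𝒜 := by
    obtain ⟨ω⟩ : Nonempty (Table 𝒞 𝒜 𝒵 𝒴) := P.nonempty_of_neZero
    exact ⟨ω.2.1⟩
  have hpos : ∀ (c : 𝒞) (a : 𝒜), 0 < P.real (trtA ⁻¹' {a} ∩ covC ⁻¹' {c}) := by
    intro c a
    obtain ⟨ω⟩ : Nonempty (Table 𝒞 𝒜 𝒵 𝒴) := P.nonempty_of_neZero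
    refine ENNReal.toReal_pos ((hP.positivity a (potY a ω) a (medZ ω) c).trans_le
      (measure_mono ?_)).ne' (measure_ne_top _ _)
    rintro x ⟨_, hx, _, hx'⟩
    exact ⟨hx, hx'⟩
  have hposA : ∀ (a : 𝒜) (c : 𝒞), 0 < P.real (trtA ⁻¹' {a} : Set (Table 𝒞 𝒜 𝒵 𝒴)) :=
    fun a c => (hpos c a).trans_le (measureReal_mono Set.inter_subset_left)
  have hposC : ∀ c : 𝒞, 0 < P.real (covC ⁻¹' {c} : Set (Table 𝒞 𝒜 𝒵 𝒴)) :=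
    fun c => (hpos c a₀).trans_le (measureReal_mono Set.inter_subset_right)
  have hm1 : ∀ c : 𝒞, MeasurableSet (covC ⁻¹' {c} : Set (Table 𝒞 𝒜 𝒵 𝒴)) :=
    fun c => measurable_covC (measurableSet_singleton c)
  have hm2 : ∀ a : 𝒜, MeasurableSet (trtA ⁻¹' {a} : Set (Table 𝒞 𝒜 𝒵 𝒴)) :=
    fun a => measurable_trtA (measurableSet_singleton a)
  set ζ : 𝒜 → 𝒵 → ℝ := fun b z => P.real (potZ b ⁻¹' {z} : Set (Table 𝒞 𝒜 𝒵 𝒴)) with hζ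
  -- The reference level a₀ is arbitrary, since Y(a, z) is almost surely the same for all a.
  set η : 𝒞 → 𝒵 → 𝒴 → ℝ := fun c z y =>
    P.real (covC ⁻¹' {c} ∩ potYZ a₀ z ⁻¹' {y} : Set (Table 𝒞 𝒜 𝒵 𝒴)) /
      P.real (covC ⁻¹' {c} : Set (Table 𝒞 𝒜 𝒵 𝒴)) with hη
  set ρ : 𝒞 → 𝒜 → ℝ := fun c a => P.real (trtA ⁻¹' {a} ∩ covC ⁻¹' {c}) with hρ
  -- Contraction: Z(b) ⊥ A and Z(b) ⊥ C | A together give Z(b) ⊥ (A, C).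
  have hzca : ∀ c a b z, P.real (trtA ⁻¹' {a} ∩ covC ⁻¹' {c} ∩ potZ b ⁻¹' {z}) = ρ c a * ζ b z := by
    intro c a b z
    have h1 := (hP.med_indep_cov b).real_mul (hm2 a) (measurableSet_singleton z)
      (measurableSet_singleton c)
    have h2 := congrArg ENNReal.toReal ((hP.frontDoor.fd2 b).measure_inter_preimage_eq_mul
      {z} {a} (measurableSet_singleton z) (measurableSet_singleton a))
    rw [ENNReal.toReal_mul] at h2
    simp only [← measureReal_def] at h2
    rw [Set.inter_comm (trtA ⁻¹' {a}) (potZ b ⁻¹' {z}), h2] at h1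
    have h3 := (hposA a c).ne'
    rw [Set.inter_assoc, Set.inter_comm (covC ⁻¹' {c})]
    refine mul_right_cancel₀ h3 (h1.trans ?_)
    simp only [hρ, hζ]
    ring
  -- The received treatment a, the mediator level b and the outcome level b' are kept separate:
  -- `td3` splits off Z(b), `joint` removes the dependence on a, and `fd1` that on b'. Taking a = b
  -- = b' gives the observed law; taking b = b' and summing over a gives the law of (C, Z(b), Y(b)).
  have hkey : ∀ c a b b' z y, P.real (trtA ⁻¹' {a} ∩ covC ⁻¹' {c} ∩
      (potYZ b' z ⁻¹' {y} ∩ potZ b ⁻¹' {z})) = ρ c a * ζ b z * η c z y := by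
    intro c a b b' z y
    have hW : (fun ω : Table 𝒞 𝒜 𝒵 𝒴 => (trtA ω, covC ω)) ⁻¹' {(a, c)} =
        trtA ⁻¹' {a} ∩ covC ⁻¹' {c} := by
      ext ω
      simp
    have h1 := (hP.twoDoor.td3 b' b z).real_mul (w := (a, c)) (by rw [hW]; exact (hm2 a).inter (hm1 c))
      (measurableSet_singleton y) (measurableSet_singleton z)
    rw [hW, hzca] at h1
    have h2 := (hP.backDoor.joint b' z).real_mul (hm1 c) (measurableSet_singleton y)
      (measurableSet_singleton a)
    have h3 : P.real (covC ⁻¹' {c} ∩ potYZ b' z ⁻¹' {y}) =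
        P.real (covC ⁻¹' {c} ∩ potYZ a₀ z ⁻¹' {y}) := by
      refine measureReal_congr ?_
      filter_upwards [hP.frontDoor.fd1 b' a₀ z] with ω hω
      exact propext (and_congr_right fun _ => by
        change potYZ b' z ω = y ↔ potYZ a₀ z ω = y
        rw [hω])
    rw [h3, Set.inter_comm (potYZ b' z ⁻¹' {y}), ← Set.inter_assoc,
      Set.inter_comm (covC ⁻¹' {c}) (trtA ⁻¹' {a})] at h2
    have h4 := (hpos c a).ne'
    have h5 := (hposC c).ne'
    refine mul_right_cancel₀ h4 (mul_right_cancel₀ h5 ?_)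
    rw [h1]
    have h6 : P.real (trtA ⁻¹' {a} ∩ covC ⁻¹' {c} ∩ potYZ b' z ⁻¹' {y}) =
        η c z y * ρ c a := by
      refine mul_right_cancel₀ h5 (h2.trans ?_)
      simp only [hη, hρ]
      field_simp
    rw [h6]
    simp only [hρ]
    ring
  refine ⟨ρ, ζ, η, fun a => ?_, fun c z => ?_, fun c a z y => ?_, fun c b z y => ?_⟩
  · have := hasSum_measureReal_inter_fiber (μ := P) (measurable_potZ a) Set.univ
    simpa only [Set.univ_inter, probReal_univ] using this
  · have := (hasSum_measureReal_inter_fiber (μ := P) (measurable_potYZ a₀ z) (covC ⁻¹' {c})).div_const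
      (P.real (covC ⁻¹' {c}))
    rwa [div_self (hposC c).ne'] at this
  · rw [obsLaw_real, ← hkey c a a a z y]
    congr 1
    ext ω
    simp only [observed, medZ, outY, potY, Set.mem_preimage, Set.mem_singleton_iff, Prod.mk.injEq,
      Set.mem_inter_iff]
    constructor
    · rintro ⟨rfl, rfl, rfl, rfl⟩
      simp
    · rintro ⟨⟨rfl, rfl⟩, hy, rfl⟩
      exact ⟨rfl, rfl, rfl, hy⟩
  · have := hasSum_measureReal_inter_fiber (μ := P) measurable_trtA
      (covC ⁻¹' {c} ∩ (potYZ b z ⁻¹' {y} ∩ potZ b ⁻¹' {z}))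
    rw [potLaw_real]
    convert! this using 1
    · ext a
      rw [← hkey c a b b z y]
      congr 1
      ext ω
      simp only [Set.mem_inter_iff]
      tauto
    · congr 1
      ext ω
      simp only [potY, Set.mem_preimage, Set.mem_singleton_iff, Prod.mk.injEq, Set.mem_inter_iff]
      constructor
      · rintro ⟨rfl, rfl, rfl⟩
        simp
      · rintro ⟨rfl, hy, rfl⟩
        exact ⟨rfl, rfl, hy⟩

end model

/-! ### Marginal and conditional masses of a factorized law. -/

section observed_law

variable {𝒞 𝒜 𝒵 : Type*} {𝒴 : Set ℝ}
    [Countable 𝒞] [MeasurableSpace 𝒞] [MeasurableSingletonClass 𝒞]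
    [Countable 𝒜] [MeasurableSpace 𝒜] [MeasurableSingletonClass 𝒜]
    [Countable 𝒵] [MeasurableSpace 𝒵] [MeasurableSingletonClass 𝒵]
    [Countable 𝒴]

/-- A law of `(C, A, Z, Y)` of full support that factorizes along the graph with the edges `C → A`,
`C → Y`, `A → Z`, `Z → Y`. -/
structure Factorizes (μ : Measure (Obs 𝒞 𝒜 𝒵 𝒴)) : Prop where
  isProbabilityMeasure : IsProbabilityMeasure μ
  pos : ∀ x, 0 < μ.real {x}
  exists_factors : ∃ (ρ : 𝒞 → 𝒜 → ℝ) (ζ : 𝒜 → 𝒵 → ℝ) (η : 𝒞 → 𝒵 → 𝒴 → ℝ),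
    (∀ a, HasSum (ζ a) 1) ∧ (∀ c z, HasSum (η c z) 1) ∧
    ∀ c a z y, μ.real {(c, a, z, y)} = ρ c a * ζ a z * η c z y

theorem InModel.factorizes {P : Measure (Table 𝒞 𝒜 𝒵 𝒴)} (hP : InModel P) :
    Factorizes (obsLaw P) := by
  have := hP.isProbabilityMeasure
  refine ⟨Measure.isProbabilityMeasure_map measurable_observed.aemeasurable, ?_, ?_⟩
  · rintro ⟨c, a, z, y⟩
    rw [obsLaw_real]
    refine ENNReal.toReal_pos ((hP.positivity a y a z c).trans_le
      (measure_mono ?_)).ne' (measure_ne_top _ _)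
    rintro ω ⟨h1, rfl, rfl, rfl⟩
    simp only [observed, outY, Set.mem_preimage, Set.mem_singleton_iff, h1]
  · obtain ⟨ρ, ζ, η, h1, h2, h3, -⟩ := hP.exists_factors
    exact ⟨ρ, ζ, η, h1, h2, h3⟩

/-- `p(z | c) = ∑_b p(b | c) p(z | b)`. -/
def pZC (μ : Measure (Obs 𝒞 𝒜 𝒵 𝒴)) (z : 𝒵) (c : 𝒞) : ℝ := ∑' b, pAC μ b c * pZA μ z b

namespace Factorizes

variable {μ : Measure (Obs 𝒞 𝒜 𝒵 𝒴)} (hμ : Factorizes μ)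

include hμ

theorem nonempty : Nonempty (Obs 𝒞 𝒜 𝒵 𝒴) := by
  have := hμ.isProbabilityMeasure
  exact μ.nonempty_of_neZero

theorem real_pos {E : Set (Obs 𝒞 𝒜 𝒵 𝒴)} (hE : E.Nonempty) : 0 < μ.real E := by
  have := hμ.isProbabilityMeasure
  obtain ⟨x, hx⟩ := hE
  exact (hμ.pos x).trans_le (measureReal_mono (Set.singleton_subset_iff.2 hx))

/-- Every atom has positive mass, so the only null set is empty. -/
theorem ae_iff {p : Obs 𝒞 𝒜 𝒵 𝒴 → Prop} : (∀ᵐ x ∂μ, p x) ↔ ∀ x, p x := by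
  refine ⟨fun h x => ?_, fun h => ae_of_all _ h⟩
  by_contra hx
  have h1 : μ {x} = 0 := measure_mono_null (Set.singleton_subset_iff.2 hx) (MeasureTheory.ae_iff.1 h)
  have h2 := hμ.pos x
  rw [measureReal_def, h1] at h2
  simp at h2

omit hμ in
theorem real_cond {E : Set (Obs 𝒞 𝒜 𝒵 𝒴)} (F : Set (Obs 𝒞 𝒜 𝒵 𝒴)) :
    (μ[|E]).real F = μ.real (E ∩ F) / μ.real E := by
  rw [measureReal_def, cond_apply .of_discrete, ENNReal.toReal_mul, ENNReal.toReal_inv,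
    inv_mul_eq_div]
  rfl

theorem pC_pos (c : 𝒞) : 0 < pC μ c := by
  obtain ⟨_, a, z, y⟩ := hμ.nonempty
  exact hμ.real_pos ⟨(c, a, z, y), rfl⟩

theorem pA_pos (a : 𝒜) : 0 < pA μ a := by
  obtain ⟨c, _, z, y⟩ := hμ.nonempty
  exact hμ.real_pos ⟨(c, a, z, y), rfl⟩

theorem real_evC_evA (c : 𝒞) (a : 𝒜) : μ.real (evC c ∩ evA a) = pC μ c * pAC μ a c := by
  rw [pAC, real_cond]
  exact (mul_div_cancel₀ _ (hμ.pC_pos c).ne').symm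

theorem real_evA_evZ (a : 𝒜) (z : 𝒵) : μ.real (evA a ∩ evZ z) = pA μ a * pZA μ z a := by
  rw [pZA, real_cond]
  exact (mul_div_cancel₀ _ (hμ.pA_pos a).ne').symm

theorem real_evZ_evC_evY (z : 𝒵) (c : 𝒞) (y : 𝒴) :
    μ.real (evZ z ∩ evC c ∩ evY y) = μ.real (evZ z ∩ evC c) * pYZC μ y z c := by
  obtain ⟨_, a, _, y'⟩ := hμ.nonempty
  have h : 0 < μ.real (evZ z ∩ evC c) := hμ.real_pos ⟨(c, a, z, y'), rfl, rfl⟩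
  rw [pYZC, real_cond]
  exact (mul_div_cancel₀ _ h.ne').symm

theorem pAC_pos (a : 𝒜) (c : 𝒞) : 0 < pAC μ a c := by
  obtain ⟨_, _, z, y⟩ := hμ.nonempty
  rw [pAC, real_cond]
  exact div_pos (hμ.real_pos ⟨(c, a, z, y), rfl, rfl⟩) (hμ.pC_pos c)

theorem pZA_pos (z : 𝒵) (a : 𝒜) : 0 < pZA μ z a := by
  obtain ⟨c, _, _, y⟩ := hμ.nonempty
  rw [pZA, real_cond]
  exact div_pos (hμ.real_pos ⟨(c, a, z, y), rfl, rfl⟩) (hμ.pA_pos a)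

theorem pYZC_pos (y : 𝒴) (z : 𝒵) (c : 𝒞) : 0 < pYZC μ y z c := by
  obtain ⟨_, a, _, _⟩ := hμ.nonempty
  rw [pYZC, real_cond]
  exact div_pos (hμ.real_pos ⟨(c, a, z, y), ⟨rfl, rfl⟩, rfl⟩)
    (hμ.real_pos ⟨(c, a, z, y), rfl, rfl⟩)

/-- Normalization of ζ and η leaves no freedom: summing out y and then z shows that ρ is the mass of
(C, A). Since ζ does not involve c and η does not involve a, they factor out of the sums over c and
over a, and so are the conditional masses. -/
theorem factors_eq {ρ : 𝒞 → 𝒜 → ℝ} {ζ : 𝒜 → 𝒵 → ℝ} {η : 𝒞 → 𝒵 → 𝒴 → ℝ}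
    (hζ : ∀ a, HasSum (ζ a) 1) (hη : ∀ c z, HasSum (η c z) 1)
    (hm : ∀ c a z y, μ.real {(c, a, z, y)} = ρ c a * ζ a z * η c z y) :
    (∀ c a, ρ c a = pC μ c * pAC μ a c) ∧ (∀ a z, ζ a z = pZA μ z a) ∧
    (∀ c z y, η c z y = pYZC μ y z c) := by
  have := hμ.isProbabilityMeasure
  have h1 : ∀ c a z, μ.real (evC c ∩ evA a ∩ evZ z) = ρ c a * ζ a z := by
    intro c a z
    have h := hasSum_measureReal_fiber (ν := μ) (fun x => x.2.2.2) (evC c ∩ evA a ∩ evZ z)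
    refine h.unique (HasSum.congr_fun (f := fun y => ρ c a * ζ a z * η c z y) ?_ fun y => ?_)
    · simpa using (hη c z).mul_left (ρ c a * ζ a z)
    · rw [← hm]
      congr 1
      ext ⟨c', a', z', y'⟩
      simp [evC, evA, evZ, and_assoc]
  have h2 : ∀ c a, μ.real (evC c ∩ evA a) = ρ c a := by
    intro c a
    have h := hasSum_measureReal_fiber (ν := μ) (fun x => x.2.2.1) (evC c ∩ evA a)
    refine h.unique (HasSum.congr_fun ?_ fun z => h1 c a z)
    simpa using (hζ a).mul_left (ρ c a)
  have h3 : ∀ a z, μ.real (evA a ∩ evZ z) = pA μ a * ζ a z := by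
    intro a z
    have h := hasSum_measureReal_fiber (ν := μ) (fun x => x.1) (evA a ∩ evZ z)
    have h' := hasSum_measureReal_fiber (ν := μ) (fun x => x.1) (evA a)
    refine h.unique (HasSum.congr_fun (h'.mul_right (ζ a z)) fun c => ?_)
    have e1 : (evA a ∩ evZ z ∩ (fun x => x.1) ⁻¹' {c} : Set (Obs 𝒞 𝒜 𝒵 𝒴)) =
        evC c ∩ evA a ∩ evZ z := by
      ext x
      simp only [evC, evA, evZ, Set.mem_inter_iff, Set.mem_ofPred_eq, Set.mem_preimage,
        Set.mem_singleton_iff]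
      tauto
    have e2 : (evA a ∩ (fun x => x.1) ⁻¹' {c} : Set (Obs 𝒞 𝒜 𝒵 𝒴)) = evC c ∩ evA a :=
      Set.inter_comm _ _
    simp only [e1, e2, h1, h2]
  have h4 : ∀ z c y, μ.real (evZ z ∩ evC c ∩ evY y) = μ.real (evZ z ∩ evC c) * η c z y := by
    intro z c y
    have h := hasSum_measureReal_fiber (ν := μ) (fun x => x.2.1) (evZ z ∩ evC c ∩ evY y)
    have h' := hasSum_measureReal_fiber (ν := μ) (fun x => x.2.1) (evZ z ∩ evC c)
    refine h.unique (HasSum.congr_fun (h'.mul_right (η c z y)) fun a => ?_)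
    have e1 : (evZ z ∩ evC c ∩ evY y ∩ (fun x => x.2.1) ⁻¹' {a} : Set (Obs 𝒞 𝒜 𝒵 𝒴)) =
        {(c, a, z, y)} := by
      ext ⟨c', a', z', y'⟩
      simp only [evC, evY, evZ, Set.mem_inter_iff, Set.mem_ofPred_eq, Set.mem_preimage,
        Set.mem_singleton_iff, Prod.mk.injEq]
      tauto
    have e2 : (evZ z ∩ evC c ∩ (fun x => x.2.1) ⁻¹' {a} : Set (Obs 𝒞 𝒜 𝒵 𝒴)) =
        evC c ∩ evA a ∩ evZ z := by
      ext x
      simp only [evC, evA, evZ, Set.mem_inter_iff, Set.mem_ofPred_eq, Set.mem_preimage,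
        Set.mem_singleton_iff]
      tauto
    simp only [e1, e2, h1, hm]
  refine ⟨fun c a => ?_, fun a z => ?_, fun c z y => ?_⟩
  · rw [← h2, hμ.real_evC_evA]
  · have := hμ.real_evA_evZ a z
    rw [h3] at this
    exact mul_left_cancel₀ (hμ.pA_pos a).ne' this
  · have := hμ.real_evZ_evC_evY z c y
    rw [h4] at this
    obtain ⟨_, a, _, _⟩ := hμ.nonempty
    have h : 0 < μ.real (evZ z ∩ evC c) := hμ.real_pos ⟨(c, a, z, y), rfl, rfl⟩
    exact mul_left_cancel₀ h.ne' this

/-- The observed density factorizes. -/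
theorem real_singleton (c : 𝒞) (a : 𝒜) (z : 𝒵) (y : 𝒴) :
    μ.real {(c, a, z, y)} = pC μ c * pAC μ a c * pZA μ z a * pYZC μ y z c := by
  obtain ⟨ρ, ζ, η, hζ, hη, h⟩ := hμ.exists_factors
  obtain ⟨h1, h2, h3⟩ := hμ.factors_eq hζ hη h
  rw [h, h1, h2, h3]

theorem hasSum_pZA (a : 𝒜) : HasSum (fun z => pZA μ z a) 1 := by
  obtain ⟨ρ, ζ, η, hζ, hη, h⟩ := hμ.exists_factors
  simpa only [← (hμ.factors_eq hζ hη h).2.1] using hζ a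

theorem hasSum_pYZC (z : 𝒵) (c : 𝒞) : HasSum (fun y => pYZC μ y z c) 1 := by
  obtain ⟨ρ, ζ, η, hζ, hη, h⟩ := hμ.exists_factors
  simpa only [← (hμ.factors_eq hζ hη h).2.2] using hη c z

theorem hasSum_pC : HasSum (pC μ) 1 := by
  have := hμ.isProbabilityMeasure
  have h := hasSum_measureReal_fiber (ν := μ) (fun x => x.1) Set.univ
  rw [probReal_univ] at h
  refine h.congr_fun fun c => ?_
  rw [Set.univ_inter]
  rfl

theorem hasSum_pAC (c : 𝒞) : HasSum (fun a => pAC μ a c) 1 := by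
  have := hμ.isProbabilityMeasure
  have h := hasSum_measureReal_fiber (ν := μ) (fun x => x.2.1) (evC c)
  have h' := (HasSum.congr_fun h fun a => (hμ.real_evC_evA c a).symm).div_const (pC μ c)
  have h0 := (hμ.pC_pos c).ne'
  rw [← pC, div_self h0] at h'
  exact h'.congr_fun fun a => (mul_div_cancel_left₀ _ h0).symm

theorem hasSum_pC_mul_pAC : HasSum (fun x : 𝒞 × 𝒜 => pC μ x.1 * pAC μ x.2 x.1) 1 := by
  have := hμ.isProbabilityMeasure
  have h := hasSum_measureReal_fiber (ν := μ) (fun x => (x.1, x.2.1)) Set.univ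
  rw [probReal_univ] at h
  refine h.congr_fun fun ⟨c, a⟩ => ?_
  rw [← hμ.real_evC_evA]
  congr 1
  ext x
  simp [evC, evA]

theorem hasSum_pA (a : 𝒜) : HasSum (fun c => pC μ c * pAC μ a c) (pA μ a) := by
  have := hμ.isProbabilityMeasure
  have h := hasSum_measureReal_fiber (ν := μ) (fun x => x.1) (evA a)
  refine h.congr_fun fun c => ?_
  rw [← hμ.real_evC_evA, Set.inter_comm]
  rfl

theorem pZA_le_one (z : 𝒵) (a : 𝒜) : pZA μ z a ≤ 1 :=
  (hμ.hasSum_pZA a).summable.le_tsum z (fun b _ => (hμ.pZA_pos b a).le) |>.trans_eq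
    (hμ.hasSum_pZA a).tsum_eq

theorem hasSum_pZC (z : 𝒵) (c : 𝒞) : HasSum (fun b => pAC μ b c * pZA μ z b) (pZC μ z c) := by
  refine (Summable.of_nonneg_of_le (fun b => ?_) (fun b => ?_) (hμ.hasSum_pAC c).summable).hasSum
  · exact mul_nonneg (hμ.pAC_pos b c).le (hμ.pZA_pos z b).le
  · exact mul_le_of_le_one_right (hμ.pAC_pos b c).le (hμ.pZA_le_one z b)

theorem real_evC_evA_evZ (c : 𝒞) (a : 𝒜) (z : 𝒵) :
    μ.real (evC c ∩ evA a ∩ evZ z) = pC μ c * pAC μ a c * pZA μ z a := by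
  have := hμ.isProbabilityMeasure
  have h := hasSum_measureReal_fiber (ν := μ) (fun x => x.2.2.2) (evC c ∩ evA a ∩ evZ z)
  refine h.unique (HasSum.congr_fun
    (f := fun y => pC μ c * pAC μ a c * pZA μ z a * pYZC μ y z c) ?_ fun y => ?_)
  · simpa using (hμ.hasSum_pYZC z c).mul_left (pC μ c * pAC μ a c * pZA μ z a)
  · rw [← hμ.real_singleton]
    congr 1
    ext ⟨c', a', z', y'⟩
    simp [evC, evA, evZ, and_assoc]

/-- Identifies the denominators of `phi` as the conditional probabilities of Z given C. -/
theorem real_evZ_evC (z : 𝒵) (c : 𝒞) : μ.real (evZ z ∩ evC c) = pC μ c * pZC μ z c := by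
  have := hμ.isProbabilityMeasure
  have h := hasSum_measureReal_fiber (ν := μ) (fun x => x.2.1) (evZ z ∩ evC c)
  refine h.unique (((hμ.hasSum_pZC z c).mul_left (pC μ c)).congr_fun fun a => ?_)
  rw [← mul_assoc, ← hμ.real_evC_evA_evZ]
  congr 1
  ext x
  simp only [evC, evA, evZ, Set.mem_inter_iff, Set.mem_ofPred_eq, Set.mem_preimage,
    Set.mem_singleton_iff]
  tauto

theorem pZC_pos (z : 𝒵) (c : 𝒞) : 0 < pZC μ z c := by
  obtain ⟨_, a, _, y⟩ := hμ.nonempty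
  have h := hμ.real_pos (E := evZ z ∩ evC c) ⟨(c, a, z, y), rfl, rfl⟩
  rw [hμ.real_evZ_evC] at h
  exact pos_of_mul_pos_right h (hμ.pC_pos c).le

theorem meanY_eq (z : 𝒵) (c : 𝒞) : meanY μ z c = ∑' y : 𝒴, (y : ℝ) * pYZC μ y z c := by
  have := hμ.isProbabilityMeasure
  exact integral_comp_eq_tsum (μ := μ[|evZ z ∩ evC c]) (X := fun x : Obs 𝒞 𝒜 𝒵 𝒴 => x.2.2.2)
    .of_discrete (fun y : 𝒴 => (y : ℝ))

theorem varY_eq (z : 𝒵) (c : 𝒞) :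
    varY μ z c = ∑' y : 𝒴, ((y : ℝ) - meanY μ z c) ^ 2 * pYZC μ y z c := by
  have := hμ.isProbabilityMeasure
  rw [varY, variance_eq_integral (Measurable.of_discrete).aemeasurable]
  exact integral_comp_eq_tsum (μ := μ[|evZ z ∩ evC c]) (X := fun x : Obs 𝒞 𝒜 𝒵 𝒴 => x.2.2.2)
    .of_discrete (fun y : 𝒴 => ((y : ℝ) - meanY μ z c) ^ 2)

end Factorizes

end observed_law

/-! ### Weighted ℓ² estimates. -/

section weights

variable {ι κ : Type*}

theorem summable_mul_of_sq_weight {w f g : ι → ℝ} (hw : ∀ i, 0 ≤ w i)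
    (hf : Summable fun i => f i ^ 2 * w i) (hg : Summable fun i => g i ^ 2 * w i) :
    Summable fun i => f i * g i * w i := by
  refine (summable_mul_of_sq (u := fun i => f i * √(w i)) (v := fun i => g i * √(w i)) ?_ ?_).congr
    fun i => ?_
  · simpa only [mul_pow, Real.sq_sqrt (hw _)] using hf
  · simpa only [mul_pow, Real.sq_sqrt (hw _)] using hg
  · have := Real.mul_self_sqrt (hw i)
    linear_combination (f i * g i) * this

theorem summable_mul_weight {w f : ι → ℝ} (hw : ∀ i, 0 ≤ w i) (hw1 : Summable w)
    (hf : Summable fun i => f i ^ 2 * w i) : Summable fun i => f i * w i := by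
  simpa using summable_mul_of_sq_weight (g := fun _ => 1) hw hf (by simpa using hw1)

/-- Cauchy–Schwarz against the constant 1, with the weight split as √w · √w. -/
theorem sq_tsum_mul_weight_le {w f : ι → ℝ} (hw : ∀ i, 0 ≤ w i) (hw1 : HasSum w 1)
    (hf : Summable fun i => f i ^ 2 * w i) :
    (∑' i, f i * w i) ^ 2 ≤ ∑' i, f i ^ 2 * w i := by
  have h := sq_tsum_mul_le (u := fun i => f i * √(w i)) (v := fun i => √(w i))
    (by simpa only [mul_pow, Real.sq_sqrt (hw _)] using hf)
    (by simpa only [Real.sq_sqrt (hw _)] using hw1.summable)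
  simpa only [mul_pow, Real.sq_sqrt (hw _), hw1.tsum_eq, mul_one, mul_assoc,
    Real.mul_self_sqrt (hw _)] using h

/-- Conditional expectations of square summable functions are square summable. -/
theorem summable_condMean_sq {w : ι → ℝ} {k : ι → κ → ℝ} {f : ι → κ → ℝ} (hw : ∀ i, 0 < w i)
    (hk : ∀ i j, 0 ≤ k i j) (hk1 : ∀ i, HasSum (k i) 1)
    (hf : Summable fun x : ι × κ => f x.1 x.2 ^ 2 * (w x.1 * k x.1 x.2)) :
    (∀ i, Summable fun j => f i j ^ 2 * k i j) ∧ (∀ i, Summable fun j => f i j * k i j) ∧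
      Summable fun i => (∑' j, f i j * k i j) ^ 2 * w i := by
  have h1 : ∀ i, Summable fun j => f i j ^ 2 * k i j := by
    intro i
    refine ((hf.prod_factor i).mul_left (w i)⁻¹).congr fun j => ?_
    have := (hw i).ne'
    field_simp
  refine ⟨h1, fun i => summable_mul_weight (hk i) (hk1 i).summable (h1 i), ?_⟩
  refine Summable.of_nonneg_of_le (fun i => mul_nonneg (sq_nonneg _) (hw i).le) (fun i => ?_) hf.prod
  calc _ ≤ (∑' j, f i j ^ 2 * k i j) * w i :=
        mul_le_mul_of_nonneg_right (sq_tsum_mul_weight_le (hk i) (hk1 i) (h1 i)) (hw i).le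
    _ = _ := by
      rw [← tsum_mul_right]
      exact tsum_congr fun j => by ring

end weights

/-! ### Moments of the potential outcomes in terms of the observed law. -/

section moments

variable {𝒞 𝒜 𝒵 : Type*} {𝒴 : Set ℝ}
    [Countable 𝒞] [MeasurableSpace 𝒞] [MeasurableSingletonClass 𝒞]
    [Countable 𝒜] [MeasurableSpace 𝒜] [MeasurableSingletonClass 𝒜]
    [Countable 𝒵] [MeasurableSpace 𝒵] [MeasurableSingletonClass 𝒵]
    [Countable 𝒴]

/-- The mass function `p(c) p(z | b) p(y | z, c)` of `(C, Z(b), Y(b))`. -/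
def potMass (μ : Measure (Obs 𝒞 𝒜 𝒵 𝒴)) (b : 𝒜) (v : 𝒞 × 𝒵 × 𝒴) : ℝ :=
  pC μ v.1 * pZA μ v.2.1 b * pYZC μ v.2.2 v.2.1 v.1

/-- The potential outcome `Y(b)` has a finite second moment. -/
def PotSq (μ : Measure (Obs 𝒞 𝒜 𝒵 𝒴)) (b : 𝒜) : Prop :=
  Summable fun v : 𝒞 × 𝒵 × 𝒴 => (v.2.2 : ℝ) ^ 2 * potMass μ b v

/-- `E Y(b)`. -/
def potMean (μ : Measure (Obs 𝒞 𝒜 𝒵 𝒴)) (b : 𝒜) : ℝ :=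
  ∑' v : 𝒞 × 𝒵 × 𝒴, (v.2.2 : ℝ) * potMass μ b v

/-- `∑_c p(c) E(Y | z, c)`. -/
def meanYZ (μ : Measure (Obs 𝒞 𝒜 𝒵 𝒴)) (z : 𝒵) : ℝ := ∑' c, pC μ c * meanY μ z c

/-- `∑_z E(Y | z, c) p(z | b)`. -/
def meanYC (μ : Measure (Obs 𝒞 𝒜 𝒵 𝒴)) (b : 𝒜) (c : 𝒞) : ℝ := ∑' z, meanY μ z c * pZA μ z b

/-- This is identification: in the sum over the received treatment only p(a|c) varies, and it adds
up to one. Hence the mean of `Y(b)` depends on P only through the observed law. -/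
theorem InModel.potLaw_real_singleton {P : Measure (Table 𝒞 𝒜 𝒵 𝒴)} (hP : InModel P) (b : 𝒜)
    (v : 𝒞 × 𝒵 × 𝒴) : (potLaw b P).real {v} = potMass (obsLaw P) b v := by
  have hμ := hP.factorizes
  obtain ⟨c, z, y⟩ := v
  obtain ⟨ρ, ζ, η, hζ, hη, hm, hpot⟩ := hP.exists_factors
  obtain ⟨hρ, hz, hy⟩ := hμ.factors_eq hζ hη hm
  refine (hpot c b z y).unique ?_
  have h := ((hμ.hasSum_pAC c).mul_left (pC (obsLaw P) c)).mul_right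
    (pZA (obsLaw P) z b * pYZC (obsLaw P) y z c)
  rw [mul_one, ← mul_assoc] at h
  refine HasSum.congr_fun h fun a => ?_
  rw [hρ, hz, hy]
  ring

theorem InModel.integral_potY {P : Measure (Table 𝒞 𝒜 𝒵 𝒴)} (hP : InModel P) (b : 𝒜) :
    ∫ ω, (potY b ω : ℝ) ∂P = potMean (obsLaw P) b := by
  have := hP.isProbabilityMeasure
  have h := integral_comp_eq_tsum (μ := P) (X := fun ω => (covC ω, potZ b ω, potY b ω))
    (by fun_prop) (fun v => (v.2.2 : ℝ))
  rw [h, potMean]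
  refine tsum_congr fun v => ?_
  rw [← hP.potLaw_real_singleton, potLaw_real]

theorem InModel.memLp_potY_iff {P : Measure (Table 𝒞 𝒜 𝒵 𝒴)} (hP : InModel P) (b : 𝒜) :
    MemLp (fun ω => (potY b ω : ℝ)) 2 P ↔ PotSq (obsLaw P) b := by
  have := hP.isProbabilityMeasure
  rw [memLp_two_iff_integrable_sq (f := fun ω => (potY b ω : ℝ))
    (measurable_subtype_coe.comp (measurable_potY b)).aestronglyMeasurable]
  have h := integrable_comp_iff (μ := P) (X := fun ω => (covC ω, potZ b ω, potY b ω))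
    (by fun_prop) (fun v => (v.2.2 : ℝ) ^ 2)
  rw [h, PotSq]
  refine summable_congr fun v => ?_
  rw [← hP.potLaw_real_singleton, potLaw_real]

theorem InModel.integral_potY_sq {P : Measure (Table 𝒞 𝒜 𝒵 𝒴)} (hP : InModel P) (b : 𝒜) :
    ∫ ω, (potY b ω : ℝ) ^ 2 ∂P = ∑' v : 𝒞 × 𝒵 × 𝒴, (v.2.2 : ℝ) ^ 2 * potMass (obsLaw P) b v := by
  have := hP.isProbabilityMeasure
  have h := integral_comp_eq_tsum (μ := P) (X := fun ω => (covC ω, potZ b ω, potY b ω))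
    (by fun_prop) (fun v => (v.2.2 : ℝ) ^ 2)
  rw [h]
  refine tsum_congr fun v => ?_
  rw [← hP.potLaw_real_singleton, potLaw_real]

namespace Factorizes

variable {μ : Measure (Obs 𝒞 𝒜 𝒵 𝒴)} (hμ : Factorizes μ)

include hμ

theorem potMass_pos (b : 𝒜) (v : 𝒞 × 𝒵 × 𝒴) : 0 < potMass μ b v :=
  mul_pos (mul_pos (hμ.pC_pos _) (hμ.pZA_pos _ _)) (hμ.pYZC_pos _ _ _)

theorem hasSum_pC_mul_pZA (b : 𝒜) : HasSum (fun x : 𝒞 × 𝒵 => pC μ x.1 * pZA μ x.2 b) 1 := by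
  have h1 := hμ.hasSum_pC
  have h2 := hμ.hasSum_pZA b
  have h := h1.summable.mul_of_nonneg h2.summable (fun c => (hμ.pC_pos c).le)
    fun z => (hμ.pZA_pos z b).le
  exact (h1.mul h2 h).trans (by rw [mul_one])

variable {b : 𝒜} (hb : PotSq μ b)

include hb

theorem summable_sq_aux : Summable fun x : (𝒞 × 𝒵) × 𝒴 =>
    (x.2 : ℝ) ^ 2 * ((pC μ x.1.1 * pZA μ x.1.2 b) * pYZC μ x.2 x.1.2 x.1.1) :=
  (Equiv.prodAssoc 𝒞 𝒵 𝒴).summable_iff.2 hb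

theorem summable_condMean_aux :
    (∀ x : 𝒞 × 𝒵, Summable fun y : 𝒴 => (y : ℝ) ^ 2 * pYZC μ y x.2 x.1) ∧
    (∀ x : 𝒞 × 𝒵, Summable fun y : 𝒴 => (y : ℝ) * pYZC μ y x.2 x.1) ∧
    Summable fun x : 𝒞 × 𝒵 => (∑' y : 𝒴, (y : ℝ) * pYZC μ y x.2 x.1) ^ 2 *
      (pC μ x.1 * pZA μ x.2 b) :=
  summable_condMean_sq (w := fun x : 𝒞 × 𝒵 => pC μ x.1 * pZA μ x.2 b)
    (k := fun x y => pYZC μ y x.2 x.1) (f := fun _ y => (y : ℝ))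
    (fun _ => mul_pos (hμ.pC_pos _) (hμ.pZA_pos _ _)) (fun _ _ => (hμ.pYZC_pos _ _ _).le)
    (fun _ => hμ.hasSum_pYZC _ _) (hμ.summable_sq_aux hb)

/-- A second moment at a single level b controls every conditional law of Y, because p(c) p(z|b) is
positive at every (c, z). -/
theorem summable_sq_pYZC (z : 𝒵) (c : 𝒞) : Summable fun y : 𝒴 => (y : ℝ) ^ 2 * pYZC μ y z c :=
  (hμ.summable_condMean_aux hb).1 (c, z)

theorem hasSum_meanY (z : 𝒵) (c : 𝒞) :
    HasSum (fun y : 𝒴 => (y : ℝ) * pYZC μ y z c) (meanY μ z c) := by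
  rw [hμ.meanY_eq]
  exact ((hμ.summable_condMean_aux hb).2.1 (c, z)).hasSum

theorem summable_meanY_sq :
    Summable fun x : 𝒞 × 𝒵 => meanY μ x.2 x.1 ^ 2 * (pC μ x.1 * pZA μ x.2 b) := by
  simpa only [hμ.meanY_eq] using (hμ.summable_condMean_aux hb).2.2

theorem summable_meanY :
    Summable fun x : 𝒞 × 𝒵 => meanY μ x.2 x.1 * (pC μ x.1 * pZA μ x.2 b) :=
  summable_mul_weight (fun _ => (mul_pos (hμ.pC_pos _) (hμ.pZA_pos _ _)).le)
    (hμ.hasSum_pC_mul_pZA b).summable (hμ.summable_meanY_sq hb)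

theorem summable_potMean : Summable fun v : 𝒞 × 𝒵 × 𝒴 => (v.2.2 : ℝ) * potMass μ b v := by
  refine summable_mul_weight (fun v => (hμ.potMass_pos b v).le) ?_ hb
  have h := summable_prod_of_nonneg (f := fun x : (𝒞 × 𝒵) × 𝒴 =>
    pC μ x.1.1 * pZA μ x.1.2 b * pYZC μ x.2 x.1.2 x.1.1)
    (fun x => (hμ.potMass_pos b (x.1.1, x.1.2, x.2)).le)
  refine (Equiv.prodAssoc 𝒞 𝒵 𝒴).summable_iff.1 (h.2 ⟨fun x => ?_, ?_⟩)
  · exact (hμ.hasSum_pYZC x.2 x.1).summable.mul_left (pC μ x.1 * pZA μ x.2 b)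
  · simpa only [tsum_mul_left, (hμ.hasSum_pYZC _ _).tsum_eq, mul_one] using
      (hμ.hasSum_pC_mul_pZA b).summable

/-- Absolute convergence of the triple series lets E Y(b) be computed with the variables summed out
in any order; the variants over C alone and over Z alone are derived from this one. -/
theorem hasSum_potMean_pair :
    HasSum (fun x : 𝒞 × 𝒵 => meanY μ x.2 x.1 * (pC μ x.1 * pZA μ x.2 b)) (potMean μ b) := by
  have h := (hμ.summable_potMean hb).hasSum
  rw [← potMean, ← (Equiv.prodAssoc 𝒞 𝒵 𝒴).hasSum_iff] at h
  refine h.prod_fiberwise fun x => ?_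
  refine ((hμ.hasSum_meanY hb x.2 x.1).mul_right (pC μ x.1 * pZA μ x.2 b)).congr_fun fun y => ?_
  simp only [Function.comp, Equiv.prodAssoc_apply, potMass]
  ring

theorem hasSum_meanYC (c : 𝒞) : HasSum (fun z => meanY μ z c * pZA μ z b) (meanYC μ b c) := by
  refine Summable.hasSum (f := fun z => meanY μ z c * pZA μ z b) ?_
  refine (((hμ.summable_meanY hb).prod_factor c).mul_left (pC μ c)⁻¹).congr fun z => ?_
  have := (hμ.pC_pos c).ne'
  field_simp

theorem hasSum_potMean_C : HasSum (fun c => pC μ c * meanYC μ b c) (potMean μ b) := by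
  refine (hμ.hasSum_potMean_pair hb).prod_fiberwise fun c => ?_
  exact ((hμ.hasSum_meanYC hb c).mul_left (pC μ c)).congr_fun fun z => by ring

theorem hasSum_meanYZ (z : 𝒵) : HasSum (fun c => pC μ c * meanY μ z c) (meanYZ μ z) := by
  refine Summable.hasSum (f := fun c => pC μ c * meanY μ z c) ?_
  have h : Summable fun x : 𝒵 × 𝒞 => meanY μ x.1 x.2 * (pC μ x.2 * pZA μ x.1 b) :=
    (Equiv.prodComm 𝒵 𝒞).summable_iff.2 (hμ.summable_meanY hb)
  refine ((h.prod_factor z).mul_left (pZA μ z b)⁻¹).congr fun c => ?_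
  have := (hμ.pZA_pos z b).ne'
  field_simp

theorem hasSum_potMean_Z : HasSum (fun z => meanYZ μ z * pZA μ z b) (potMean μ b) := by
  have h := (Equiv.prodComm 𝒵 𝒞).hasSum_iff.2 (hμ.hasSum_potMean_pair hb)
  refine h.prod_fiberwise fun z => ?_
  refine ((hμ.hasSum_meanYZ hb z).mul_right (pZA μ z b)).congr_fun fun c => ?_
  simp only [Function.comp, Equiv.prodComm_apply, Prod.swap]
  ring

theorem summable_meanYZ_sq : Summable fun z => meanYZ μ z ^ 2 * pZA μ z b := by
  have h := (Equiv.prodComm 𝒵 𝒞).summable_iff.2 (hμ.summable_meanY_sq hb)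
  have h' := (summable_condMean_sq (w := fun z => pZA μ z b) (k := fun _ c => pC μ c)
    (f := fun z c => meanY μ z c) (fun z => hμ.pZA_pos z b) (fun _ c => (hμ.pC_pos c).le)
    (fun _ => hμ.hasSum_pC) (h.congr fun x => ?_)).2.2
  · simpa only [meanYZ, mul_comm (pC μ _)] using h'
  · simp only [Function.comp, Equiv.prodComm_apply, Prod.swap]
    ring

theorem summable_meanYC_sq : Summable fun c => meanYC μ b c ^ 2 * pC μ c :=
  (summable_condMean_sq (w := pC μ) (k := fun _ z => pZA μ z b) (f := fun c z => meanY μ z c)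
    hμ.pC_pos (fun _ z => (hμ.pZA_pos z b).le) (fun _ => hμ.hasSum_pZA b)
    (hμ.summable_meanY_sq hb)).2.2

end Factorizes

end moments

/-! ### Decomposition of the influence function and the Rotnitzky–Smucler formula. -/

section influence_function

variable {𝒞 𝒜 𝒵 : Type*} {𝒴 : Set ℝ}
    [Countable 𝒞] [MeasurableSpace 𝒞] [MeasurableSingletonClass 𝒞]
    [Countable 𝒜] [MeasurableSpace 𝒜] [MeasurableSingletonClass 𝒜]
    [Countable 𝒵] [MeasurableSpace 𝒵] [MeasurableSingletonClass 𝒵]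
    [Countable 𝒴]

theorem ind_self (b : 𝒜) : ind b b = 1 := by simp [ind]

theorem ind_of_ne {b a : 𝒜} (h : a ≠ b) : ind b a = 0 := by simp [ind, h]

/-- The component of `φ_{bd,fd,td}` along the scores of `p(y | z, c)`. -/
def phiY (as a : 𝒜) (μ : Measure (Obs 𝒞 𝒜 𝒵 𝒴)) (c : 𝒞) (z : 𝒵) (y : 𝒴) : ℝ :=
  ((y : ℝ) - meanY μ z c) * (pZA μ z as - pZA μ z a) / pZC μ z c

/-- The component of the influence function of `E Y(b)` along the scores of `p(z | a)`. -/
def phiZ (b : 𝒜) (μ : Measure (Obs 𝒞 𝒜 𝒵 𝒴)) (a' : 𝒜) (z : 𝒵) : ℝ :=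
  ind b a' * ((meanYZ μ z - potMean μ b) / pA μ b)

/-- The component of the influence function of `E Y(b)` along the scores of `p(c)`. -/
def phiC (b : 𝒜) (μ : Measure (Obs 𝒞 𝒜 𝒵 𝒴)) (c : 𝒞) : ℝ := meanYC μ b c - potMean μ b

theorem InModel.ace_eq {P : Measure (Table 𝒞 𝒜 𝒵 𝒴)} (hP : InModel P) (as a : 𝒜) :
    ace as a P = potMean (obsLaw P) as - potMean (obsLaw P) a := by
  rw [ace, hP.integral_potY, hP.integral_potY]

namespace Factorizes

variable {μ : Measure (Obs 𝒞 𝒜 𝒵 𝒴)} (hμ : Factorizes μ)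

include hμ

/-- In the middle term the factor I(A = a⋆) − I(A = a) is nonzero only for A equal to one of the
compared levels b. There the inner sum is `meanYC` at b, and averaging over c turns it into E Y(b),
which leaves `phiZ` up to sign. -/
theorem phi_eq {as a : 𝒜} (hne : as ≠ a) (has : PotSq μ as) (ha : PotSq μ a)
    (c : 𝒞) (a' : 𝒜) (z : 𝒵) (y : 𝒴) :
    phi as a μ (potMean μ as - potMean μ a) (c, a', z, y) =
      phiY as a μ c z y + (phiZ as μ a' z - phiZ a μ a' z) + (phiC as μ c - phiC a μ c) := by
  have h1 : ∑' z, meanY μ z c * (pZA μ z as - pZA μ z a) = meanYC μ as c - meanYC μ a c := by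
    refine (((hμ.hasSum_meanYC has c).sub (hμ.hasSum_meanYC ha c)).congr_fun fun z => ?_).tsum_eq
    ring
  have hpA : ∑' c', pC μ c' * pAC μ a' c' = pA μ a' := (hμ.hasSum_pA a').tsum_eq
  -- The factor k will be the value 1 or −1 of the difference of indicators.
  have h2 : ∀ b, PotSq μ b → ∀ k : ℝ, ∑' c, (meanY μ z c - ∑' z, meanY μ z c * pZA μ z b) *
      (k * pC μ c / pA μ b) = k * ((meanYZ μ z - potMean μ b) / pA μ b) := by
    intro b hb k
    refine ((((hμ.hasSum_meanYZ hb z).sub (hμ.hasSum_potMean_C hb)).mul_left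
      (k / pA μ b)).congr_fun fun c => ?_).tsum_eq.trans ?_
    · rw [← meanYC]
      ring
    · ring
  have h3 : ∑' c, (meanY μ z c - ∑' z, meanY μ z c * pZA μ z a') *
      ((ind as a' - ind a a') * pC μ c / pA μ a') = phiZ as μ a' z - phiZ a μ a' z := by
    rw [phiZ, phiZ]
    by_cases e1 : a' = as
    · subst e1
      rw [h2 a' has, ind_self, ind_of_ne hne]
      ring
    · by_cases e2 : a' = a
      · subst e2
        rw [h2 a' ha, ind_self, ind_of_ne hne.symm]
        ring
      · simp [ind_of_ne e1, ind_of_ne e2]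
  simp only [phi, h1, hpA, h3, phiY, phiC, pZC]
  ring

omit hμ in
theorem integral_cond_eq_tsum {β : Type*} [Countable β] (E : Set (Obs 𝒞 𝒜 𝒵 𝒴))
    (f : Obs 𝒞 𝒜 𝒵 𝒴 → ℝ) (X : Obs 𝒞 𝒜 𝒵 𝒴 → β) (g : β → ℝ) (m : β → ℝ)
    (hf : ∀ x ∈ E, f x = g (X x)) (hm : ∀ b, μ.real (E ∩ X ⁻¹' {b}) / μ.real E = m b) :
    ∫ x, f x ∂(μ[|E]) = ∑' b, g b * m b := by
  let _ : MeasurableSpace β := ⊤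
  have h1 : ∫ x, f x ∂(μ[|E]) = ∫ x, g (X x) ∂(μ[|E]) :=
    integral_congr_ae ((ae_cond_mem .of_discrete).mono hf)
  rw [h1, integral_comp_eq_tsum .of_discrete]
  exact tsum_congr fun b => by rw [real_cond, hm]

/-- Given A = b and C = c, the law of (Z, Y) is p(z|b) p(y|z,c). -/
theorem adjMean_eq {b : 𝒜} (hb : PotSq μ b) (c : 𝒞) : adjMean b μ c = meanYC μ b c := by
  rw [adjMean, integral_cond_eq_tsum (evA b ∩ evC c) valY (fun x => (x.2.2.1, x.2.2.2))
    (fun v => (v.2 : ℝ)) (fun v => pZA μ v.1 b * pYZC μ v.2 v.1 c) (fun _ _ => rfl)]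
  · have hs : Summable fun v : 𝒵 × 𝒴 => (v.2 : ℝ) * (pZA μ v.1 b * pYZC μ v.2 v.1 c) := by
      refine (((hμ.summable_potMean hb).prod_factor c).mul_left (pC μ c)⁻¹).congr fun v => ?_
      have := (hμ.pC_pos c).ne'
      rw [potMass]
      field_simp
    refine (hs.hasSum.prod_fiberwise fun z => ?_).unique (hμ.hasSum_meanYC hb c)
    exact ((hμ.hasSum_meanY hb z c).mul_right (pZA μ z b)).congr_fun fun y => by ring
  · rintro ⟨z, y⟩
    have h : (evA b ∩ evC c ∩ (fun x => (x.2.2.1, x.2.2.2)) ⁻¹' {(z, y)} :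
        Set (Obs 𝒞 𝒜 𝒵 𝒴)) = {(c, b, z, y)} := by
      ext ⟨c', a', z', y'⟩
      simp only [evC, evA, Set.mem_inter_iff, Set.mem_ofPred_eq, Set.mem_preimage,
        Set.mem_singleton_iff, Prod.mk.injEq]
      tauto
    rw [h, hμ.real_singleton, Set.inter_comm, hμ.real_evC_evA]
    have := (hμ.pC_pos c).ne'
    have := (hμ.pAC_pos b c).ne'
    field_simp

theorem integral_adjMean {b : 𝒜} (hb : PotSq μ b) : ∫ x, adjMean b μ x.1 ∂μ = potMean μ b := by
  have := hμ.isProbabilityMeasure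
  rw [integral_comp_eq_tsum (X := fun x : Obs 𝒞 𝒜 𝒵 𝒴 => x.1) .of_discrete (adjMean b μ),
    ← (hμ.hasSum_potMean_C hb).tsum_eq]
  refine tsum_congr fun c => ?_
  rw [hμ.adjMean_eq hb, mul_comm]
  rfl

omit hμ in
theorem integral_cond_ipwY_of_ne {b a' : 𝒜} (h : a' ≠ b) {E : Set (Obs 𝒞 𝒜 𝒵 𝒴)}
    (hE : E ⊆ evA a') : ∫ x, ipwY b μ x ∂(μ[|E]) = 0 := by
  rw [← integral_zero (Obs 𝒞 𝒜 𝒵 𝒴) ℝ (μ := μ[|E])]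
  refine integral_congr_ae ((ae_cond_mem .of_discrete).mono fun x hx => ?_)
  have hx' : x.2.1 = a' := hE hx
  simp only [ipwY, hx', ind_of_ne h, zero_mul, zero_div]

/-- Given A = b and Z = z, the covariate has mass p(c) p(b|c) / p(b). Inverse-probability weighting
cancels p(b|c), which leaves an average over the marginal law of C. -/
theorem integral_ipwY_evZ_evA {b : 𝒜} (hb : PotSq μ b) (z : 𝒵) :
    ∫ x, ipwY b μ x ∂(μ[|evZ z ∩ evA b]) = meanYZ μ z / pA μ b := by
  rw [integral_cond_eq_tsum (evZ z ∩ evA b) (ipwY b μ) (fun x => (x.1, x.2.2.2))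
    (fun v => (v.2 : ℝ) / pAC μ b v.1)
    (fun v => pC μ v.1 * pAC μ b v.1 * pYZC μ v.2 z v.1 / pA μ b) (fun x hx => ?_)]
  · have hb0 := (hμ.pA_pos b).ne'
    have hterm : ∀ c (y : 𝒴), (y : ℝ) / pAC μ b c * (pC μ c * pAC μ b c * pYZC μ y z c / pA μ b) =
        (y : ℝ) * pYZC μ y z c * (pC μ c / pA μ b) := by
      intro c y
      have := (hμ.pAC_pos b c).ne'
      field_simp
    have hs : Summable fun v : 𝒞 × 𝒴 => (v.2 : ℝ) / pAC μ b v.1 *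
        (pC μ v.1 * pAC μ b v.1 * pYZC μ v.2 z v.1 / pA μ b) := by
      have hinj : Function.Injective fun v : 𝒞 × 𝒴 => (v.1, z, v.2) := by
        rintro ⟨c, y⟩ ⟨c', y'⟩ h
        simp only [Prod.mk.injEq] at h
        rw [h.1, h.2.2]
      refine (((hμ.summable_potMean hb).comp_injective hinj).mul_left
        (pZA μ z b * pA μ b)⁻¹).congr fun v => ?_
      have := (hμ.pZA_pos z b).ne'
      rw [hterm]
      simp only [Function.comp, potMass]
      field_simp
    refine (hs.hasSum.prod_fiberwise fun c => ?_).unique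
      ((hμ.hasSum_meanYZ hb z).div_const (pA μ b))
    exact ((hμ.hasSum_meanY hb z c).mul_right (pC μ c / pA μ b)).congr_fun (fun y => hterm c y)
      |>.trans (by rw [mul_div_assoc', mul_comm])
  · rintro ⟨c, y⟩
    have h : (evZ z ∩ evA b ∩ (fun x => (x.1, x.2.2.2)) ⁻¹' {(c, y)} :
        Set (Obs 𝒞 𝒜 𝒵 𝒴)) = {(c, b, z, y)} := by
      ext ⟨c', a', z', y'⟩
      simp only [evZ, evA, Set.mem_inter_iff, Set.mem_ofPred_eq, Set.mem_preimage,
        Set.mem_singleton_iff, Prod.mk.injEq]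
      tauto
    rw [h, hμ.real_singleton, Set.inter_comm, hμ.real_evA_evZ]
    have := (hμ.pA_pos b).ne'
    have := (hμ.pZA_pos z b).ne'
    field_simp
  · have hx' : x.2.1 = b := hx.2
    simp only [ipwY, hx', ind_self, one_mul, valY]

/-- The two series agree term by term, so no convergence enters. -/
theorem integral_ipwY_evA (b : 𝒜) : ∫ x, ipwY b μ x ∂(μ[|evA b]) = potMean μ b / pA μ b := by
  rw [integral_cond_eq_tsum (evA b) (ipwY b μ) (fun x => (x.1, x.2.2.1, x.2.2.2))
    (fun v => (v.2.2 : ℝ) / pAC μ b v.1) (fun v => pAC μ b v.1 * potMass μ b v / pA μ b)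
    (fun x hx => ?_)]
  · rw [potMean, ← tsum_div_const]
    refine tsum_congr fun v => ?_
    have := (hμ.pAC_pos b v.1).ne'
    field_simp
  · rintro ⟨c, z, y⟩
    have h : (evA b ∩ (fun x => (x.1, x.2.2.1, x.2.2.2)) ⁻¹' {(c, z, y)} :
        Set (Obs 𝒞 𝒜 𝒵 𝒴)) = {(c, b, z, y)} := by
      ext ⟨c', a', z', y'⟩
      simp only [evA, Set.mem_inter_iff, Set.mem_ofPred_eq, Set.mem_preimage,
        Set.mem_singleton_iff, Prod.mk.injEq]
      tauto
    rw [h, hμ.real_singleton, potMass, pA]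
    ring
  · have hx' : x.2.1 = b := hx
    simp only [ipwY, hx', ind_self, one_mul, valY]

/-- Given (C, Z, Y) only A is random, with mass p(a'|c) p(z|a') / p(z|c); the indicator selects a' =
b and the weight cancels p(b|c). -/
theorem integral_ipwY_evY (b : 𝒜) (c : 𝒞) (z : 𝒵) (y : 𝒴) :
    ∫ x, ipwY b μ x ∂(μ[|evY y ∩ (evZ z ∩ evC c)]) = (y : ℝ) * pZA μ z b / pZC μ z c := by
  rw [integral_cond_eq_tsum (evY y ∩ (evZ z ∩ evC c)) (ipwY b μ) (fun x => x.2.1)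
    (fun a' => ind b a' * (y : ℝ) / pAC μ b c) (fun a' => pAC μ a' c * pZA μ z a' / pZC μ z c)
    (fun x hx => ?_), tsum_eq_single b fun a' h => by simp [ind_of_ne h]]
  · have := (hμ.pAC_pos b c).ne'
    rw [ind_self]
    field_simp
  · intro a'
    have h : (evY y ∩ (evZ z ∩ evC c) ∩ (fun x => x.2.1) ⁻¹' {a'} :
        Set (Obs 𝒞 𝒜 𝒵 𝒴)) = {(c, a', z, y)} := by
      ext ⟨c', a', z', y'⟩
      simp only [evC, evZ, evY, Set.mem_inter_iff, Set.mem_ofPred_eq, Set.mem_preimage,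
        Set.mem_singleton_iff, Prod.mk.injEq]
      tauto
    rw [h, hμ.real_singleton, Set.inter_comm, hμ.real_evZ_evC_evY, hμ.real_evZ_evC]
    have := (hμ.pC_pos c).ne'
    have := (hμ.pYZC_pos y z c).ne'
    have := (hμ.pZC_pos z c).ne'
    field_simp
  · obtain ⟨h1, -, h3⟩ := hx
    have h1' : x.2.2.2 = y := h1
    have h3' : x.1 = c := h3
    simp only [ipwY, valY, h1', h3']

theorem integral_ipwY_evZ_evC {b : 𝒜} (hb : PotSq μ b) (c : 𝒞) (z : 𝒵) :
    ∫ x, ipwY b μ x ∂(μ[|evZ z ∩ evC c]) = meanY μ z c * pZA μ z b / pZC μ z c := by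
  rw [integral_cond_eq_tsum (evZ z ∩ evC c) (ipwY b μ) (fun x => (x.2.1, x.2.2.2))
    (fun v => ind b v.1 * (v.2 : ℝ) / pAC μ b c)
    (fun v => pAC μ v.1 c * pZA μ z v.1 * pYZC μ v.2 z c / pZC μ z c) (fun x hx => ?_)]
  · have hinj : Function.Injective fun y : 𝒴 => (b, y) := fun y y' h => (Prod.mk.inj h).2
    refine ((hinj.hasSum_iff fun v hv => ?_).1 (HasSum.congr_fun ((hμ.hasSum_meanY hb z c).mul_right
      (pZA μ z b / pZC μ z c)) fun y => ?_)).tsum_eq.trans (by ring)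
    · have h : v.1 ≠ b := fun h => hv ⟨v.2, by rw [← h]⟩
      simp [ind_of_ne h]
    · have := (hμ.pAC_pos b c).ne'
      simp only [Function.comp, ind_self]
      field_simp
  · rintro ⟨a', y⟩
    have h : (evZ z ∩ evC c ∩ (fun x => (x.2.1, x.2.2.2)) ⁻¹' {(a', y)} :
        Set (Obs 𝒞 𝒜 𝒵 𝒴)) = {(c, a', z, y)} := by
      ext ⟨c', a', z', y'⟩
      simp only [evC, evZ, Set.mem_inter_iff, Set.mem_ofPred_eq, Set.mem_preimage,
        Set.mem_singleton_iff, Prod.mk.injEq]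
      tauto
    rw [h, hμ.real_singleton, hμ.real_evZ_evC]
    have := (hμ.pC_pos c).ne'
    have := (hμ.pZC_pos z c).ne'
    field_simp
  · have h' : x.1 = c := hx.2
    simp only [ipwY, valY, h']

theorem rsTerm_eq {b : 𝒜} (hb : PotSq μ b) (c : 𝒞) (a' : 𝒜) (z : 𝒵) (y : 𝒴) :
    rsTerm b μ (c, a', z, y) = phiC b μ c + phiZ b μ a' z +
      ((y : ℝ) - meanY μ z c) * pZA μ z b / pZC μ z c := by
  have h : (∫ x, ipwY b μ x ∂(μ[|evZ z ∩ evA a'])) - ∫ x, ipwY b μ x ∂(μ[|evA a']) =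
      phiZ b μ a' z := by
    by_cases e : a' = b
    · subst e
      rw [hμ.integral_ipwY_evZ_evA hb, hμ.integral_ipwY_evA, phiZ, ind_self]
      ring
    · rw [integral_cond_ipwY_of_ne e Set.inter_subset_right, integral_cond_ipwY_of_ne e subset_rfl,
        phiZ, ind_of_ne e]
      ring
  simp only [rsTerm, h, hμ.integral_adjMean hb]
  simp only [hμ.adjMean_eq hb, hμ.integral_ipwY_evY, hμ.integral_ipwY_evZ_evC hb, phiC]
  ring

/-- `φ_{bd,fd,td}` is the Rotnitzky–Smucler influence function. -/
theorem phi_eq_rsEIF {as a : 𝒜} (hne : as ≠ a) (has : PotSq μ as) (ha : PotSq μ a)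
    (x : Obs 𝒞 𝒜 𝒵 𝒴) : phi as a μ (potMean μ as - potMean μ a) x = rsEIF as a μ x := by
  obtain ⟨c, a', z, y⟩ := x
  rw [hμ.phi_eq hne has ha, rsEIF, hμ.rsTerm_eq has, hμ.rsTerm_eq ha, phiY]
  ring

end Factorizes

end influence_function

/-! ### Orthogonality of the components and the variance. -/

section variance_of_influence_function

variable {𝒞 𝒜 𝒵 : Type*} {𝒴 : Set ℝ}
    [Countable 𝒞] [MeasurableSpace 𝒞] [MeasurableSingletonClass 𝒞]
    [Countable 𝒜] [MeasurableSpace 𝒜] [MeasurableSingletonClass 𝒜]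
    [Countable 𝒵] [MeasurableSpace 𝒵] [MeasurableSingletonClass 𝒵]
    [Countable 𝒴]

theorem setIntegral_eq_tsum {β : Type*} [Countable β] {μ : Measure (Obs 𝒞 𝒜 𝒵 𝒴)}
    [IsFiniteMeasure μ] (E : Set (Obs 𝒞 𝒜 𝒵 𝒴)) (f : Obs 𝒞 𝒜 𝒵 𝒴 → ℝ) (X : Obs 𝒞 𝒜 𝒵 𝒴 → β)
    (g : β → ℝ) (hf : ∀ x ∈ E, f x = g (X x)) :
    ∫ x in E, f x ∂μ = ∑' b, g b * μ.real (E ∩ X ⁻¹' {b}) := by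
  let _ : MeasurableSpace β := ⊤
  rw [setIntegral_congr_fun .of_discrete hf, integral_comp_eq_tsum .of_discrete]
  refine tsum_congr fun b => ?_
  rw [measureReal_restrict_apply .of_discrete, Set.inter_comm]

/-- A function whose mean vanishes given `X` is orthogonal to the functions of `X`. -/
theorem integral_comp_mul_eq_zero {β : Type*} [Countable β] {μ : Measure (Obs 𝒞 𝒜 𝒵 𝒴)}
    (X : Obs 𝒞 𝒜 𝒵 𝒴 → β) (g : β → ℝ) {f : Obs 𝒞 𝒜 𝒵 𝒴 → ℝ}
    (hf : ∀ b, ∫ x in X ⁻¹' {b}, f x ∂μ = 0) : ∫ x, g (X x) * f x ∂μ = 0 := by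
  by_cases h : Integrable (fun x => g (X x) * f x) μ
  · refine (hasSum_integral_fiber X g h).unique ?_
    simpa only [hf, mul_zero] using hasSum_zero
  -- Without integrability the integral is 0 by convention.
  · exact integral_undef h

namespace Factorizes

variable {μ : Measure (Obs 𝒞 𝒜 𝒵 𝒴)} (hμ : Factorizes μ)

include hμ

theorem real_preimage_CZY (c : 𝒞) (z : 𝒵) (y : 𝒴) :
    μ.real ((fun x => (x.1, x.2.2.1, x.2.2.2)) ⁻¹' {(c, z, y)}) =
      pC μ c * pZC μ z c * pYZC μ y z c := by
  rw [← hμ.real_evZ_evC, ← hμ.real_evZ_evC_evY]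
  congr 1
  ext x
  simp only [evC, evZ, evY, Set.mem_inter_iff, Set.mem_ofPred_eq, Set.mem_preimage,
    Set.mem_singleton_iff, Prod.mk.injEq]
  tauto

theorem real_preimage_AZ (a : 𝒜) (z : 𝒵) :
    μ.real ((fun x => (x.2.1, x.2.2.1)) ⁻¹' {(a, z)}) = pA μ a * pZA μ z a := by
  rw [← hμ.real_evA_evZ]
  congr 1
  ext x
  simp [evA, evZ]

/-! ### The component along `p(y | z, c)` -/

theorem hasSum_phiY_mul {as a b : 𝒜} (hb : PotSq μ b) (c : 𝒞) (z : 𝒵) :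
    HasSum (fun y => phiY as a μ c z y * pYZC μ y z c) 0 := by
  have h := ((hμ.hasSum_meanY hb z c).sub ((hμ.hasSum_pYZC z c).mul_left (meanY μ z c))).mul_right
    ((pZA μ z as - pZA μ z a) / pZC μ z c)
  rw [mul_one, sub_self, zero_mul] at h
  refine h.congr_fun fun y => ?_
  rw [phiY]
  ring

theorem hasSum_varY {b : 𝒜} (hb : PotSq μ b) (c : 𝒞) (z : 𝒵) :
    HasSum (fun y : 𝒴 => ((y : ℝ) - meanY μ z c) ^ 2 * pYZC μ y z c) (varY μ z c) := by
  rw [hμ.varY_eq]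
  refine Summable.hasSum ?_
  refine (((hμ.summable_sq_pYZC hb z c).sub ((hμ.hasSum_meanY hb z c).summable.mul_left
    (2 * meanY μ z c))).add ((hμ.hasSum_pYZC z c).summable.mul_left (meanY μ z c ^ 2))).congr
    fun y => ?_
  ring

/-- The weight p(c) p(z|c) p(y|z,c) cancels one of the two factors p(z|c) in the denominator of the
square, which leaves exactly one summand of the bound. -/
theorem hasSum_phiY_sq_fiber {as a b : 𝒜} (hb : PotSq μ b) (z : 𝒵) (c : 𝒞) :
    HasSum (fun y => phiY as a μ c z y ^ 2 * (pC μ c * pZC μ z c * pYZC μ y z c))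
      (boundSummand as a μ z c) := by
  have h0 := (hμ.pZC_pos z c).ne'
  have h := (hμ.hasSum_varY hb c z).mul_left
    ((pZA μ z as - pZA μ z a) ^ 2 * pC μ c / pZC μ z c)
  have e : (pZA μ z as - pZA μ z a) ^ 2 * pC μ c / pZC μ z c * varY μ z c =
      boundSummand as a μ z c := by
    rw [boundSummand, pZC]
    ring
  rw [e] at h
  refine h.congr_fun fun y => ?_
  rw [phiY]
  field_simp

/-- The hypothesis `hfin` is thus square integrability of the outcome component, and its sum is the
second moment. -/
theorem hasSum_phiY_sq {as a b : 𝒜} (hb : PotSq μ b)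
    (hfin : Summable fun zc : 𝒵 × 𝒞 => boundSummand as a μ zc.1 zc.2) :
    HasSum (fun v : 𝒞 × 𝒵 × 𝒴 => phiY as a μ v.1 v.2.1 v.2.2 ^ 2 *
      μ.real ((fun x => (x.1, x.2.2.1, x.2.2.2)) ⁻¹' {v}))
      (∑' zc : 𝒵 × 𝒞, boundSummand as a μ zc.1 zc.2) := by
  have hs : Summable fun w : (𝒞 × 𝒵) × 𝒴 => phiY as a μ w.1.1 w.1.2 w.2 ^ 2 *
      (pC μ w.1.1 * pZC μ w.1.2 w.1.1 * pYZC μ w.2 w.1.2 w.1.1) := by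
    refine (summable_prod_of_nonneg fun w => ?_).2 ⟨fun x => ?_, ?_⟩
    · exact mul_nonneg (sq_nonneg _) (mul_pos (mul_pos (hμ.pC_pos _) (hμ.pZC_pos _ _))
        (hμ.pYZC_pos _ _ _)).le
    · exact (hμ.hasSum_phiY_sq_fiber hb x.2 x.1).summable
    · refine ((Equiv.prodComm 𝒞 𝒵).summable_iff.2 hfin).congr fun x => ?_
      exact ((hμ.hasSum_phiY_sq_fiber hb x.2 x.1).tsum_eq).symm
  have h := hs.hasSum.prod_fiberwise fun x => hμ.hasSum_phiY_sq_fiber hb x.2 x.1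
  have e := h.unique ((Equiv.prodComm 𝒞 𝒵).hasSum_iff.2 hfin.hasSum)
  rw [← e]
  refine (Equiv.prodAssoc 𝒞 𝒵 𝒴).hasSum_iff.1 (hs.hasSum.congr_fun fun w => ?_)
  simp only [Function.comp, Equiv.prodAssoc_apply, hμ.real_preimage_CZY]

theorem memLp_phiY {as a b : 𝒜} (hb : PotSq μ b)
    (hfin : Summable fun zc : 𝒵 × 𝒞 => boundSummand as a μ zc.1 zc.2) :
    MemLp (fun x : Obs 𝒞 𝒜 𝒵 𝒴 => phiY as a μ x.1 x.2.2.1 x.2.2.2) 2 μ := by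
  have := hμ.isProbabilityMeasure
  rw [memLp_two_iff_integrable_sq (Measurable.of_discrete).aestronglyMeasurable]
  exact (integrable_comp_iff (μ := μ) (X := fun x : Obs 𝒞 𝒜 𝒵 𝒴 => (x.1, x.2.2.1, x.2.2.2))
    .of_discrete fun v => phiY as a μ v.1 v.2.1 v.2.2 ^ 2).2 (hμ.hasSum_phiY_sq hb hfin).summable

theorem integral_phiY_sq {as a b : 𝒜} (hb : PotSq μ b)
    (hfin : Summable fun zc : 𝒵 × 𝒞 => boundSummand as a μ zc.1 zc.2) :
    ∫ x, phiY as a μ x.1 x.2.2.1 x.2.2.2 ^ 2 ∂μ = ∑' z, (pZA μ z as - pZA μ z a) ^ 2 *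
      ∑' c, pC μ c * varY μ z c / (∑' b, pAC μ b c * pZA μ z b) := by
  have := hμ.isProbabilityMeasure
  rw [integral_comp_eq_tsum (μ := μ) (X := fun x : Obs 𝒞 𝒜 𝒵 𝒴 => (x.1, x.2.2.1, x.2.2.2))
    .of_discrete fun v => phiY as a μ v.1 v.2.1 v.2.2 ^ 2, (hμ.hasSum_phiY_sq hb hfin).tsum_eq,
    hfin.tsum_prod]
  refine tsum_congr fun z => ?_
  rw [← tsum_mul_left]
  rfl

/-- Given (C, A, Z) the outcome has mass p(y|z,c), free of a, so the centring at E(Y|z,c) also works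
on these finer fibers. This gives orthogonality to every function of (C, A, Z). -/
theorem setIntegral_phiY {as a b : 𝒜} (hb : PotSq μ b) (v : 𝒞 × 𝒜 × 𝒵) :
    ∫ x in (fun x => (x.1, x.2.1, x.2.2.1)) ⁻¹' {v}, phiY as a μ x.1 x.2.2.1 x.2.2.2 ∂μ = 0 := by
  have := hμ.isProbabilityMeasure
  obtain ⟨c, a', z⟩ := v
  rw [setIntegral_eq_tsum _ _ (fun x => x.2.2.2) (phiY as a μ c z) fun x hx => ?_]
  · have h := (hμ.hasSum_phiY_mul (as := as) (a := a) hb c z).mul_left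
      (pC μ c * pAC μ a' c * pZA μ z a')
    rw [mul_zero] at h
    refine (h.congr_fun fun y => ?_).tsum_eq
    have e : (fun x : Obs 𝒞 𝒜 𝒵 𝒴 => (x.1, x.2.1, x.2.2.1)) ⁻¹' {(c, a', z)} ∩
        (fun x => x.2.2.2) ⁻¹' {y} = {(c, a', z, y)} := by
      ext ⟨c', a', z', y'⟩
      simp only [Set.mem_inter_iff, Set.mem_preimage, Set.mem_singleton_iff, Prod.mk.injEq]
      tauto
    rw [e, hμ.real_singleton]
    ring
  · simp only [Set.mem_preimage, Set.mem_singleton_iff, Prod.mk.injEq] at hx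
    rw [hx.1, hx.2.2]

/-! ### The component along `p(z | a)` -/

theorem hasSum_phiZ_mul {b : 𝒜} (hb : PotSq μ b) (a' : 𝒜) :
    HasSum (fun z => phiZ b μ a' z * pZA μ z a') 0 := by
  by_cases e : a' = b
  · subst e
    have h := ((hμ.hasSum_potMean_Z hb).sub ((hμ.hasSum_pZA a').mul_left
      (potMean μ a'))).mul_right (1 / pA μ a')
    rw [mul_one, sub_self, zero_mul] at h
    refine h.congr_fun fun z => ?_
    rw [phiZ, ind_self]
    ring
  · simp [phiZ, ind_of_ne e]

/-- Only the slice A = b contributes: the value is the variance of `meanYZ` under p(·|b), divided by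
p(b). -/
theorem hasSum_phiZ_sq {b : 𝒜} (hb : PotSq μ b) :
    HasSum (fun v : 𝒜 × 𝒵 => phiZ b μ v.1 v.2 ^ 2 *
      μ.real ((fun x => (x.2.1, x.2.2.1)) ⁻¹' {v}))
      (∑' z, pZA μ z b / pA μ b * meanYZ μ z ^ 2 - potMean μ b ^ 2 / pA μ b) := by
  have h0 := (hμ.pA_pos b).ne'
  have hinj : Function.Injective fun z : 𝒵 => (b, z) := fun z z' h => (Prod.mk.inj h).2
  refine (hinj.hasSum_iff fun v hv => ?_).1 ?_
  · have h : v.1 ≠ b := fun h => hv ⟨v.2, by rw [← h]⟩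
    simp [phiZ, ind_of_ne h]
  · have h1 : HasSum (fun z => pZA μ z b / pA μ b * meanYZ μ z ^ 2)
        (∑' z, pZA μ z b / pA μ b * meanYZ μ z ^ 2) :=
      (((hμ.summable_meanYZ_sq hb).mul_left (1 / pA μ b)).congr fun z => by ring).hasSum
    have h2 := (hμ.hasSum_potMean_Z hb).mul_left (-2 * potMean μ b / pA μ b)
    have h3 := (hμ.hasSum_pZA b).mul_left (potMean μ b ^ 2 / pA μ b)
    have h := (h1.add h2).add h3
    have e : ∑' z, pZA μ z b / pA μ b * meanYZ μ z ^ 2 +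
        -2 * potMean μ b / pA μ b * potMean μ b + potMean μ b ^ 2 / pA μ b * 1 =
        ∑' z, pZA μ z b / pA μ b * meanYZ μ z ^ 2 - potMean μ b ^ 2 / pA μ b := by ring
    rw [e] at h
    refine h.congr_fun fun z => ?_
    simp only [Function.comp, hμ.real_preimage_AZ, phiZ, ind_self]
    field_simp
    ring

theorem memLp_phiZ {b : 𝒜} (hb : PotSq μ b) :
    MemLp (fun x : Obs 𝒞 𝒜 𝒵 𝒴 => phiZ b μ x.2.1 x.2.2.1) 2 μ := by
  have := hμ.isProbabilityMeasure
  rw [memLp_two_iff_integrable_sq (Measurable.of_discrete).aestronglyMeasurable]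
  exact (integrable_comp_iff (μ := μ) (X := fun x : Obs 𝒞 𝒜 𝒵 𝒴 => (x.2.1, x.2.2.1))
    .of_discrete fun v => phiZ b μ v.1 v.2 ^ 2).2 (hμ.hasSum_phiZ_sq hb).summable

theorem integral_phiZ_sq {b : 𝒜} (hb : PotSq μ b) :
    ∫ x, phiZ b μ x.2.1 x.2.2.1 ^ 2 ∂μ =
      ∑' z, pZA μ z b / pA μ b * meanYZ μ z ^ 2 - potMean μ b ^ 2 / pA μ b := by
  have := hμ.isProbabilityMeasure
  rw [integral_comp_eq_tsum (μ := μ) (X := fun x : Obs 𝒞 𝒜 𝒵 𝒴 => (x.2.1, x.2.2.1))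
    .of_discrete fun v => phiZ b μ v.1 v.2 ^ 2, (hμ.hasSum_phiZ_sq hb).tsum_eq]

/-- Given (C, A) the mediator has mass p(z|a), free of c, hence orthogonality to every function of
(C, A). -/
theorem setIntegral_phiZ {b : 𝒜} (hb : PotSq μ b) (v : 𝒞 × 𝒜) :
    ∫ x in (fun x => (x.1, x.2.1)) ⁻¹' {v}, phiZ b μ x.2.1 x.2.2.1 ∂μ = 0 := by
  have := hμ.isProbabilityMeasure
  obtain ⟨c, a'⟩ := v
  rw [setIntegral_eq_tsum _ _ (fun x => x.2.2.1) (phiZ b μ a') fun x hx => ?_]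
  · have h := (hμ.hasSum_phiZ_mul hb a').mul_left (pC μ c * pAC μ a' c)
    rw [mul_zero] at h
    refine (h.congr_fun fun z => ?_).tsum_eq
    have e : (fun x : Obs 𝒞 𝒜 𝒵 𝒴 => (x.1, x.2.1)) ⁻¹' {(c, a')} ∩
        (fun x => x.2.2.1) ⁻¹' {z} = evC c ∩ evA a' ∩ evZ z := by
      ext x
      simp [evC, evA, evZ]
    rw [e, hμ.real_evC_evA_evZ]
    ring
  · simp only [Set.mem_preimage, Set.mem_singleton_iff, Prod.mk.injEq] at hx
    rw [hx.2]

/-! ### The component along `p(c)` -/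

theorem hasSum_phiC_mul {b : 𝒜} (hb : PotSq μ b) :
    HasSum (fun c => phiC b μ c * pC μ c) 0 := by
  have h := (hμ.hasSum_potMean_C hb).sub (hμ.hasSum_pC.mul_left (potMean μ b))
  rw [mul_one, sub_self] at h
  refine h.congr_fun fun c => ?_
  rw [phiC]
  ring

theorem memLp_meanYC {b : 𝒜} (hb : PotSq μ b) :
    MemLp (fun x : Obs 𝒞 𝒜 𝒵 𝒴 => meanYC μ b x.1) 2 μ := by
  have := hμ.isProbabilityMeasure
  rw [memLp_two_iff_integrable_sq (Measurable.of_discrete).aestronglyMeasurable]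
  exact (integrable_comp_iff (μ := μ) (X := fun x : Obs 𝒞 𝒜 𝒵 𝒴 => x.1)
    .of_discrete fun c => meanYC μ b c ^ 2).2 (hμ.summable_meanYC_sq hb)

theorem memLp_phiC {b : 𝒜} (hb : PotSq μ b) :
    MemLp (fun x : Obs 𝒞 𝒜 𝒵 𝒴 => phiC b μ x.1) 2 μ := by
  have := hμ.isProbabilityMeasure
  exact (hμ.memLp_meanYC hb).sub (memLp_const _)

theorem integral_phiC {b : 𝒜} (hb : PotSq μ b) : ∫ x, phiC b μ x.1 ∂μ = 0 := by
  have := hμ.isProbabilityMeasure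
  rw [integral_comp_eq_tsum (μ := μ) (X := fun x : Obs 𝒞 𝒜 𝒵 𝒴 => x.1) .of_discrete (phiC b μ)]
  exact (hμ.hasSum_phiC_mul hb).tsum_eq

theorem integral_phiC_sub_sq {as a : 𝒜} (has : PotSq μ as) (ha : PotSq μ a) :
    ∫ x, (phiC as μ x.1 - phiC a μ x.1) ^ 2 ∂μ =
      ∑' c, pC μ c * (∑' z, meanY μ z c * (pZA μ z as - pZA μ z a)) ^ 2 -
        (potMean μ as - potMean μ a) ^ 2 := by
  have := hμ.isProbabilityMeasure
  rw [integral_comp_eq_tsum (μ := μ) (X := fun x : Obs 𝒞 𝒜 𝒵 𝒴 => x.1) .of_discrete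
    fun c => (phiC as μ c - phiC a μ c) ^ 2]
  have h0 : ∀ c, ∑' z, meanY μ z c * (pZA μ z as - pZA μ z a) = meanYC μ as c - meanYC μ a c := by
    intro c
    refine (((hμ.hasSum_meanYC has c).sub (hμ.hasSum_meanYC ha c)).congr_fun fun z => ?_).tsum_eq
    ring
  simp only [h0]
  have hcross := summable_mul_of_sq_weight (fun c => (hμ.pC_pos c).le)
    (hμ.summable_meanYC_sq has) (hμ.summable_meanYC_sq ha)
  have h1 : HasSum (fun c => pC μ c * (meanYC μ as c - meanYC μ a c) ^ 2)
      (∑' c, pC μ c * (meanYC μ as c - meanYC μ a c) ^ 2) :=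
    ((((hμ.summable_meanYC_sq has).add (hμ.summable_meanYC_sq ha)).sub
      (hcross.mul_left 2)).congr fun c => by ring).hasSum
  have h2 := ((hμ.hasSum_potMean_C has).sub (hμ.hasSum_potMean_C ha)).mul_left
    (-2 * (potMean μ as - potMean μ a))
  have h3 := hμ.hasSum_pC.mul_left ((potMean μ as - potMean μ a) ^ 2)
  refine (((h1.add h2).add h3).congr_fun fun c => ?_).tsum_eq.trans (by ring)
  change _ * pC μ c = _
  rw [phiC, phiC]
  ring

/-! ### The influence function -/

variable {as a : 𝒜} (hne : as ≠ a) (has : PotSq μ as) (ha : PotSq μ a)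
  (hfin : Summable fun zc : 𝒵 × 𝒞 => boundSummand as a μ zc.1 zc.2)

include hne has ha

theorem phi_eq_fun : phi as a μ (potMean μ as - potMean μ a) = fun x : Obs 𝒞 𝒜 𝒵 𝒴 =>
    phiY as a μ x.1 x.2.2.1 x.2.2.2 + (phiZ as μ x.2.1 x.2.2.1 - phiZ a μ x.2.1 x.2.2.1) +
      (phiC as μ x.1 - phiC a μ x.1) := by
  ext ⟨c, a', z, y⟩
  exact hμ.phi_eq hne has ha c a' z y

include hfin

theorem memLp_phi : MemLp (phi as a μ (potMean μ as - potMean μ a)) 2 μ := by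
  rw [hμ.phi_eq_fun hne has ha]
  exact ((hμ.memLp_phiY has hfin).add ((hμ.memLp_phiZ has).sub (hμ.memLp_phiZ ha))).add
    ((hμ.memLp_phiC has).sub (hμ.memLp_phiC ha))

theorem integral_phi : ∫ x, phi as a μ (potMean μ as - potMean μ a) x ∂μ = 0 := by
  have := hμ.isProbabilityMeasure
  have i1 := (hμ.memLp_phiY has hfin).integrable one_le_two
  have i2 := (hμ.memLp_phiZ has).integrable one_le_two
  have i3 := (hμ.memLp_phiZ ha).integrable one_le_two
  have i4 := (hμ.memLp_phiC has).integrable one_le_two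
  have i5 := (hμ.memLp_phiC ha).integrable one_le_two
  have i23 : Integrable (fun x : Obs 𝒞 𝒜 𝒵 𝒴 =>
    phiZ as μ x.2.1 x.2.2.1 - phiZ a μ x.2.1 x.2.2.1) μ := i2.sub i3
  have i45 : Integrable (fun x : Obs 𝒞 𝒜 𝒵 𝒴 => phiC as μ x.1 - phiC a μ x.1) μ := i4.sub i5
  rw [hμ.phi_eq_fun hne has ha]
  beta_reduce
  rw [integral_add (by fun_prop) i45, integral_add i1 i23, integral_sub i2 i3, integral_sub i4 i5, hμ.integral_phiC has,
    hμ.integral_phiC ha]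
  have h1 := integral_comp_mul_eq_zero (μ := μ) _ (fun _ => 1)
    (hμ.setIntegral_phiY (as := as) (a := a) has)
  have h2 := integral_comp_mul_eq_zero (μ := μ) _ (fun _ => 1) (hμ.setIntegral_phiZ has)
  have h3 := integral_comp_mul_eq_zero (μ := μ) _ (fun _ => 1) (hμ.setIntegral_phiZ ha)
  simp only [one_mul] at h1 h2 h3
  rw [h1, h2, h3]
  ring

/-- The variance of the influence function. -/
theorem variance_phi : variance (phi as a μ (potMean μ as - potMean μ a)) μ =
    bound as a μ (potMean μ as - potMean μ a) := by
  have := hμ.isProbabilityMeasure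
  rw [variance_of_integral_eq_zero (Measurable.of_discrete).aemeasurable
    (hμ.integral_phi hne has ha hfin)]
  set F := fun x : Obs 𝒞 𝒜 𝒵 𝒴 => phiY as a μ x.1 x.2.2.1 x.2.2.2 with hF
  set G := fun (b : 𝒜) (x : Obs 𝒞 𝒜 𝒵 𝒴) => phiZ b μ x.2.1 x.2.2.1 with hG
  set H := fun x : Obs 𝒞 𝒜 𝒵 𝒴 => phiC as μ x.1 - phiC a μ x.1 with hH
  have m1 : MemLp F 2 μ := hμ.memLp_phiY has hfin
  have m2 : MemLp (G as) 2 μ := hμ.memLp_phiZ has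
  have m3 : MemLp (G a) 2 μ := hμ.memLp_phiZ ha
  have m4 : MemLp H 2 μ := (hμ.memLp_phiC has).sub (hμ.memLp_phiC ha)
  -- The product of the two mediator components is zero pointwise because their indicators have
  -- disjoint supports; the other cross terms vanish only after integration.
  have hexp : ∀ x, phi as a μ (potMean μ as - potMean μ a) x ^ 2 =
      F x ^ 2 + G as x ^ 2 + G a x ^ 2 + H x ^ 2 + 2 * ((G as x - G a x + H x) * F x) +
        2 * (H x * G as x) - 2 * (H x * G a x) := by
    intro x
    have h : G as x * G a x = 0 := by
      simp only [hG, phiZ]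
      by_cases e : x.2.1 = as
      · rw [e, ind_of_ne hne]
        ring
      · rw [ind_of_ne e]
        ring
    rw [hμ.phi_eq_fun hne has ha]
    simp only [hF, hG, hH] at h ⊢
    linear_combination (-2) * h
  -- Everything multiplying the outcome component is a function of (C, A, Z).
  have o1 : ∫ x, (G as x - G a x + H x) * F x ∂μ = 0 :=
    integral_comp_mul_eq_zero (fun x => (x.1, x.2.1, x.2.2.1))
      (fun v => phiZ as μ v.2.1 v.2.2 - phiZ a μ v.2.1 v.2.2 + (phiC as μ v.1 - phiC a μ v.1))
      (hμ.setIntegral_phiY has)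
  have o2 : ∀ b, PotSq μ b → ∫ x, H x * G b x ∂μ = 0 := fun b hb =>
    integral_comp_mul_eq_zero (fun x => (x.1, x.2.1))
      (fun v => phiC as μ v.1 - phiC a μ v.1) (hμ.setIntegral_phiZ hb)
  have i1 := m1.integrable_sq
  have i2 := m2.integrable_sq
  have i3 := m3.integrable_sq
  have i4 := m4.integrable_sq
  have i5 : Integrable (fun x => 2 * ((G as x - G a x + H x) * F x)) μ :=
    (((m2.sub m3).add m4).integrable_mul m1).const_mul 2
  have i6 : Integrable (fun x => 2 * (H x * G as x)) μ := (m4.integrable_mul m2).const_mul 2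
  have i7 : Integrable (fun x => 2 * (H x * G a x)) μ := (m4.integrable_mul m3).const_mul 2
  have e1 := hμ.integral_phiY_sq has hfin
  have e2 := hμ.integral_phiZ_sq has
  have e3 := hμ.integral_phiZ_sq ha
  have e4 := hμ.integral_phiC_sub_sq has ha
  have e5 : ∀ b, PotSq μ b →
      ∑' zc : 𝒵 × 𝒞, meanY μ zc.1 zc.2 * pZA μ zc.1 b * pC μ zc.2 = potMean μ b := by
    intro b hb
    refine (HasSum.congr_fun ((Equiv.prodComm 𝒵 𝒞).hasSum_iff.2 (hμ.hasSum_potMean_pair hb))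
      fun zc => ?_).tsum_eq
    simp only [Function.comp, Equiv.prodComm_apply, Prod.swap]
    ring
  simp only [hexp]
  rw [integral_sub (by fun_prop) i7, integral_add (by fun_prop) i6, integral_add (by fun_prop) i5,
    integral_add (by fun_prop) i4, integral_add (by fun_prop) i3, integral_add i1 i2,
    integral_const_mul, integral_const_mul, integral_const_mul, o1, o2 as has, o2 a ha, bound,
    e5 as has, e5 a ha, e1, e2, e3, e4]
  simp only [meanYZ]
  ring

end Factorizes

end variance_of_influence_function

/-! ### Differentiability in quadratic mean for curves of measures. -/

section quadratic_mean_measures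

variable {β : Type*} [Countable β] [MeasurableSpace β] [MeasurableSingletonClass β]

theorem integrable_iff_summable {ν : Measure β} [IsFiniteMeasure ν] (f : β → ℝ) :
    Integrable f ν ↔ Summable fun x => f x * ν.real {x} :=
  integrable_comp_iff measurable_id f

theorem integral_eq_tsum_mul_real {ν : Measure β} [IsFiniteMeasure ν] (f : β → ℝ) :
    ∫ x, f x ∂ν = ∑' x, f x * ν.real {x} :=
  integral_comp_eq_tsum measurable_id f

theorem memLp_two_iff_summable {ν : Measure β} [IsFiniteMeasure ν] (f : β → ℝ) :
    MemLp f 2 ν ↔ Summable fun x => f x ^ 2 * ν.real {x} := by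
  rw [memLp_two_iff_integrable_sq (Measurable.of_discrete).aestronglyMeasurable,
    integrable_iff_summable]

/-- Along a curve of laws that is differentiable in quadratic mean, the mean of a function with
locally bounded second moment is differentiable. -/
theorem IsQMD.hasDerivAt_integral {ν : ℝ → Measure β} {s : β → ℝ}
    (hs : IsQMD (fun t x => (ν t).real {x}) s)
    (hR : ∀ᶠ t in 𝓝 (0 : ℝ), IsProbabilityMeasure (ν t)) {f : β → ℝ} {K : ℝ}
    (hf : ∀ᶠ t in 𝓝 (0 : ℝ), MemLp f 2 (ν t) ∧ ∫ x, f x ^ 2 ∂(ν t) ≤ K) :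
    HasDerivAt (fun t => ∫ x, f x ∂(ν t)) (∫ x, f x * s x ∂(ν 0)) 0 := by
  have := hR.self_of_nhds
  have h := hs.hasDerivAt_tsum (f := f) (K := K) ?_ ?_ ?_
  · rw [integral_eq_tsum_mul_real]
    simp only [mul_assoc]
    refine h.congr_of_eventuallyEq ?_
    filter_upwards [hR] with t ht
    exact integral_eq_tsum_mul_real f
  · filter_upwards [hR] with t ht
    refine ⟨fun x => measureReal_nonneg, ?_⟩
    simpa using (integrable_iff_summable (ν := ν t) (fun _ => (1 : ℝ))).1 (integrable_const _)
  · filter_upwards [hR, hf] with t ht h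
    exact (memLp_two_iff_summable f).1 h.1
  · filter_upwards [hR, hf] with t ht h
    rw [← integral_eq_tsum_mul_real (fun x => f x ^ 2)]
    exact h.2

theorem IsQMD.hasDerivAt_real {ν : ℝ → Measure β} {s : β → ℝ}
    (hs : IsQMD (fun t x => (ν t).real {x}) s)
    (hR : ∀ᶠ t in 𝓝 (0 : ℝ), IsProbabilityMeasure (ν t)) (E : Set β) :
    HasDerivAt (fun t => (ν t).real E) (∫ x in E, s x ∂(ν 0)) 0 := by
  have h := hs.hasDerivAt_integral hR (f := E.indicator 1) (K := 1) ?_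
  · simp only [integral_indicator_one (MeasurableSet.of_discrete (s := E))] at h
    rw [← integral_indicator .of_discrete]
    convert! h using 3 with x
    by_cases hx : x ∈ E <;> simp [hx]
  · filter_upwards [hR] with t ht
    refine ⟨(memLp_const (1 : ℝ)).indicator .of_discrete, ?_⟩
    have e : ∀ x, E.indicator (1 : β → ℝ) x ^ 2 = E.indicator 1 x := fun x => by
      by_cases hx : x ∈ E <;> simp [hx]
    simp only [e, integral_indicator_one (MeasurableSet.of_discrete (s := E))]
    exact measureReal_le_one

theorem IsQMD.memLp {ν : ℝ → Measure β} {s : β → ℝ}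
    (hs : IsQMD (fun t x => (ν t).real {x}) s) [IsFiniteMeasure (ν 0)] : MemLp s 2 (ν 0) :=
  (memLp_two_iff_summable s).2 hs.summable

/-- Jensen's inequality on an event. -/
theorem sq_setIntegral_div_le {ν : Measure β} [IsFiniteMeasure ν] {s : β → ℝ} (hs : MemLp s 2 ν)
    {E : Set β} (hE : 0 < ν.real E) :
    (∫ x in E, s x ∂ν) ^ 2 / ν.real E ≤ ∫ x in E, s x ^ 2 ∂ν := by
  set m := (∫ x in E, s x ∂ν) / ν.real E with hm
  have i1 : IntegrableOn (fun x => s x ^ 2) E ν := hs.integrable_sq.integrableOn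
  have i2 : IntegrableOn (fun x => 2 * m * s x) E ν :=
    ((hs.integrable one_le_two).const_mul _).integrableOn
  -- The integrand is (s − m)², where m is the mean of s over E.
  have h0 : 0 ≤ ∫ x in E, (s x ^ 2 - 2 * m * s x + m ^ 2) ∂ν :=
    integral_nonneg fun x => by
      change 0 ≤ s x ^ 2 - 2 * m * s x + m ^ 2
      nlinarith [sq_nonneg (s x - m)]
  have i12 : IntegrableOn (fun x => s x ^ 2 - 2 * m * s x) E ν := i1.sub i2
  rw [integral_add i12 (integrable_const _), integral_sub i1 i2, integral_const_mul,
    setIntegral_const, smul_eq_mul] at h0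
  have e : ν.real E * m ^ 2 = (∫ x in E, s x ∂ν) ^ 2 / ν.real E := by
    rw [hm]
    field_simp
  have e' : m * ∫ x in E, s x ∂ν = (∫ x in E, s x ∂ν) ^ 2 / ν.real E := by
    rw [hm]
    ring
  rw [e, mul_assoc, e'] at h0
  linarith

end quadratic_mean_measures

/-! ### Scores of the factors along a regular submodel. -/

section gradient

variable {𝒞 𝒜 𝒵 : Type*} {𝒴 : Set ℝ}
    [Countable 𝒞] [MeasurableSpace 𝒞] [MeasurableSingletonClass 𝒞]
    [Countable 𝒜] [MeasurableSpace 𝒜] [MeasurableSingletonClass 𝒜]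
    [Countable 𝒵] [MeasurableSpace 𝒵] [MeasurableSingletonClass 𝒵]
    [Countable 𝒴]

/-- A regular submodel is made of probability measures near the truth. -/
theorem IsRegularSubmodel.isProbabilityMeasure_obsLaw {as a : 𝒜} {μ : Measure (Obs 𝒞 𝒜 𝒵 𝒴)}
    {Q : ℝ → Measure (Table 𝒞 𝒜 𝒵 𝒴)} {S : Obs 𝒞 𝒜 𝒵 𝒴 → ℝ}
    (h : IsRegularSubmodel as a μ Q S) : ∀ᶠ t in 𝓝 (0 : ℝ), IsProbabilityMeasure (obsLaw (Q t)) :=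
  h.inModel.mono fun _ ht => ht.factorizes.isProbabilityMeasure

theorem IsRegularSubmodel.isProbabilityMeasure_potLaw {as a : 𝒜} {μ : Measure (Obs 𝒞 𝒜 𝒵 𝒴)}
    {Q : ℝ → Measure (Table 𝒞 𝒜 𝒵 𝒴)} {S : Obs 𝒞 𝒜 𝒵 𝒴 → ℝ}
    (h : IsRegularSubmodel as a μ Q S) (b : 𝒜) :
    ∀ᶠ t in 𝓝 (0 : ℝ), IsProbabilityMeasure (potLaw b (Q t)) := by
  filter_upwards [h.inModel] with t ht
  have := ht.isProbabilityMeasure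
  exact Measure.isProbabilityMeasure_map (by fun_prop)

variable {as a : 𝒜} {μ : Measure (Obs 𝒞 𝒜 𝒵 𝒴)} {Q : ℝ → Measure (Table 𝒞 𝒜 𝒵 𝒴)}
  {S : Obs 𝒞 𝒜 𝒵 𝒴 → ℝ} (hQ : IsRegularSubmodel as a μ Q S)

include hQ

theorem IsRegularSubmodel.memLp : MemLp S 2 μ := by
  have := hQ.isProbabilityMeasure_obsLaw.self_of_nhds
  have h := IsQMD.memLp (ν := fun t => obsLaw (Q t)) hQ.score
  rwa [hQ.base] at h

theorem IsRegularSubmodel.hasDerivAt_real (E : Set (Obs 𝒞 𝒜 𝒵 𝒴)) :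
    HasDerivAt (fun t => (obsLaw (Q t)).real E) (∫ x in E, S x ∂μ) 0 := by
  have h := IsQMD.hasDerivAt_real (ν := fun t => obsLaw (Q t)) hQ.score
    hQ.isProbabilityMeasure_obsLaw E
  rwa [hQ.base] at h

theorem IsRegularSubmodel.integral_score : ∫ x, S x ∂μ = 0 := by
  have h := hQ.hasDerivAt_real Set.univ
  rw [setIntegral_univ] at h
  refine h.unique ((hasDerivAt_const (0 : ℝ) (1 : ℝ)).congr_of_eventuallyEq ?_)
  filter_upwards [hQ.isProbabilityMeasure_obsLaw] with t ht
  exact probReal_univ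

/-- The score of `p(c)`. -/
def scoreC (μ : Measure (Obs 𝒞 𝒜 𝒵 𝒴)) (S : Obs 𝒞 𝒜 𝒵 𝒴 → ℝ) (c : 𝒞) : ℝ :=
  (∫ x in evC c, S x ∂μ) / pC μ c

/-- The score of `p(z | b)`. -/
def scoreZ (μ : Measure (Obs 𝒞 𝒜 𝒵 𝒴)) (S : Obs 𝒞 𝒜 𝒵 𝒴 → ℝ) (b : 𝒜) (z : 𝒵) : ℝ :=
  (∫ x in evA b ∩ evZ z, S x ∂μ) / (pA μ b * pZA μ z b) - (∫ x in evA b, S x ∂μ) / pA μ b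

/-- The score of `p(y | z, c)`. -/
def scoreY (μ : Measure (Obs 𝒞 𝒜 𝒵 𝒴)) (S : Obs 𝒞 𝒜 𝒵 𝒴 → ℝ) (c : 𝒞) (z : 𝒵) (y : 𝒴) : ℝ :=
  (∫ x in evZ z ∩ evC c ∩ evY y, S x ∂μ) / (pC μ c * pZC μ z c * pYZC μ y z c) -
    (∫ x in evZ z ∩ evC c, S x ∂μ) / (pC μ c * pZC μ z c)

theorem IsRegularSubmodel.factorizes : Factorizes μ := by
  have h := hQ.inModel.self_of_nhds.factorizes
  rwa [hQ.base] at h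

/-- Near 0 the mass p(c) p(z|b) p(y|z,c) is a rational expression in five observed-event
probabilities, each differentiable; its logarithmic derivative is the sum of the three scores. -/
theorem IsRegularSubmodel.hasDerivAt_potLaw_real (b : 𝒜) (c : 𝒞) (z : 𝒵) (y : 𝒴) :
    HasDerivAt (fun t => (potLaw b (Q t)).real {(c, z, y)})
      ((scoreC μ S c + scoreZ μ S b z + scoreY μ S c z y) * potMass μ b (c, z, y)) 0 := by
  have hμ := hQ.factorizes
  have d1 := hQ.hasDerivAt_real (evC c)
  have d2 := hQ.hasDerivAt_real (evA b ∩ evZ z)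
  have d3 := hQ.hasDerivAt_real (evA b)
  have d4 := hQ.hasDerivAt_real (evZ z ∩ evC c ∩ evY y)
  have d5 := hQ.hasDerivAt_real (evZ z ∩ evC c)
  have n1 := (hμ.pC_pos c).ne'
  have n2 := (hμ.pA_pos b).ne'
  have n3 := (hμ.pZA_pos z b).ne'
  have n4 := (hμ.pZC_pos z c).ne'
  have n5 := (hμ.pYZC_pos y z c).ne'
  have e1 : (obsLaw (Q 0)).real (evC c) = pC μ c := by rw [hQ.base]; rfl
  have e2 : (obsLaw (Q 0)).real (evA b ∩ evZ z) = pA μ b * pZA μ z b := by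
    rw [hQ.base, hμ.real_evA_evZ]
  have e3 : (obsLaw (Q 0)).real (evA b) = pA μ b := by rw [hQ.base]; rfl
  have e4 : (obsLaw (Q 0)).real (evZ z ∩ evC c ∩ evY y) = pC μ c * pZC μ z c * pYZC μ y z c := by
    rw [hQ.base, hμ.real_evZ_evC_evY, hμ.real_evZ_evC]
  have e5 : (obsLaw (Q 0)).real (evZ z ∩ evC c) = pC μ c * pZC μ z c := by
    rw [hQ.base, hμ.real_evZ_evC]
  have h := (d1.mul (d2.div d3 (by rwa [e3]))).mul
    (d4.div d5 (by rw [e5]; exact mul_ne_zero n1 n4))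
  have hEv : (fun t => (potLaw b (Q t)).real {(c, z, y)}) =ᶠ[𝓝 0] fun t =>
      (obsLaw (Q t)).real (evC c) * ((obsLaw (Q t)).real (evA b ∩ evZ z) /
        (obsLaw (Q t)).real (evA b)) * ((obsLaw (Q t)).real (evZ z ∩ evC c ∩ evY y) /
          (obsLaw (Q t)).real (evZ z ∩ evC c)) := by
    filter_upwards [hQ.inModel] with t ht
    rw [ht.potLaw_real_singleton, potMass, pZA, pYZC, Factorizes.real_cond, Factorizes.real_cond]
    rfl
  refine (h.congr_of_eventuallyEq hEv).congr_deriv ?_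
  simp only [Pi.mul_apply, Pi.div_apply, e1, e2, e3, e4, e5, scoreC, scoreZ, scoreY, potMass]
  field_simp

/-- The score of the law of `(C, Z(b), Y(b))` in terms of the score of the observed data. -/
theorem IsRegularSubmodel.score_potLaw {b : 𝒜} {s : 𝒞 × 𝒵 × 𝒴 → ℝ}
    (hs : IsQMD (fun t v => (potLaw b (Q t)).real {v}) s) (c : 𝒞) (z : 𝒵) (y : 𝒴) :
    s (c, z, y) = scoreC μ S c + scoreZ μ S b z + scoreY μ S c z y := by
  have hμ := hQ.factorizes
  have h0 := (hμ.potMass_pos b (c, z, y)).ne'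
  have h1 := IsQMD.hasDerivAt_real (ν := fun t => potLaw b (Q t)) hs
    (hQ.isProbabilityMeasure_potLaw b) {(c, z, y)}
  have h2 := h1.unique (hQ.hasDerivAt_potLaw_real b c z y)
  rw [integral_singleton, hQ.inModel.self_of_nhds.potLaw_real_singleton, hQ.base, smul_eq_mul,
    mul_comm] at h2
  exact mul_right_cancel₀ h0 h2

omit hQ in
theorem integral_potLaw (b : 𝒜) (P : Measure (Table 𝒞 𝒜 𝒵 𝒴)) (f : 𝒴 → ℝ) :
    ∫ v, f v.2.2 ∂(potLaw b P) = ∫ ω, f (potY b ω) ∂P := by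
  rw [potLaw, integral_map (by fun_prop) (Measurable.of_discrete).aestronglyMeasurable]

theorem IsRegularSubmodel.hasDerivAt_mean {b : 𝒜} (hb : b = as ∨ b = a) {s : 𝒞 × 𝒵 × 𝒴 → ℝ}
    (hs : IsQMD (fun t v => (potLaw b (Q t)).real {v}) s) :
    HasDerivAt (fun t => ∫ ω, (potY b ω : ℝ) ∂(Q t))
      (∫ v, (v.2.2 : ℝ) * s v ∂(potLaw b (Q 0))) 0 := by
  obtain ⟨K, hK⟩ := hQ.moment b hb
  have h := IsQMD.hasDerivAt_integral (ν := fun t => potLaw b (Q t)) hs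
    (hQ.isProbabilityMeasure_potLaw b) (f := fun v => (v.2.2 : ℝ)) (K := K) ?_
  · simpa only [integral_potLaw b _ (fun y : 𝒴 => (y : ℝ))] using h
  · filter_upwards [hK] with t ht
    refine ⟨?_, ?_⟩
    · rw [potLaw, memLp_map_measure_iff (Measurable.of_discrete).aestronglyMeasurable
        (by fun_prop)]
      exact ht.1
    · rw [integral_potLaw b _ (fun y : 𝒴 => (y : ℝ) ^ 2)]
      exact ht.2

end gradient

/-! ### The derivative of θ as an inner product with the observed score. -/

section pathwise_derivative

variable {𝒞 𝒜 𝒵 : Type*} {𝒴 : Set ℝ}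
    [Countable 𝒞] [MeasurableSpace 𝒞] [MeasurableSingletonClass 𝒞]
    [Countable 𝒜] [MeasurableSpace 𝒜] [MeasurableSingletonClass 𝒜]
    [Countable 𝒵] [MeasurableSpace 𝒵] [MeasurableSingletonClass 𝒵]
    [Countable 𝒴]

namespace Factorizes

variable {μ : Measure (Obs 𝒞 𝒜 𝒵 𝒴)} (hμ : Factorizes μ) {b : 𝒜} (hb : PotSq μ b)
  {ν : Measure (𝒞 × 𝒵 × 𝒴)} [IsProbabilityMeasure ν] (hν : ∀ v, ν.real {v} = potMass μ b v)
  {S : Obs 𝒞 𝒜 𝒵 𝒴 → ℝ} (hS : MemLp S 2 μ)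

include hμ hν

theorem pot_real_CZ (c : 𝒞) (z : 𝒵) :
    ν.real ((fun v => v.1) ⁻¹' {c} ∩ (fun v => v.2.1) ⁻¹' {z}) = pC μ c * pZA μ z b := by
  have h := hasSum_measureReal_fiber (ν := ν) (fun v => v.2.2)
    ((fun v => v.1) ⁻¹' {c} ∩ (fun v => v.2.1) ⁻¹' {z})
  have h' := (hμ.hasSum_pYZC z c).mul_left (pC μ c * pZA μ z b)
  rw [mul_one] at h'
  refine h.unique (h'.congr_fun fun y => ?_)
  have e : ((fun v : 𝒞 × 𝒵 × 𝒴 => v.1) ⁻¹' {c} ∩ (fun v => v.2.1) ⁻¹' {z} ∩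
      (fun v => v.2.2) ⁻¹' {y}) = {(c, z, y)} := by
    ext ⟨c', z', y'⟩
    simp [and_assoc]
  rw [e, hν, potMass]

theorem pot_real_C (c : 𝒞) : ν.real ((fun v => v.1) ⁻¹' {c}) = pC μ c := by
  have h := hasSum_measureReal_fiber (ν := ν) (fun v => v.2.1) ((fun v => v.1) ⁻¹' {c})
  have h' := (hμ.hasSum_pZA b).mul_left (pC μ c)
  rw [mul_one] at h'
  exact h.unique (h'.congr_fun fun z => hμ.pot_real_CZ hν c z)

theorem pot_real_Z (z : 𝒵) : ν.real ((fun v => v.2.1) ⁻¹' {z}) = pZA μ z b := by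
  have h := hasSum_measureReal_fiber (ν := ν) (fun v => v.1) ((fun v => v.2.1) ⁻¹' {z})
  have h' := hμ.hasSum_pC.mul_right (pZA μ z b)
  rw [one_mul] at h'
  refine h.unique (h'.congr_fun fun c => ?_)
  rw [Set.inter_comm]
  exact hμ.pot_real_CZ hν c z

include hb

theorem pot_memLp : MemLp (fun v : 𝒞 × 𝒵 × 𝒴 => (v.2.2 : ℝ)) 2 ν := by
  rw [memLp_two_iff_summable]
  simp only [hν]
  exact hb

theorem pot_setIntegral_CZ (c : 𝒞) (z : 𝒵) :
    ∫ v in (fun v => v.1) ⁻¹' {c} ∩ (fun v => v.2.1) ⁻¹' {z}, (v.2.2 : ℝ) ∂ν =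
      meanY μ z c * (pC μ c * pZA μ z b) := by
  have h := hasSum_setIntegral_fiber (ν := ν) (fun v => v.2.2)
    ((fun v => v.1) ⁻¹' {c} ∩ (fun v => v.2.1) ⁻¹' {z})
    ((hμ.pot_memLp hb hν).integrable one_le_two).integrableOn
  refine h.unique (((hμ.hasSum_meanY hb z c).mul_right (pC μ c * pZA μ z b)).congr_fun
    fun y => ?_)
  have e : ((fun v : 𝒞 × 𝒵 × 𝒴 => v.1) ⁻¹' {c} ∩ (fun v => v.2.1) ⁻¹' {z} ∩
      (fun v => v.2.2) ⁻¹' {y}) = {(c, z, y)} := by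
    ext ⟨c', z', y'⟩
    simp [and_assoc]
  rw [e, integral_singleton, hν, potMass, smul_eq_mul]
  ring

theorem pot_setIntegral_C (c : 𝒞) :
    ∫ v in (fun v => v.1) ⁻¹' {c}, (v.2.2 : ℝ) ∂ν = pC μ c * meanYC μ b c := by
  have h := hasSum_setIntegral_fiber (ν := ν) (fun v => v.2.1) ((fun v => v.1) ⁻¹' {c})
    ((hμ.pot_memLp hb hν).integrable one_le_two).integrableOn
  refine h.unique (((hμ.hasSum_meanYC hb c).mul_left (pC μ c)).congr_fun fun z => ?_)
  rw [hμ.pot_setIntegral_CZ hb hν]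
  ring

theorem pot_setIntegral_Z (z : 𝒵) :
    ∫ v in (fun v => v.2.1) ⁻¹' {z}, (v.2.2 : ℝ) ∂ν = pZA μ z b * meanYZ μ z := by
  have h := hasSum_setIntegral_fiber (ν := ν) (fun v => v.1) ((fun v => v.2.1) ⁻¹' {z})
    ((hμ.pot_memLp hb hν).integrable one_le_two).integrableOn
  refine h.unique (((hμ.hasSum_meanYZ hb z).mul_left (pZA μ z b)).congr_fun fun c => ?_)
  rw [Set.inter_comm, hμ.pot_setIntegral_CZ hb hν]
  ring

include hS
omit hb

/-- The score of C is the conditional mean of S given C, and C has the same law under ν and μ, so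
Jensen's inequality applies. -/
theorem pot_memLp_scoreC : MemLp (fun v : 𝒞 × 𝒵 × 𝒴 => scoreC μ S v.1) 2 ν := by
  have := hμ.isProbabilityMeasure
  rw [memLp_two_iff_integrable_sq (Measurable.of_discrete).aestronglyMeasurable]
  refine (integrable_comp_iff (μ := ν) (X := fun v : 𝒞 × 𝒵 × 𝒴 => v.1) .of_discrete
    fun c => scoreC μ S c ^ 2).2 ?_
  have h := (hasSum_setIntegral_fiber (ν := μ) (fun x => x.1) Set.univ
    hS.integrable_sq.integrableOn).summable
  refine Summable.of_nonneg_of_le (fun c => mul_nonneg (sq_nonneg _) measureReal_nonneg)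
    (fun c => ?_) h
  have h1 := sq_setIntegral_div_le hS (E := evC c) (hμ.pC_pos c)
  rw [hμ.pot_real_C hν, Set.univ_inter]
  refine le_of_eq_of_le ?_ h1
  have := (hμ.pC_pos c).ne'
  change _ = _ / pC μ c
  rw [scoreC]
  field_simp

/-- Jensen's inequality on the events A = b, Z = z; dividing by p(b) turns the observed mass into
that of Z(b). The same argument fails for the score of p(y|z,c), since the ratio p(z|b)/p(z|c) may
be unbounded. -/
theorem pot_memLp_scoreZ : MemLp (fun v : 𝒞 × 𝒵 × 𝒴 => scoreZ μ S b v.2.1) 2 ν := by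
  have := hμ.isProbabilityMeasure
  refine MemLp.sub (f := fun v : 𝒞 × 𝒵 × 𝒴 =>
    (∫ x in evA b ∩ evZ v.2.1, S x ∂μ) / (pA μ b * pZA μ v.2.1 b)) ?_ (memLp_const _)
  rw [memLp_two_iff_integrable_sq (Measurable.of_discrete).aestronglyMeasurable]
  refine (integrable_comp_iff (μ := ν) (X := fun v : 𝒞 × 𝒵 × 𝒴 => v.2.1) .of_discrete
    fun z => ((∫ x in evA b ∩ evZ z, S x ∂μ) / (pA μ b * pZA μ z b)) ^ 2).2 ?_
  have h := ((hasSum_setIntegral_fiber (ν := μ) (fun x => x.2.2.1) (evA b)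
    hS.integrable_sq.integrableOn).div_const (pA μ b)).summable
  refine Summable.of_nonneg_of_le (fun c => mul_nonneg (sq_nonneg _) measureReal_nonneg)
    (fun z => ?_) h
  have p1 := hμ.pA_pos b
  have p2 := hμ.pZA_pos z b
  have h1 := sq_setIntegral_div_le hS (E := evA b ∩ evZ z)
    (by rw [hμ.real_evA_evZ]; exact mul_pos p1 p2)
  rw [hμ.pot_real_Z hν]
  refine le_of_eq_of_le ?_ (div_le_div_of_nonneg_right h1 p1.le)
  rw [hμ.real_evA_evZ]
  field_simp

include hb

/-- Both sides, grouped by c, have the terms `meanYC` times the integral of S over C = c. -/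
theorem integral_mul_scoreC (hC : Integrable (fun x => meanYC μ b x.1 * S x) μ) :
    ∫ v, (v.2.2 : ℝ) * scoreC μ S v.1 ∂ν = ∫ x, meanYC μ b x.1 * S x ∂μ := by
  have hi := (hμ.pot_memLp_scoreC hν hS).integrable_mul (hμ.pot_memLp hb hν)
  have h1 := hasSum_integral_fiber (ν := ν) (fun v => v.1) (scoreC μ S) hi
  have h2 := hasSum_integral_fiber (ν := μ) (fun x => x.1) (meanYC μ b) hC
  simp only [mul_comm (Subtype.val _) (scoreC μ S _)]
  refine h1.unique (h2.congr_fun fun c => ?_)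
  rw [hμ.pot_setIntegral_C hb hν, scoreC]
  have := (hμ.pC_pos c).ne'
  change _ = _ * ∫ x in evC c, S x ∂μ
  field_simp

theorem integral_mul_scoreZ :
    ∫ v, (v.2.2 : ℝ) * scoreZ μ S b v.2.1 ∂ν = ∫ x, phiZ b μ x.2.1 x.2.2.1 * S x ∂μ := by
  have := hμ.isProbabilityMeasure
  have p0 := (hμ.pA_pos b).ne'
  have hi := (hμ.pot_memLp_scoreZ hν hS).integrable_mul (hμ.pot_memLp hb hν)
  have h1 := hasSum_integral_fiber (ν := ν) (fun v => v.2.1) (scoreZ μ S b) hi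
  have hiS : Integrable S μ := hS.integrable one_le_two
  have h2 := hasSum_integral_fiber (ν := μ) (fun x => (x.2.1, x.2.2.1))
    (fun v : 𝒜 × 𝒵 => phiZ b μ v.1 v.2) ((hμ.memLp_phiZ hb).integrable_mul hS)
  have hinj : Function.Injective fun z : 𝒵 => (b, z) := fun z z' h => (Prod.mk.inj h).2
  rw [← hinj.hasSum_iff fun v hv => ?_] at h2
  swap
  · have h : v.1 ≠ b := fun h => hv ⟨v.2, by rw [← h]⟩
    simp [phiZ, ind_of_ne h]
  have h3 : HasSum (fun z => ∫ x in evA b ∩ evZ z, S x ∂μ) (∫ x in evA b, S x ∂μ) :=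
    hasSum_setIntegral_fiber (ν := μ) (fun x => x.2.2.1) (evA b) hiS.integrableOn
  -- The kernel `phiZ` centres the outcome and `scoreZ` centres the score. The two centring
  -- corrections differ term by term in z but have the same total, so adding one and subtracting the
  -- other leaves the sum unchanged.
  have h4 := (h2.add (h3.mul_left (potMean μ b / pA μ b))).sub
    ((hμ.hasSum_potMean_Z hb).mul_left ((∫ x in evA b, S x ∂μ) / pA μ b))
  simp only [mul_comm (Subtype.val _) (scoreZ μ S b _)]
  refine (h1.unique (h4.congr_fun fun z => ?_)).trans (by ring)
  have e : (fun x : Obs 𝒞 𝒜 𝒵 𝒴 => (x.2.1, x.2.2.1)) ⁻¹' {(b, z)} = evA b ∩ evZ z := by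
    ext x
    simp [evA, evZ]
  have p1 := (hμ.pZA_pos z b).ne'
  rw [hμ.pot_setIntegral_Z hb hν, scoreZ]
  simp only [Function.comp, phiZ, ind_self, e]
  field_simp
  ring

end Factorizes

variable {as a : 𝒜} {μ : Measure (Obs 𝒞 𝒜 𝒵 𝒴)} {Q : ℝ → Measure (Table 𝒞 𝒜 𝒵 𝒴)}
  {S : Obs 𝒞 𝒜 𝒵 𝒴 → ℝ}

/-- The derivative of the mean of `Y(b)` along a regular submodel. -/
theorem IsRegularSubmodel.hasDerivAt_mean' (hQ : IsRegularSubmodel as a μ Q S) {b : 𝒜}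
    (hb : b = as ∨ b = a) (hY : PotSq μ b) :
    ∃ T, HasDerivAt (fun t => ∫ ω, (potY b ω : ℝ) ∂(Q t))
      (∫ x, meanYC μ b x.1 * S x ∂μ + ∫ x, phiZ b μ x.2.1 x.2.2.1 * S x ∂μ + T) 0 ∧
      HasSum (fun v : 𝒞 × 𝒵 × 𝒴 => (v.2.2 : ℝ) * scoreY μ S v.1 v.2.1 v.2.2 * potMass μ b v) T := by
  obtain ⟨s, hs⟩ := hQ.potential b hb
  have hμ := hQ.factorizes
  have := hμ.isProbabilityMeasure
  have hS := hQ.memLp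
  set ν := potLaw b (Q 0) with hνdef
  have : IsProbabilityMeasure ν := (hQ.isProbabilityMeasure_potLaw b).self_of_nhds
  have hν : ∀ v, ν.real {v} = potMass μ b v := fun v => by
    rw [hνdef, hQ.inModel.self_of_nhds.potLaw_real_singleton, hQ.base]
  have hsν : MemLp s 2 ν := IsQMD.memLp (ν := fun t => potLaw b (Q t)) hs
  have hYν := hμ.pot_memLp hY hν
  have hC : Integrable (fun x => meanYC μ b x.1 * S x) μ :=
    (hμ.memLp_meanYC hY).integrable_mul hS
  have i0 : Integrable (fun v => (v.2.2 : ℝ) * s v) ν := hYν.integrable_mul hsν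
  have i1 : Integrable (fun v : 𝒞 × 𝒵 × 𝒴 => (v.2.2 : ℝ) * scoreC μ S v.1) ν :=
    hYν.integrable_mul (hμ.pot_memLp_scoreC hν hS)
  have i2 : Integrable (fun v : 𝒞 × 𝒵 × 𝒴 => (v.2.2 : ℝ) * scoreZ μ S b v.2.1) ν :=
    hYν.integrable_mul (hμ.pot_memLp_scoreZ hν hS)
  -- Integrability of Y times the score of p(y|z,c) is obtained by subtraction, from the square
  -- integrable score s that the regularity of the potential law provides.
  have hdec : ∀ v : 𝒞 × 𝒵 × 𝒴, (v.2.2 : ℝ) * scoreY μ S v.1 v.2.1 v.2.2 =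
      v.2.2 * s v - v.2.2 * scoreC μ S v.1 - v.2.2 * scoreZ μ S b v.2.1 := by
    rintro ⟨c, z, y⟩
    rw [hQ.score_potLaw hs c z y]
    ring
  have i3 : Integrable (fun v : 𝒞 × 𝒵 × 𝒴 => (v.2.2 : ℝ) * scoreY μ S v.1 v.2.1 v.2.2) ν := by
    simp only [hdec]
    exact (i0.sub i1).sub i2
  refine ⟨∫ v, (v.2.2 : ℝ) * scoreY μ S v.1 v.2.1 v.2.2 ∂ν, ?_, ?_⟩
  · refine (hQ.hasDerivAt_mean hb hs).congr_deriv ?_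
    simp only [hdec]
    have i01 : Integrable (fun v => (v.2.2 : ℝ) * s v - v.2.2 * scoreC μ S v.1) ν := i0.sub i1
    rw [integral_sub i01 i2, integral_sub i0 i1, hμ.integral_mul_scoreC hY hν hS hC,
      hμ.integral_mul_scoreZ hY hν hS]
    ring
  · rw [integral_eq_tsum_mul_real]
    simp only [← hν]
    exact ((integrable_iff_summable _).1 i3).hasSum

/-- For a single level b the kernel (Y − E(Y|Z,C)) p(Z|b)/p(Z|C) need not be square integrable;
`hfin` controls only the difference, so the two levels are treated together. The two series over (c,
z, y) differ termwise, one centring the score and the other the outcome, and agree once y is summed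
out. -/
theorem Factorizes.sub_eq_integral_phiY (hμ : Factorizes μ) (hS : MemLp S 2 μ)
    (has : PotSq μ as) (hfin : Summable fun zc : 𝒵 × 𝒞 => boundSummand as a μ zc.1 zc.2)
    {T T' : ℝ}
    (hT : HasSum (fun v : 𝒞 × 𝒵 × 𝒴 =>
      (v.2.2 : ℝ) * scoreY μ S v.1 v.2.1 v.2.2 * potMass μ as v) T)
    (hT' : HasSum (fun v : 𝒞 × 𝒵 × 𝒴 =>
      (v.2.2 : ℝ) * scoreY μ S v.1 v.2.1 v.2.2 * potMass μ a v) T') :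
    T - T' = ∫ x, phiY as a μ x.1 x.2.2.1 x.2.2.2 * S x ∂μ := by
  have := hμ.isProbabilityMeasure
  have hiS : Integrable S μ := hS.integrable one_le_two
  set G : 𝒞 → 𝒵 → 𝒴 → ℝ := fun c z y => ∫ x in evZ z ∩ evC c ∩ evY y, S x ∂μ with hG
  set g : 𝒞 → 𝒵 → ℝ := fun c z => ∫ x in evZ z ∩ evC c, S x ∂μ with hg
  have hGg : ∀ c z, HasSum (G c z) (g c z) := fun c z =>
    hasSum_setIntegral_fiber (ν := μ) (fun x => x.2.2.2) (evZ z ∩ evC c) hiS.integrableOn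
  have hterm : ∀ b c z (y : 𝒴), (y : ℝ) * scoreY μ S c z y * potMass μ b (c, z, y) =
      pZA μ z b / pZC μ z c * ((y : ℝ) * G c z y - y * pYZC μ y z c * g c z) := by
    intro b c z y
    have n1 := (hμ.pC_pos c).ne'
    have n4 := (hμ.pZC_pos z c).ne'
    have n5 := (hμ.pYZC_pos y z c).ne'
    rw [scoreY, potMass]
    simp only [hG, hg]
    field_simp
  -- Recovered from a fiber of `hT` by adding back the summable centring term.
  have hW : ∀ c z, Summable fun y : 𝒴 => (y : ℝ) * G c z y := by
    intro c z
    have h1 := ((Equiv.prodAssoc 𝒞 𝒵 𝒴).summable_iff.2 hT.summable).prod_factor (c, z)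
    have h2 : Summable fun y : 𝒴 => pZA μ z as / pZC μ z c *
        ((y : ℝ) * G c z y - y * pYZC μ y z c * g c z) :=
      h1.congr fun y => (hterm as c z y)
    have n3 := (hμ.pZA_pos z as).ne'
    have n4 := (hμ.pZC_pos z c).ne'
    refine ((h2.mul_left (pZC μ z c / pZA μ z as)).add
      ((hμ.hasSum_meanY has z c).summable.mul_right (g c z))).congr fun y => ?_
    field_simp
    ring
  have h1 := (Equiv.prodAssoc 𝒞 𝒵 𝒴).hasSum_iff.2 (hT.sub hT')
  have h2 := hasSum_integral_fiber (ν := μ) (fun x => (x.1, x.2.2.1, x.2.2.2))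
    (fun v : 𝒞 × 𝒵 × 𝒴 => phiY as a μ v.1 v.2.1 v.2.2)
    ((hμ.memLp_phiY has hfin).integrable_mul hS)
  have h2' := (Equiv.prodAssoc 𝒞 𝒵 𝒴).hasSum_iff.2 h2
  have f1 := h1.prod_fiberwise (g := fun x => (pZA μ x.2 as - pZA μ x.2 a) / pZC μ x.2 x.1 *
    (∑' y : 𝒴, (y : ℝ) * G x.1 x.2 y - meanY μ x.2 x.1 * g x.1 x.2)) ?_
  have f2 := h2'.prod_fiberwise (g := fun x => (pZA μ x.2 as - pZA μ x.2 a) / pZC μ x.2 x.1 *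
    (∑' y : 𝒴, (y : ℝ) * G x.1 x.2 y - meanY μ x.2 x.1 * g x.1 x.2)) ?_
  · exact f1.unique f2
  · rintro ⟨c, z⟩
    refine HasSum.congr_fun (((hW c z).hasSum.sub ((hGg c z).mul_left (meanY μ z c))).mul_left
      ((pZA μ z as - pZA μ z a) / pZC μ z c)) fun y => ?_
    have e : (fun x : Obs 𝒞 𝒜 𝒵 𝒴 => (x.1, x.2.2.1, x.2.2.2)) ⁻¹' {(c, z, y)} =
        evZ z ∩ evC c ∩ evY y := by
      ext x
      simp only [evC, evZ, evY, Set.mem_inter_iff, Set.mem_ofPred_eq, Set.mem_preimage,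
        Set.mem_singleton_iff, Prod.mk.injEq]
      tauto
    simp only [Function.comp, Equiv.prodAssoc_apply, e, phiY, hG]
    ring
  · rintro ⟨c, z⟩
    refine HasSum.congr_fun (((hW c z).hasSum.sub
      ((hμ.hasSum_meanY has z c).mul_right (g c z))).mul_left
      ((pZA μ z as - pZA μ z a) / pZC μ z c)) fun y => ?_
    simp only [Function.comp, Equiv.prodAssoc_apply, hterm]
    ring

/-- The function `φ_{bd,fd,td}` represents the derivative of the parameter along all regular
submodels. -/
theorem IsRegularSubmodel.hasDerivAt_ace (hQ : IsRegularSubmodel as a μ Q S) (hne : as ≠ a)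
    (has : PotSq μ as) (ha : PotSq μ a)
    (hfin : Summable fun zc : 𝒵 × 𝒞 => boundSummand as a μ zc.1 zc.2) :
    HasDerivAt (fun t => ace as a (Q t))
      (∫ x, phi as a μ (potMean μ as - potMean μ a) x * S x ∂μ) 0 := by
  have hμ := hQ.factorizes
  have := hμ.isProbabilityMeasure
  have hS := hQ.memLp
  obtain ⟨T, hd, hT⟩ := hQ.hasDerivAt_mean' (Or.inl rfl) has
  obtain ⟨T', hd', hT'⟩ := hQ.hasDerivAt_mean' (Or.inr rfl) ha
  refine (hd.sub hd').congr_deriv ?_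
  have hTT := hμ.sub_eq_integral_phiY hS has hfin hT hT'
  have i1 : Integrable (fun x => phiY as a μ x.1 x.2.2.1 x.2.2.2 * S x) μ :=
    (hμ.memLp_phiY has hfin).integrable_mul hS
  have i2 : Integrable (fun x => phiZ as μ x.2.1 x.2.2.1 * S x) μ :=
    (hμ.memLp_phiZ has).integrable_mul hS
  have i3 : Integrable (fun x => phiZ a μ x.2.1 x.2.2.1 * S x) μ :=
    (hμ.memLp_phiZ ha).integrable_mul hS
  have i4 : Integrable (fun x => meanYC μ as x.1 * S x) μ := (hμ.memLp_meanYC has).integrable_mul hS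
  have i5 : Integrable (fun x => meanYC μ a x.1 * S x) μ := (hμ.memLp_meanYC ha).integrable_mul hS
  have i6 : Integrable (fun x => (potMean μ as - potMean μ a) * S x) μ :=
    (hS.integrable one_le_two).const_mul _
  have hexp : ∀ x, phi as a μ (potMean μ as - potMean μ a) x * S x =
      phiY as a μ x.1 x.2.2.1 x.2.2.2 * S x + phiZ as μ x.2.1 x.2.2.1 * S x
        - phiZ a μ x.2.1 x.2.2.1 * S x + meanYC μ as x.1 * S x - meanYC μ a x.1 * S x
        - (potMean μ as - potMean μ a) * S x := by
    intro x
    rw [hμ.phi_eq_fun hne has ha]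
    simp only [phiC]
    ring
  simp only [hexp]
  rw [integral_sub (by fun_prop) i6, integral_sub (by fun_prop) i5, integral_add (by fun_prop) i4,
    integral_sub (by fun_prop) i3, integral_add i1 i2, integral_const_mul, hQ.integral_score,
    ← hTT]
  ring

end pathwise_derivative

/-! ### Measures with prescribed mass functions. -/

section mass_functions

variable {α : Type*} [MeasurableSpace α] [MeasurableSingletonClass α] [Nonempty α]

open Classical in
/-- The probability measure with mass function `f` (and a Dirac mass if `f` is not a probability mass
function). -/
def ofMass (f : α → ℝ) : Measure α :=
  if (∀ x, 0 ≤ f x) ∧ HasSum f 1 then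
    Measure.sum fun x => ENNReal.ofReal (f x) • Measure.dirac x
  else Measure.dirac (Classical.arbitrary α)

instance (f : α → ℝ) : IsProbabilityMeasure (ofMass f) := by
  rw [ofMass]
  split_ifs with h
  · constructor
    rw [Measure.sum_apply _ .univ]
    simp only [Measure.smul_apply, measure_univ, smul_eq_mul, mul_one]
    rw [← ENNReal.ofReal_tsum_of_nonneg h.1 h.2.summable, h.2.tsum_eq, ENNReal.ofReal_one]
  · infer_instance

theorem ofMass_singleton {f : α → ℝ} (h0 : ∀ x, 0 ≤ f x) (h1 : HasSum f 1) (x : α) :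
    ofMass f {x} = ENNReal.ofReal (f x) := by
  rw [ofMass, if_pos ⟨h0, h1⟩, Measure.sum_smul_dirac_singleton]

theorem ofMass_real_singleton {f : α → ℝ} (h0 : ∀ x, 0 ≤ f x) (h1 : HasSum f 1) (x : α) :
    (ofMass f).real {x} = f x := by
  rw [measureReal_def, ofMass_singleton h0 h1, ENNReal.toReal_ofReal (h0 x)]

end mass_functions

/-! ### Conditional independence from independent coordinates. -/

section independence

variable {Ω Ω' α β γ δ ε : Type*} [MeasurableSpace Ω] [MeasurableSpace Ω'] [MeasurableSpace α]
  [MeasurableSpace β] [MeasurableSpace γ] [MeasurableSpace δ] [MeasurableSpace ε]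

/-- If `U` and `V` are independent, `Y` and `W` are functions of `V`, and `X` is a function of `U`
on the event `W = w`, for each `w`, then `X ⊥ Y | W`. -/
theorem condIndepGiven_of_indepFun [MeasurableSingletonClass γ] {P : Measure Ω'}
    [IsProbabilityMeasure P] {Φ : Ω' → Ω} (hΦ : Measurable Φ) {U : Ω' → δ} {V : Ω' → ε}
    (hUV : IndepFun U V P) {X : Ω → α} {Y : Ω → β} {W : Ω → γ} (hX : Measurable X)
    (hY : Measurable Y) (hW : Measurable W) {y : ε → β} {w : ε → γ} (hy : Measurable y)
    (hw : Measurable w) (hYV : ∀ ω, Y (Φ ω) = y (V ω)) (hWV : ∀ ω, W (Φ ω) = w (V ω))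
    (x : γ → δ → α) (hx : ∀ g, Measurable (x g)) (hXU : ∀ ω, X (Φ ω) = x (W (Φ ω)) (U ω)) :
    CondIndepGiven (P.map Φ) X Y W := by
  intro g
  have hE : MeasurableSet (W ⁻¹' {g}) := hW (measurableSet_singleton g)
  rw [indepFun_iff_measure_inter_preimage_eq_mul]
  intro s t hs ht
  rw [cond_apply hE, cond_apply hE, cond_apply hE, Measure.map_apply hΦ hE,
    Measure.map_apply hΦ (hE.inter ((hX hs).inter (hY ht))),
    Measure.map_apply hΦ (hE.inter (hX hs)), Measure.map_apply hΦ (hE.inter (hY ht))]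
  have e1 : Φ ⁻¹' (W ⁻¹' {g} ∩ (X ⁻¹' s ∩ Y ⁻¹' t)) =
      U ⁻¹' (x g ⁻¹' s) ∩ V ⁻¹' (w ⁻¹' {g} ∩ y ⁻¹' t) := by
    ext ω
    simp only [Set.mem_preimage, Set.mem_inter_iff, Set.mem_singleton_iff, hYV, hXU, hWV]
    constructor
    · rintro ⟨rfl, h1, h2⟩
      exact ⟨h1, rfl, h2⟩
    · rintro ⟨h1, rfl, h2⟩
      exact ⟨rfl, h1, h2⟩
  have e2 : Φ ⁻¹' (W ⁻¹' {g} ∩ X ⁻¹' s) = U ⁻¹' (x g ⁻¹' s) ∩ V ⁻¹' (w ⁻¹' {g}) := by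
    ext ω
    simp only [Set.mem_preimage, Set.mem_inter_iff, Set.mem_singleton_iff, hXU, hWV]
    constructor
    · rintro ⟨rfl, h1⟩
      exact ⟨h1, rfl⟩
    · rintro ⟨h1, rfl⟩
      exact ⟨rfl, h1⟩
  have e3 : Φ ⁻¹' (W ⁻¹' {g} ∩ Y ⁻¹' t) = V ⁻¹' (w ⁻¹' {g} ∩ y ⁻¹' t) := by
    ext ω
    simp [hYV, hWV]
  have e4 : Φ ⁻¹' (W ⁻¹' {g}) = V ⁻¹' (w ⁻¹' {g}) := by
    ext ω
    simp [hWV]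
  have hwg : MeasurableSet (w ⁻¹' {g}) := hw (measurableSet_singleton g)
  rw [e1, e2, e3, e4, hUV.measure_inter_preimage_eq_mul _ _ (hx g hs) (hwg.inter (hy ht)),
    hUV.measure_inter_preimage_eq_mul _ _ (hx g hs) hwg]
  set e := P (V ⁻¹' (w ⁻¹' {g}))
  set m := P (V ⁻¹' (w ⁻¹' {g} ∩ y ⁻¹' t))
  set u := P (U ⁻¹' (x g ⁻¹' s))
  by_cases h0 : e = 0
  · have hm : m = 0 := measure_mono_null (Set.preimage_mono Set.inter_subset_left) h0
    rw [hm]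
    simp
  · have h1 : e⁻¹ * e = 1 := ENNReal.inv_mul_cancel h0 (measure_ne_top _ _)
    calc e⁻¹ * (u * m) = e⁻¹ * e * u * (e⁻¹ * m) := by rw [h1]; ring
      _ = _ := by ring

theorem CondIndepGiven.symm {P : Measure Ω} {X : Ω → α} {Y : Ω → β} {W : Ω → γ}
    (h : CondIndepGiven P X Y W) : CondIndepGiven P Y X W := fun w => (h w).symm

theorem indepFun_fst_snd {μ : Measure α} {ν : Measure β} [IsProbabilityMeasure μ]
    [IsProbabilityMeasure ν] : IndepFun (fun ω : α × β => ω.1) (fun ω => ω.2) (μ.prod ν) :=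
  indepFun_prod (X := id) (Y := id) measurable_id measurable_id

/-- In a product of three spaces, the second coordinate is independent of the other two. -/
theorem indepFun_mid {μ : Measure α} {ν : Measure β} {τ : Measure γ} [IsProbabilityMeasure μ]
    [IsProbabilityMeasure ν] [IsProbabilityMeasure τ] :
    IndepFun (fun ω : α × β × γ => ω.2.1) (fun ω => (ω.1, ω.2.2)) (μ.prod (ν.prod τ)) := by
  have h1 := (measurePreserving_prodAssoc μ ν τ).symm
  have h2 : MeasurePreserving (Prod.map Prod.swap id) ((μ.prod ν).prod τ) ((ν.prod μ).prod τ) :=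
    Measure.measurePreserving_swap.prod (MeasurePreserving.id τ)
  have h := ((measurePreserving_prodAssoc ν μ τ).comp h2).comp h1
  have h3 := indepFun_fst_snd (μ := ν) (ν := μ.prod τ)
  rw [indepFun_iff_measure_inter_preimage_eq_mul] at h3 ⊢
  intro s t hs ht
  have h4 := h3 s t hs ht
  rw [← h.measure_preimage ((measurable_fst hs).inter (measurable_snd ht)).nullMeasurableSet,
    ← h.measure_preimage (measurable_fst hs).nullMeasurableSet,
    ← h.measure_preimage (measurable_snd ht).nullMeasurableSet] at h4
  exact h4

end independence

/-! ### A law in the causal model with prescribed factors. -/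

section table_law

variable {𝒞 𝒜 𝒵 : Type*} {𝒴 : Set ℝ}
    [Countable 𝒞] [MeasurableSpace 𝒞] [MeasurableSingletonClass 𝒞]
    [Countable 𝒜] [MeasurableSpace 𝒜] [MeasurableSingletonClass 𝒜]
    [Countable 𝒵] [MeasurableSpace 𝒵] [MeasurableSingletonClass 𝒵]
    [Countable 𝒴]

/-- The potential outcomes that are determined by `(C, A)`, by the table `a ↦ Z(a)`, and by a table
of outcomes indexed by the values of `(C, Z)`. -/
def assemble (u : (𝒞 × 𝒜) × (𝒜 → 𝒵) × (𝒞 × 𝒵 → 𝒴)) : Table 𝒞 𝒜 𝒵 𝒴 :=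
  (u.1.1, u.1.2, u.2.1, fun _ z => u.2.2 (u.1.1, z))

theorem measurable_eval_snd (z : 𝒵) : Measurable
    fun u : (𝒞 × 𝒜) × (𝒜 → 𝒵) × (𝒞 × 𝒵 → 𝒴) => u.2.2 (u.1.1, z) :=
  measurable_eval_countable (f := fun u : (𝒞 × 𝒜) × (𝒜 → 𝒵) × (𝒞 × 𝒵 → 𝒴) => u.1.1)
    (g := fun c u => u.2.2 (c, z)) (by fun_prop) fun c => by fun_prop

theorem measurable_assemble : Measurable (assemble : _ → Table 𝒞 𝒜 𝒵 𝒴) := by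
  refine Measurable.prodMk (by fun_prop) (Measurable.prodMk (by fun_prop)
    (Measurable.prodMk (by fun_prop) ?_))
  exact measurable_pi_lambda _ fun _ => measurable_pi_lambda _ fun z => measurable_eval_snd z

variable (ρ : Measure (𝒞 × 𝒜)) (ζ : 𝒜 → Measure 𝒵) (η : 𝒞 × 𝒵 → Measure 𝒴)
  [IsProbabilityMeasure ρ] [∀ a, IsProbabilityMeasure (ζ a)] [∀ x, IsProbabilityMeasure (η x)]

/-- The law of independent `(C, A)`, `Z(a)` and outcome tables. -/
def baseLaw : Measure ((𝒞 × 𝒜) × (𝒜 → 𝒵) × (𝒞 × 𝒵 → 𝒴)) :=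
  ρ.prod ((Measure.infinitePi ζ).prod (Measure.infinitePi η))

instance : IsProbabilityMeasure (baseLaw ρ ζ η) := by
  rw [baseLaw]
  infer_instance

/-- The law of the potential outcomes with given laws of `(C, A)`, of `Z(a)`, and of `Y(a, z)` given
`C`, in which all other dependencies are absent. -/
def tableLaw : Measure (Table 𝒞 𝒜 𝒵 𝒴) := (baseLaw ρ ζ η).map assemble

theorem baseLaw_apply (c : 𝒞) (z : 𝒵) (y : 𝒴) (b : 𝒜) (s : Set (𝒞 × 𝒜)) :
    baseLaw ρ ζ η (s ×ˢ (((fun f => f b) ⁻¹' {z}) ×ˢ ((fun f => f (c, z)) ⁻¹' {y}))) =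
      ρ s * (ζ b {z} * η (c, z) {y}) := by
  rw [baseLaw, Measure.prod_prod, Measure.prod_prod,
    (measurePreserving_eval_infinitePi ζ b).measure_preimage
      (measurableSet_singleton z).nullMeasurableSet,
    (measurePreserving_eval_infinitePi η (c, z)).measure_preimage
      (measurableSet_singleton y).nullMeasurableSet]

theorem obsLaw_tableLaw (c : 𝒞) (a : 𝒜) (z : 𝒵) (y : 𝒴) :
    (obsLaw (tableLaw ρ ζ η)).real {(c, a, z, y)} =
      ρ.real {(c, a)} * (ζ a).real {z} * (η (c, z)).real {y} := by
  rw [obsLaw_real, measureReal_def, tableLaw, Measure.map_apply measurable_assemble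
    (measurable_observed .of_discrete)]
  have e : assemble ⁻¹' (observed ⁻¹' {(c, a, z, y)}) =
      ({(c, a)} : Set (𝒞 × 𝒜)) ×ˢ (((fun f => f a) ⁻¹' {z}) ×ˢ ((fun f => f (c, z)) ⁻¹' {y})) := by
    ext ⟨⟨c', a'⟩, f, g⟩
    simp only [assemble, observed, covC, trtA, medZ, outY, potZ, potY, potYZ, Set.mem_preimage,
      Set.mem_singleton_iff, Prod.mk.injEq, Set.mem_prod]
    constructor
    · rintro ⟨rfl, rfl, rfl, rfl⟩
      simp
    · rintro ⟨⟨rfl, rfl⟩, rfl, rfl⟩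
      simp
  rw [e, baseLaw_apply, ENNReal.toReal_mul, ENNReal.toReal_mul, ← mul_assoc]
  rfl

theorem potLaw_tableLaw (b : 𝒜) (c : 𝒞) (z : 𝒵) (y : 𝒴) :
    (potLaw b (tableLaw ρ ζ η)).real {(c, z, y)} =
      ρ.real ((fun x => x.1) ⁻¹' {c}) * (ζ b).real {z} * (η (c, z)).real {y} := by
  rw [potLaw_real, measureReal_def, tableLaw, Measure.map_apply measurable_assemble
    ((by fun_prop : Measurable fun ω : Table 𝒞 𝒜 𝒵 𝒴 => (covC ω, potZ b ω, potY b ω))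
      .of_discrete)]
  have e : assemble ⁻¹' ((fun ω : Table 𝒞 𝒜 𝒵 𝒴 => (covC ω, potZ b ω, potY b ω)) ⁻¹' {(c, z, y)}) =
      ((fun x : 𝒞 × 𝒜 => x.1) ⁻¹' {c}) ×ˢ
        (((fun f => f b) ⁻¹' {z}) ×ˢ ((fun f => f (c, z)) ⁻¹' {y})) := by
    ext ⟨⟨c', a'⟩, f, g⟩
    simp only [assemble, covC, potZ, potY, potYZ, Set.mem_preimage,
      Set.mem_singleton_iff, Prod.mk.injEq, Set.mem_prod]
    constructor
    · rintro ⟨rfl, rfl, rfl⟩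
      simp
    · rintro ⟨rfl, rfl, rfl⟩
      simp
  rw [e, baseLaw_apply, ENNReal.toReal_mul, ENNReal.toReal_mul, ← mul_assoc]
  rfl

/-- The constructed laws belong to the causal model. -/
theorem inModel_tableLaw (hρ : ∀ x, 0 < ρ {x}) (hζ : ∀ a z, 0 < ζ a {z})
    (hη : ∀ x y, 0 < η x {y}) : InModel (tableLaw ρ ζ η) := by
  have hΦ : Measurable (assemble : _ → Table 𝒞 𝒜 𝒵 𝒴) := measurable_assemble
  have hind : IndepFun (fun u : (𝒞 × 𝒜) × (𝒜 → 𝒵) × (𝒞 × 𝒵 → 𝒴) => u.2) (fun u => u.1)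
      (baseLaw ρ ζ η) := indepFun_fst_snd.symm
  have hmid : IndepFun (fun u : (𝒞 × 𝒜) × (𝒜 → 𝒵) × (𝒞 × 𝒵 → 𝒴) => u.2.1)
      (fun u => (u.1, u.2.2)) (baseLaw ρ ζ η) := indepFun_mid
  have hev : ∀ z : 𝒵, Measurable fun v : (𝒞 × 𝒜) × (𝒞 × 𝒵 → 𝒴) => v.2 (v.1.1, z) := fun z =>
    measurable_eval_countable (f := fun v : (𝒞 × 𝒜) × (𝒞 × 𝒵 → 𝒴) => v.1.1)
      (g := fun c v => v.2 (c, z)) (by fun_prop) fun c => by fun_prop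
  have hpot : ∀ (c : 𝒞) (b : 𝒜), Measurable fun v : (𝒜 → 𝒵) × (𝒞 × 𝒵 → 𝒴) => v.2 (c, v.1 b) :=
    fun c b => measurable_eval_countable (f := fun v : (𝒜 → 𝒵) × (𝒞 × 𝒵 → 𝒴) => v.1 b)
      (g := fun z v => v.2 (c, z)) (by fun_prop) fun z => by fun_prop
  have htd1 : ∀ (a a' : 𝒜) (z : 𝒵), ∀ᵐ ω ∂(tableLaw ρ ζ η), potYZ a z ω = potYZ a' z ω := by
    intro a a' z
    rw [tableLaw, ae_map_iff hΦ.aemeasurable]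
    · exact ae_of_all _ fun u => rfl
    · exact measurableSet_eq_fun (measurable_potYZ a z) (measurable_potYZ a' z)
  refine ⟨?_, ?_, ⟨?_, ?_⟩, ⟨htd1, ?_, ?_⟩, ⟨htd1, ?_, ?_⟩, ?_⟩
  · exact Measure.isProbabilityMeasure_map hΦ.aemeasurable
  · intro a y a' z c
    classical
    have hm : MeasurableSet {ω : Table 𝒞 𝒜 𝒵 𝒴 |
        potY a ω = y ∧ trtA ω = a' ∧ medZ ω = z ∧ covC ω = c} := by
      refine (measurableSet_eq_fun (measurable_potY a) measurable_const).inter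
        ((measurableSet_eq_fun measurable_trtA measurable_const).inter
          ((measurableSet_eq_fun measurable_medZ measurable_const).inter
            (measurableSet_eq_fun measurable_covC measurable_const)))
    rw [tableLaw, Measure.map_apply hΦ hm]
    -- Forcing Z(a) = Z(a') = z makes Y(a) the table entry at (c, z). The finite set {a, a'} also
    -- covers a = a'.
    have hsub : ({(c, a')} : Set (𝒞 × 𝒜)) ×ˢ ((Set.pi (({a, a'} : Finset 𝒜) : Set 𝒜) fun _ => {z}) ×ˢ
        ((fun f : 𝒞 × 𝒵 → 𝒴 => f (c, z)) ⁻¹' {y})) ⊆ assemble ⁻¹' {ω : Table 𝒞 𝒜 𝒵 𝒴 |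
        potY a ω = y ∧ trtA ω = a' ∧ medZ ω = z ∧ covC ω = c} := by
      rintro ⟨⟨c', b⟩, f, g⟩ ⟨h1, h2, h3⟩
      simp only [Set.mem_singleton_iff, Prod.mk.injEq] at h1
      obtain ⟨rfl, rfl⟩ := h1
      have h4 : f a = z := h2 a (by simp)
      have h5 : f b = z := h2 b (by simp)
      have h6 : g (c', z) = y := h3
      refine ⟨?_, rfl, h5, rfl⟩
      change g (c', f a) = y
      rw [h4, h6]
    refine lt_of_lt_of_le ?_ (measure_mono hsub)
    rw [baseLaw, Measure.prod_prod, Measure.prod_prod,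
      Measure.infinitePi_pi _ (fun _ _ => measurableSet_singleton z),
      (measurePreserving_eval_infinitePi η (c, z)).measure_preimage
        (measurableSet_singleton y).nullMeasurableSet]
    refine ENNReal.mul_pos (hρ _).ne' (ENNReal.mul_pos ?_ (hη _ _).ne').ne'
    exact Finset.prod_ne_zero_iff.2 fun b _ => (hζ b z).ne'
  -- Given C, the outcomes Y(a), Y(a') are read off the two tables, which are independent of (C, A).
  · intro a a'
    exact condIndepGiven_of_indepFun hΦ hind (by fun_prop) measurable_trtA measurable_covC
      (y := fun v => v.2) (w := fun v => v.1) (by fun_prop) (by fun_prop) (fun _ => rfl)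
      (fun _ => rfl) (fun c v => (v.2 (c, v.1 a), v.2 (c, v.1 a')))
      (fun c => (hpot c a).prodMk (hpot c a')) fun _ => rfl
  · intro a z
    exact condIndepGiven_of_indepFun hΦ hind (by fun_prop) measurable_trtA measurable_covC
      (y := fun v => v.2) (w := fun v => v.1) (by fun_prop) (by fun_prop) (fun _ => rfl)
      (fun _ => rfl) (fun c v => v.2 (c, z)) (fun c => by fun_prop) fun _ => rfl
  · intro a
    rw [tableLaw, indepFun_iff_measure_inter_preimage_eq_mul]
    intro s t hs ht
    rw [Measure.map_apply hΦ ((measurable_potZ a hs).inter (measurable_trtA ht)),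
      Measure.map_apply hΦ (measurable_potZ a hs), Measure.map_apply hΦ (measurable_trtA ht)]
    exact hmid.measure_inter_preimage_eq_mul ((fun f : 𝒜 → 𝒵 => f a) ⁻¹' s)
      ((fun v : (𝒞 × 𝒜) × (𝒞 × 𝒵 → 𝒴) => v.1.2) ⁻¹' t)
      ((measurable_pi_apply a) hs) ((by fun_prop : Measurable _) ht)
  -- Y(a, z) is a function of C and of the outcome table; with (C, A) these are independent of the
  -- mediator table.
  · intro a a' z
    exact CondIndepGiven.symm (condIndepGiven_of_indepFun hΦ hmid (measurable_potZ a') (measurable_potYZ a z)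
      measurable_trtA (y := fun v => v.2 (v.1.1, z)) (w := fun v => v.1.2) (hev z) (by fun_prop)
      (fun _ => rfl) (fun _ => rfl) (fun _ f => f a') (fun _ => by fun_prop) fun _ => rfl)
  · intro a
    exact condIndepGiven_of_indepFun hΦ hmid (measurable_potZ a) measurable_trtA
      measurable_covC (y := fun v => v.1.2) (w := fun v => v.1.1) (by fun_prop) (by fun_prop)
      (fun _ => rfl) (fun _ => rfl) (fun _ f => f a) (fun _ => by fun_prop) fun _ => rfl
  · intro a a' z
    exact CondIndepGiven.symm (condIndepGiven_of_indepFun hΦ hmid (measurable_potZ a') (measurable_potYZ a z)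
      (by fun_prop) (y := fun v => v.2 (v.1.1, z)) (w := fun v => (v.1.2, v.1.1)) (hev z)
      (by fun_prop) (fun _ => rfl) (fun _ => rfl) (fun _ f => f a') (fun _ => by fun_prop)
      fun _ => rfl)
  · intro a
    exact condIndepGiven_of_indepFun hΦ hmid (measurable_potZ a) measurable_covC
      measurable_trtA (y := fun v => v.1.1) (w := fun v => v.1.2) (by fun_prop) (by fun_prop)
      (fun _ => rfl) (fun _ => rfl) (fun _ f => f a) (fun _ => by fun_prop) fun _ => rfl

end table_law

/-! ### Linear tilts are differentiable in quadratic mean. -/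

section linear_tilts

/-- Since e = (k − 1)(k + 1), the error is exactly −(k − 1)²/2, and k + 1 ≥ 1 bounds k − 1 by e in
absolute value. -/
theorem abs_sqrt_sub_le {k e : ℝ} (hk : 0 ≤ k) (he : k ^ 2 = 1 + e) :
    |k - 1 - e / 2| ≤ e ^ 2 / 2 := by
  have h1 : k - 1 - e / 2 = -((k - 1) ^ 2 / 2) := by nlinarith
  have h2 : (k - 1) ^ 2 ≤ e ^ 2 := by
    have h3 : e = (k - 1) * (k + 1) := by nlinarith
    rw [h3, mul_pow]
    exact le_mul_of_one_le_right (sq_nonneg _) (by nlinarith)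
  rw [h1, abs_neg, abs_of_nonneg (by positivity)]
  linarith

theorem abs_sqrt_prod_sub_le {U V W m : ℝ} (hU : |U| ≤ m) (hV : |V| ≤ m) (hW : |W| ≤ m)
    (hm : m ≤ 1 / 2) :
    |√((1 + U) * (1 + V) * (1 + W)) - 1 - (U + V + W) / 2| ≤ 15 * m ^ 2 := by
  have hm0 : 0 ≤ m := (abs_nonneg U).trans hU
  have hUV : |U * V| ≤ m ^ 2 := by
    rw [abs_mul, sq]
    exact mul_le_mul hU hV (abs_nonneg _) hm0
  have hUW : |U * W| ≤ m ^ 2 := by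
    rw [abs_mul, sq]
    exact mul_le_mul hU hW (abs_nonneg _) hm0
  have hVW : |V * W| ≤ m ^ 2 := by
    rw [abs_mul, sq]
    exact mul_le_mul hV hW (abs_nonneg _) hm0
  have hUVW : |U * V * W| ≤ m ^ 2 := by
    rw [abs_mul]
    refine (mul_le_mul hUV hW (abs_nonneg _) (sq_nonneg _)).trans ?_
    exact mul_le_of_le_one_right (sq_nonneg _) (by linarith)
  obtain ⟨u1, u2⟩ := abs_le.1 hU
  obtain ⟨v1, v2⟩ := abs_le.1 hV
  obtain ⟨w1, w2⟩ := abs_le.1 hW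
  obtain ⟨a1, a2⟩ := abs_le.1 hUV
  obtain ⟨b1, b2⟩ := abs_le.1 hUW
  obtain ⟨c1, c2⟩ := abs_le.1 hVW
  obtain ⟨d1, d2⟩ := abs_le.1 hUVW
  set e := U + V + W + U * V + U * W + V * W + U * V * W with he
  have hr : 0 ≤ (1 + U) * (1 + V) * (1 + W) :=
    mul_nonneg (mul_nonneg (by linarith) (by linarith)) (by linarith)
  have h1 := abs_sqrt_sub_le (e := e) (Real.sqrt_nonneg ((1 + U) * (1 + V) * (1 + W)))
    (by rw [Real.sq_sqrt hr, he]; ring)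
  -- Hence |e| ≤ 3m + 4m² ≤ 5m. The square root contributes at most 25m²/2 and the products of tilts
  -- at most 2m², together below 15m².
  have hmm : m ^ 2 ≤ m / 2 := by nlinarith
  have he2 : e ^ 2 ≤ (5 * m) ^ 2 := by
    refine sq_le_sq' ?_ ?_ <;> linarith
  obtain ⟨k1, k2⟩ := abs_le.1 h1
  rw [abs_le]
  constructor <;> nlinarith

/-- Curves of mass functions obtained by bounded linear tilts of three factors are differentiable in
quadratic mean. -/
theorem isQMD_of_tilt {α : Type*} {p : ℝ → α → ℝ} {q u v w : α → ℝ} {M : ℝ} (hq0 : ∀ x, 0 ≤ q x)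
    (hq : Summable q) (hu : ∀ x, |u x| ≤ M) (hv : ∀ x, |v x| ≤ M) (hw : ∀ x, |w x| ≤ M)
    (hp : ∀ᶠ t in 𝓝 (0 : ℝ), ∀ x, p t x = q x * ((1 + t * u x) * (1 + t * v x) * (1 + t * w x)))
    (hM : ∀ᶠ t in 𝓝 (0 : ℝ), |t| * M ≤ 1 / 2) :
    IsQMD p fun x => u x + v x + w x := by
  have hp0 : ∀ x, p 0 x = q x := fun x => by simpa using hp.self_of_nhds x
  refine ⟨?_, ?_⟩
  · refine Summable.of_nonneg_of_le (fun x => mul_nonneg (sq_nonneg _) (by rw [hp0]; exact hq0 x))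
      (fun x => ?_) (hq.mul_left ((3 * M) ^ 2))
    rw [hp0]
    refine mul_le_mul_of_nonneg_right (sq_le_sq' ?_ ?_) (hq0 x)
    · linarith [(abs_le.1 (hu x)).1, (abs_le.1 (hv x)).1, (abs_le.1 (hw x)).1]
    · linarith [(abs_le.1 (hu x)).2, (abs_le.1 (hv x)).2, (abs_le.1 (hw x)).2]
  · have hO : (fun t : ℝ => ∑' x, (√(p t x) - √(p 0 x) - t / 2 * (u x + v x + w x) * √(p 0 x)) ^ 2)
        =O[𝓝 0] fun t : ℝ => t ^ 4 := by
      refine IsBigO.of_bound ((15 * M ^ 2) ^ 2 * ∑' x, q x) ?_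
      filter_upwards [hp, hM] with t ht hMt
      have hb : ∀ x, (√(p t x) - √(p 0 x) - t / 2 * (u x + v x + w x) * √(p 0 x)) ^ 2 ≤
          (15 * M ^ 2) ^ 2 * t ^ 4 * q x := by
        intro x
        have hsc : ∀ g : ℝ, |g| ≤ M → |t * g| ≤ |t| * M := fun g hg => by
          rw [abs_mul]
          exact mul_le_mul_of_nonneg_left hg (abs_nonneg t)
        have h1 := abs_sqrt_prod_sub_le (hsc _ (hu x)) (hsc _ (hv x)) (hsc _ (hw x)) hMt
        have h2 : √(p t x) - √(p 0 x) - t / 2 * (u x + v x + w x) * √(p 0 x) =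
            √(q x) * (√((1 + t * u x) * (1 + t * v x) * (1 + t * w x)) - 1 -
              (t * u x + t * v x + t * w x) / 2) := by
          rw [ht, hp0, Real.sqrt_mul (hq0 x)]
          ring
        rw [h2, mul_pow, Real.sq_sqrt (hq0 x), mul_comm (q x)]
        refine mul_le_mul_of_nonneg_right ?_ (hq0 x)
        have h3 : (15 * M ^ 2) ^ 2 * t ^ 4 = (15 * (|t| * M) ^ 2) ^ 2 := by
          rw [mul_pow |t|, sq_abs]
          ring
        rw [h3]
        exact sq_le_sq' (abs_le.1 h1).1 (abs_le.1 h1).2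
      have hs : Summable fun x => (15 * M ^ 2) ^ 2 * t ^ 4 * q x := hq.mul_left _
      rw [Real.norm_of_nonneg (tsum_nonneg fun _ => sq_nonneg _),
        Real.norm_of_nonneg (by positivity)]
      refine ((Summable.of_nonneg_of_le (fun _ => sq_nonneg _) hb hs).tsum_le_tsum hb hs).trans ?_
      rw [tsum_mul_left]
      exact le_of_eq (by ring)
    exact hO.trans_isLittleO (isLittleO_pow_pow (by norm_num))

theorem tilt_pos {w g t M : ℝ} (hw : 0 < w) (hg : |g| ≤ M) (ht : |t| * M ≤ 1 / 2) :
    0 < w * (1 + t * g) := by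
  refine mul_pos hw ?_
  have h : |t * g| ≤ 1 / 2 := by
    rw [abs_mul]
    exact (mul_le_mul_of_nonneg_left hg (abs_nonneg t)).trans ht
  linarith [(abs_le.1 h).1]

theorem one_add_tilt_mem {g t M : ℝ} (hg : |g| ≤ M) (ht : |t| * M ≤ 1 / 2) :
    0 ≤ 1 + t * g ∧ 1 + t * g ≤ 3 / 2 := by
  have h : |t * g| ≤ 1 / 2 := by
    rw [abs_mul]
    exact (mul_le_mul_of_nonneg_left hg (abs_nonneg t)).trans ht
  exact ⟨by linarith [(abs_le.1 h).1], by linarith [(abs_le.1 h).2]⟩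

theorem hasSum_tilt {α : Type*} {w g : α → ℝ} (hw : HasSum w 1)
    (hg : HasSum (fun x => g x * w x) 0) (t : ℝ) : HasSum (fun x => w x * (1 + t * g x)) 1 := by
  have h := hw.add (hg.mul_left t)
  rw [mul_zero, add_zero] at h
  exact h.congr_fun fun x => by ring

end linear_tilts

/-! ### Regular submodels with prescribed bounded scores. -/

section tilted_submodels

variable {𝒞 𝒜 𝒵 : Type*} {𝒴 : Set ℝ}
    [Countable 𝒞] [MeasurableSpace 𝒞] [MeasurableSingletonClass 𝒞]
    [Countable 𝒜] [MeasurableSpace 𝒜] [MeasurableSingletonClass 𝒜]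
    [Countable 𝒵] [MeasurableSpace 𝒵] [MeasurableSingletonClass 𝒵]
    [Countable 𝒴]

/-- `S` is a sum of bounded scores of the factors `p(c, a)`, `p(z | a)` and `p(y | z, c)`. -/
def IsTilt (μ : Measure (Obs 𝒞 𝒜 𝒵 𝒴)) (S : Obs 𝒞 𝒜 𝒵 𝒴 → ℝ) : Prop :=
  ∃ (g₀ : 𝒞 × 𝒜 → ℝ) (g₁ : 𝒜 → 𝒵 → ℝ) (g₂ : 𝒞 × 𝒵 → 𝒴 → ℝ) (M : ℝ),
    (∀ x, |g₀ x| ≤ M) ∧ (∀ a z, |g₁ a z| ≤ M) ∧ (∀ x y, |g₂ x y| ≤ M) ∧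
    HasSum (fun x => g₀ x * (pC μ x.1 * pAC μ x.2 x.1)) 0 ∧
    (∀ a, HasSum (fun z => g₁ a z * pZA μ z a) 0) ∧
    (∀ x, HasSum (fun y => g₂ x y * pYZC μ y x.2 x.1) 0) ∧
    ∀ c a z y, S (c, a, z, y) = g₀ (c, a) + g₁ a z + g₂ (c, z) y

/-- The bounded scores of the factors are scores of regular submodels. -/
theorem IsTilt.exists_isRegularSubmodel {μ : Measure (Obs 𝒞 𝒜 𝒵 𝒴)} {S : Obs 𝒞 𝒜 𝒵 𝒴 → ℝ}
    (hS : IsTilt μ S) (hμ : Factorizes μ) {as a : 𝒜} (has : PotSq μ as) (ha : PotSq μ a) :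
    ∃ Q, IsRegularSubmodel as a μ Q S := by
  have := hμ.isProbabilityMeasure
  obtain ⟨g₀, g₁, g₂, M, b₀, b₁, b₂, s₀, s₁, s₂, hSg⟩ := hS
  obtain ⟨c₀, a₀, z₀, y₀⟩ := hμ.nonempty
  have : Nonempty (𝒞 × 𝒜) := ⟨(c₀, a₀)⟩
  have : Nonempty 𝒵 := ⟨z₀⟩
  have : Nonempty 𝒴 := ⟨y₀⟩
  have hM0 : 0 ≤ M := (abs_nonneg _).trans (b₀ (c₀, a₀))
  let ρ : ℝ → 𝒞 × 𝒜 → ℝ := fun t x => pC μ x.1 * pAC μ x.2 x.1 * (1 + t * g₀ x)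
  let ζ : ℝ → 𝒜 → 𝒵 → ℝ := fun t b z => pZA μ z b * (1 + t * g₁ b z)
  let η : ℝ → 𝒞 × 𝒵 → 𝒴 → ℝ := fun t x y => pYZC μ y x.2 x.1 * (1 + t * g₂ x y)
  -- At t = 0 this law need not be the original law of the potential outcomes; a submodel is only
  -- required to have the right observed law there.
  let Q : ℝ → Measure (Table 𝒞 𝒜 𝒵 𝒴) := fun t =>
    tableLaw (ofMass (ρ t)) (fun b => ofMass (ζ t b)) (fun x => ofMass (η t x))
  have hsmall : ∀ᶠ t in 𝓝 (0 : ℝ), |t| * M ≤ 1 / 2 := by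
    have h : Tendsto (fun t : ℝ => |t| * M) (𝓝 0) (𝓝 (|0| * M)) :=
      (Continuous.tendsto (by fun_prop) 0)
    rw [abs_zero, zero_mul] at h
    exact (h.eventually (gt_mem_nhds (by norm_num : (0 : ℝ) < 1 / 2))).mono fun t ht => ht.le
  have hρ0 : ∀ t, |t| * M ≤ 1 / 2 → ∀ x, 0 < ρ t x := fun t ht x =>
    tilt_pos (mul_pos (hμ.pC_pos _) (hμ.pAC_pos _ _)) (b₀ x) ht
  have hζ0 : ∀ t, |t| * M ≤ 1 / 2 → ∀ b z, 0 < ζ t b z := fun t ht b z =>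
    tilt_pos (hμ.pZA_pos _ _) (b₁ b z) ht
  have hη0 : ∀ t, |t| * M ≤ 1 / 2 → ∀ x y, 0 < η t x y := fun t ht x y =>
    tilt_pos (hμ.pYZC_pos _ _ _) (b₂ x y) ht
  have hρ : ∀ t, |t| * M ≤ 1 / 2 → ∀ x, (ofMass (ρ t)).real {x} = ρ t x := fun t ht x =>
    ofMass_real_singleton (fun x => (hρ0 t ht x).le) (hasSum_tilt hμ.hasSum_pC_mul_pAC s₀ t) x
  have hζ : ∀ t, |t| * M ≤ 1 / 2 → ∀ b z, (ofMass (ζ t b)).real {z} = ζ t b z := fun t ht b z =>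
    ofMass_real_singleton (fun z => (hζ0 t ht b z).le) (hasSum_tilt (hμ.hasSum_pZA b) (s₁ b) t) z
  have hη : ∀ t, |t| * M ≤ 1 / 2 → ∀ x y, (ofMass (η t x)).real {y} = η t x y := fun t ht x y =>
    ofMass_real_singleton (fun y => (hη0 t ht x y).le)
      (hasSum_tilt (hμ.hasSum_pYZC x.2 x.1) (s₂ x) t) y
  have hmod : ∀ t, |t| * M ≤ 1 / 2 → InModel (Q t) := fun t ht => by
    refine inModel_tableLaw _ _ _ (fun x => ?_) (fun b z => ?_) fun x y => ?_
    · refine (ENNReal.toReal_pos_iff.1 ?_).1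
      rw [← measureReal_def, hρ t ht]
      exact hρ0 t ht x
    · refine (ENNReal.toReal_pos_iff.1 ?_).1
      rw [← measureReal_def, hζ t ht]
      exact hζ0 t ht b z
    · refine (ENNReal.toReal_pos_iff.1 ?_).1
      rw [← measureReal_def, hη t ht]
      exact hη0 t ht x y
  have hobs : ∀ t, |t| * M ≤ 1 / 2 → ∀ x : Obs 𝒞 𝒜 𝒵 𝒴, (obsLaw (Q t)).real {x} = μ.real {x} *
      ((1 + t * g₀ (x.1, x.2.1)) * (1 + t * g₁ x.2.1 x.2.2.1) *
        (1 + t * g₂ (x.1, x.2.2.1) x.2.2.2)) := by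
    rintro t ht ⟨c, b, z, y⟩
    rw [obsLaw_tableLaw, hρ t ht, hζ t ht, hη t ht, hμ.real_singleton]
    simp only [ρ, ζ, η]
    ring
  have h0 : |(0 : ℝ)| * M ≤ 1 / 2 := by simp
  have hbase : obsLaw (Q 0) = μ := by
    have := (hmod 0 h0).factorizes.isProbabilityMeasure
    refine ext_iff_measureReal_singleton.2 fun x => ?_
    rw [hobs 0 h0]
    simp
  -- the conditional mean of `g₀` given `C`
  have hgC : ∀ c, Summable fun b => g₀ (c, b) * pAC μ b c := fun c =>
    Summable.of_norm_bounded (g := fun b => M * pAC μ b c)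
      ((hμ.hasSum_pAC c).summable.mul_left M) fun b => by
        rw [Real.norm_eq_abs, abs_mul, abs_of_pos (hμ.pAC_pos b c)]
        exact mul_le_mul_of_nonneg_right (b₀ _) (hμ.pAC_pos b c).le
  have hbC : ∀ c, |∑' b, g₀ (c, b) * pAC μ b c| ≤ M := by
    intro c
    have h1 := ((hμ.hasSum_pAC c).mul_left M).tsum_eq
    rw [mul_one] at h1
    rw [abs_le]
    constructor
    · have h2 : ∑' b, -(M * pAC μ b c) ≤ ∑' b, g₀ (c, b) * pAC μ b c := by
        refine ((hμ.hasSum_pAC c).summable.mul_left M).neg.tsum_le_tsum (fun b => ?_) (hgC c)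
        rw [← neg_mul]
        exact mul_le_mul_of_nonneg_right (abs_le.1 (b₀ _)).1 (hμ.pAC_pos b c).le
      rw [tsum_neg, h1] at h2
      exact h2
    · have h2 : ∑' b, g₀ (c, b) * pAC μ b c ≤ ∑' b, M * pAC μ b c :=
        (hgC c).tsum_le_tsum (fun b => mul_le_mul_of_nonneg_right (abs_le.1 (b₀ _)).2
          (hμ.pAC_pos b c).le) ((hμ.hasSum_pAC c).summable.mul_left M)
      rwa [h1] at h2
  -- Summing out A replaces g₀ by its conditional mean given C, still bounded by M, so the potential
  -- law is again a bounded tilt.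
  have hpotL : ∀ b t, |t| * M ≤ 1 / 2 → ∀ v, (potLaw b (Q t)).real {v} = potMass μ b v *
      ((1 + t * ∑' b', g₀ (v.1, b') * pAC μ b' v.1) * (1 + t * g₁ b v.2.1) *
        (1 + t * g₂ (v.1, v.2.1) v.2.2)) := by
    rintro b t ht ⟨c, z, y⟩
    rw [potLaw_tableLaw, hζ t ht, hη t ht]
    have h1 := hasSum_measureReal_fiber (ν := ofMass (ρ t)) (fun x => x.2)
      ((fun x => x.1) ⁻¹' {c})
    have h2 := ((hμ.hasSum_pAC c).add ((hgC c).hasSum.mul_left t)).mul_left (pC μ c)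
    rw [h1.unique (h2.congr_fun fun b' => ?_)]
    · simp only [ζ, η, potMass]
      ring
    · have e : (fun x : 𝒞 × 𝒜 => x.1) ⁻¹' {c} ∩ (fun x => x.2) ⁻¹' {b'} = {(c, b')} := by
        ext ⟨c', a'⟩
        simp
      rw [e, hρ t ht]
      simp only [ρ]
      ring
  have hsumμ : Summable fun x => μ.real {x} := by
    simpa using (integrable_iff_summable (ν := μ) fun _ => (1 : ℝ)).1 (integrable_const _)
  have hsumPot : ∀ b, Summable (potMass μ b) := by
    intro b
    have h1 := (hmod 0 h0).isProbabilityMeasure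
    have : IsProbabilityMeasure (potLaw b (Q 0)) :=
      Measure.isProbabilityMeasure_map (by fun_prop)
    have h2 := (integrable_iff_summable (ν := potLaw b (Q 0)) fun _ => (1 : ℝ)).1
      (integrable_const _)
    refine h2.congr fun v => ?_
    rw [hpotL b 0 h0]
    simp
  refine ⟨Q, ?_, hbase, ?_, ?_, ?_⟩
  · exact hsmall.mono hmod
  · have hq := isQMD_of_tilt (p := fun t x => (obsLaw (Q t)).real {x}) (q := fun x => μ.real {x})
      (u := fun x => g₀ (x.1, x.2.1)) (v := fun x => g₁ x.2.1 x.2.2.1)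
      (w := fun x => g₂ (x.1, x.2.2.1) x.2.2.2) (M := M) (fun x => measureReal_nonneg) hsumμ
      (fun x => b₀ _) (fun x => b₁ _ _) (fun x => b₂ _ _) (hsmall.mono hobs) hsmall
    have e : S = fun x => g₀ (x.1, x.2.1) + g₁ x.2.1 x.2.2.1 + g₂ (x.1, x.2.2.1) x.2.2.2 := by
      ext ⟨c, b, z, y⟩
      exact hSg c b z y
    rwa [e]
  · intro b _
    exact ⟨_, isQMD_of_tilt (q := potMass μ b) (M := M) (fun v => (hμ.potMass_pos b v).le)
      (hsumPot b) (fun v => hbC _) (fun v => b₁ _ _) (fun v => b₂ _ _)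
      (hsmall.mono (hpotL b)) hsmall⟩
  · intro b hb
    have hY : PotSq μ b := by
      rcases hb with rfl | rfl
      exacts [has, ha]
    -- Each of the three tilts is at most 3/2, and (3/2)³ ≤ 4.
    refine ⟨4 * ∑' v : 𝒞 × 𝒵 × 𝒴, (v.2.2 : ℝ) ^ 2 * potMass μ b v, ?_⟩
    filter_upwards [hsmall] with t ht
    have hle : ∀ v : 𝒞 × 𝒵 × 𝒴, (v.2.2 : ℝ) ^ 2 * potMass (obsLaw (Q t)) b v ≤
        4 * ((v.2.2 : ℝ) ^ 2 * potMass μ b v) := by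
      intro v
      rw [← (hmod t ht).potLaw_real_singleton, hpotL b t ht]
      obtain ⟨p1, q1⟩ := one_add_tilt_mem (hbC v.1) ht
      obtain ⟨p2, q2⟩ := one_add_tilt_mem (b₁ b v.2.1) ht
      obtain ⟨p3, q3⟩ := one_add_tilt_mem (b₂ (v.1, v.2.1) v.2.2) ht
      have h1 := mul_le_mul (mul_le_mul q1 q2 p2 (by norm_num)) q3 p3 (by norm_num)
      have h2 : 0 ≤ (v.2.2 : ℝ) ^ 2 * potMass μ b v :=
        mul_nonneg (sq_nonneg _) (hμ.potMass_pos b v).le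
      rw [← mul_assoc, mul_comm 4]
      exact mul_le_mul_of_nonneg_left (h1.trans (by norm_num)) h2
    have hnn : ∀ v : 𝒞 × 𝒵 × 𝒴, 0 ≤ (v.2.2 : ℝ) ^ 2 * potMass (obsLaw (Q t)) b v := fun v =>
      mul_nonneg (sq_nonneg _) ((hmod t ht).factorizes.potMass_pos b v).le
    have hs : PotSq (obsLaw (Q t)) b := Summable.of_nonneg_of_le hnn hle (Summable.mul_left 4 hY)
    refine ⟨((hmod t ht).memLp_potY_iff b).2 hs, ?_⟩
    rw [(hmod t ht).integral_potY_sq, ← tsum_mul_left]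
    exact hs.tsum_le_tsum hle (Summable.mul_left 4 hY)

end tilted_submodels

/-! ### Centred indicators as bounded mean-zero functions. -/

section centred_indicators

variable {ι : Type*}

theorem hasSum_centred {w : ι → ℝ} (hw : HasSum w 1) (i : ι) :
    HasSum (fun x => (({i} : Set ι).indicator 1 x - w i) * w x) 0 := by
  have h1 : HasSum (fun x => ({i} : Set ι).indicator (1 : ι → ℝ) x * w x) (w i) := by
    have h := hasSum_single (f := fun x => ({i} : Set ι).indicator (1 : ι → ℝ) x * w x) i
      fun j hj => by simp [hj]
    simpa using h
  have h := h1.sub (hw.mul_left (w i))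
  rw [mul_one, sub_self] at h
  exact h.congr_fun fun x => by ring

theorem abs_indicator_sub_le {w : ι → ℝ} (hw0 : ∀ i, 0 ≤ w i) (hw : HasSum w 1) (i x : ι) :
    |({i} : Set ι).indicator (1 : ι → ℝ) x - w i| ≤ 1 := by
  have h1 : w i ≤ 1 := (hw.summable.le_tsum i fun j _ => hw0 j).trans_eq hw.tsum_eq
  have h0 := hw0 i
  by_cases hx : x = i
  · simp only [hx, Set.mem_singleton_iff, Set.indicator_of_mem, Pi.one_apply]
    exact abs_le.2 ⟨by linarith, by linarith⟩
  · simp only [Set.indicator_of_notMem (show x ∉ ({i} : Set ι) from hx)]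
    exact abs_le.2 ⟨by linarith, by linarith⟩

end centred_indicators

/-! ### The influence function in the tangent space, and the efficiency bound. -/

section tangent_space

variable {𝒞 𝒜 𝒵 : Type*} {𝒴 : Set ℝ}
    [Countable 𝒞] [MeasurableSpace 𝒞] [MeasurableSingletonClass 𝒞]
    [Countable 𝒜] [MeasurableSpace 𝒜] [MeasurableSingletonClass 𝒜]
    [Countable 𝒵] [MeasurableSpace 𝒵] [MeasurableSingletonClass 𝒵]
    [Countable 𝒴]

variable {μ : Measure (Obs 𝒞 𝒜 𝒵 𝒴)}

theorem IsTilt.memLp {S : Obs 𝒞 𝒜 𝒵 𝒴 → ℝ} [IsProbabilityMeasure μ] (hS : IsTilt μ S) :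
    MemLp S 2 μ := by
  obtain ⟨g₀, g₁, g₂, M, b₀, b₁, b₂, -, -, -, h⟩ := hS
  refine MemLp.of_bound (Measurable.of_discrete).aestronglyMeasurable (M + M + M)
    (ae_of_all _ ?_)
  rintro ⟨c, a, z, y⟩
  rw [h, Real.norm_eq_abs]
  exact (abs_add_le _ _).trans (add_le_add ((abs_add_le _ _).trans (add_le_add (b₀ _) (b₁ _ _)))
    (b₂ _ _))

theorem IsTilt.add {S S' : Obs 𝒞 𝒜 𝒵 𝒴 → ℝ} (hS : IsTilt μ S) (hS' : IsTilt μ S') :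
    IsTilt μ (S + S') := by
  obtain ⟨g₀, g₁, g₂, M, b₀, b₁, b₂, s₀, s₁, s₂, h⟩ := hS
  obtain ⟨g₀', g₁', g₂', M', b₀', b₁', b₂', s₀', s₁', s₂', h'⟩ := hS'
  refine ⟨fun x => g₀ x + g₀' x, fun a z => g₁ a z + g₁' a z, fun x y => g₂ x y + g₂' x y, M + M',
    fun x => (abs_add_le _ _).trans (add_le_add (b₀ x) (b₀' x)),
    fun a z => (abs_add_le _ _).trans (add_le_add (b₁ a z) (b₁' a z)),
    fun x y => (abs_add_le _ _).trans (add_le_add (b₂ x y) (b₂' x y)), ?_, fun a => ?_,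
    fun x => ?_, fun c a z y => ?_⟩
  · simpa only [add_mul, add_zero] using s₀.add s₀'
  · simpa only [add_mul, add_zero] using (s₁ a).add (s₁' a)
  · simpa only [add_mul, add_zero] using (s₂ x).add (s₂' x)
  · rw [Pi.add_apply, h, h']
    ring

theorem IsTilt.smul {S : Obs 𝒞 𝒜 𝒵 𝒴 → ℝ} (k : ℝ) (hS : IsTilt μ S) : IsTilt μ (k • S) := by
  obtain ⟨g₀, g₁, g₂, M, b₀, b₁, b₂, s₀, s₁, s₂, h⟩ := hS
  have hb : ∀ g : ℝ, |g| ≤ M → |k * g| ≤ |k| * M := fun g hg => by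
    rw [abs_mul]
    exact mul_le_mul_of_nonneg_left hg (abs_nonneg k)
  refine ⟨fun x => k * g₀ x, fun a z => k * g₁ a z, fun x y => k * g₂ x y, |k| * M,
    fun x => hb _ (b₀ x), fun a z => hb _ (b₁ a z), fun x y => hb _ (b₂ x y), ?_, fun a => ?_,
    fun x => ?_, fun c a z y => ?_⟩
  · simpa only [mul_assoc, mul_zero] using s₀.mul_left k
  · simpa only [mul_assoc, mul_zero] using (s₁ a).mul_left k
  · simpa only [mul_assoc, mul_zero] using (s₂ x).mul_left k
  · rw [Pi.smul_apply, h, smul_eq_mul]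
    ring

theorem isTilt_zero : IsTilt μ (0 : Obs 𝒞 𝒜 𝒵 𝒴 → ℝ) :=
  ⟨0, 0, 0, 0, by simp, by simp, by simp, by simp, by simp, by simp, by simp⟩

/-- The space of the bounded scores of the factors. -/
def tiltSpace (μ : Measure (Obs 𝒞 𝒜 𝒵 𝒴)) : Submodule ℝ (Lp ℝ 2 μ) where
  carrier := {f | ∃ S, IsTilt μ S ∧ f =ᵐ[μ] S}
  zero_mem' := ⟨0, isTilt_zero, Lp.coeFn_zero _ _ _⟩
  add_mem' := by
    rintro f g ⟨S, hS, hf⟩ ⟨S', hS', hg⟩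
    exact ⟨S + S', hS.add hS', (Lp.coeFn_add f g).trans (hf.add hg)⟩
  smul_mem' := by
    rintro k f ⟨S, hS, hf⟩
    exact ⟨k • S, hS.smul k, (Lp.coeFn_smul k f).trans (hf.const_smul k)⟩

theorem inner_eq_integral {f g : Lp ℝ 2 μ} {F G : Obs 𝒞 𝒜 𝒵 𝒴 → ℝ} (hf : f =ᵐ[μ] F)
    (hg : g =ᵐ[μ] G) : inner ℝ f g = ∫ x, F x * G x ∂μ := by
  rw [L2.inner_def]
  refine integral_congr_ae ?_
  filter_upwards [hf, hg] with x h1 h2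
  rw [h1, h2]
  exact mul_comm _ _

theorem integral_indicator_sub_mul {E E' : Set (Obs 𝒞 𝒜 𝒵 𝒴)} {f : Obs 𝒞 𝒜 𝒵 𝒴 → ℝ}
    (hf : Integrable f μ) (r : ℝ) {S : Obs 𝒞 𝒜 𝒵 𝒴 → ℝ}
    (hS : ∀ x, S x = E.indicator 1 x - r * E'.indicator 1 x) :
    ∫ x, S x * f x ∂μ = ∫ x in E, f x ∂μ - r * ∫ x in E', f x ∂μ := by
  have h : ∀ x, S x * f x = E.indicator f x - r * E'.indicator f x := by
    intro x
    rw [hS]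
    by_cases h1 : x ∈ E <;> by_cases h2 : x ∈ E' <;> simp [h1, h2]; ring
  simp only [h]
  rw [integral_sub (hf.indicator .of_discrete) ((hf.indicator .of_discrete).const_mul r),
    integral_const_mul, integral_indicator .of_discrete, integral_indicator .of_discrete]

namespace Factorizes

variable (hμ : Factorizes μ)

include hμ

/-- This and the next two families of centred indicators are the test scores that determine the
conditional means of a function orthogonal to all tilts. -/
theorem isTilt_CA (c : 𝒞) (a : 𝒜) : IsTilt μ fun x =>
    ({(c, a)} : Set (𝒞 × 𝒜)).indicator 1 (x.1, x.2.1) - pC μ c * pAC μ a c := by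
  refine ⟨fun x => ({(c, a)} : Set (𝒞 × 𝒜)).indicator 1 x - pC μ c * pAC μ a c, fun _ _ => 0,
    fun _ _ => 0, 1, ?_, by simp, by simp, hasSum_centred hμ.hasSum_pC_mul_pAC (c, a), by simp,
    by simp, by simp⟩
  exact abs_indicator_sub_le (fun x => (mul_pos (hμ.pC_pos _) (hμ.pAC_pos _ _)).le)
    hμ.hasSum_pC_mul_pAC (c, a)

theorem isTilt_AZ (a : 𝒜) (z : 𝒵) : IsTilt μ fun x =>
    ({a} : Set 𝒜).indicator 1 x.2.1 * (({z} : Set 𝒵).indicator 1 x.2.2.1 - pZA μ z a) := by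
  refine ⟨fun _ => 0, fun a' z' => ({a} : Set 𝒜).indicator 1 a' *
    (({z} : Set 𝒵).indicator 1 z' - pZA μ z a), fun _ _ => 0, 1, by simp, fun a' z' => ?_, by simp,
    by simp, fun a' => ?_, by simp, by simp⟩
  · by_cases h : a' = a
    · simpa [h] using abs_indicator_sub_le (fun x => (hμ.pZA_pos x a).le) (hμ.hasSum_pZA a) z z'
    · simp [h]
  · by_cases h : a' = a
    · simpa [h] using hasSum_centred (hμ.hasSum_pZA a) z
    · simp [h]

theorem isTilt_CZY (c : 𝒞) (z : 𝒵) (y : 𝒴) : IsTilt μ fun x =>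
    ({(c, z)} : Set (𝒞 × 𝒵)).indicator 1 (x.1, x.2.2.1) *
      (({y} : Set 𝒴).indicator 1 x.2.2.2 - pYZC μ y z c) := by
  refine ⟨fun _ => 0, fun _ _ => 0, fun x y' => ({(c, z)} : Set (𝒞 × 𝒵)).indicator 1 x *
    (({y} : Set 𝒴).indicator 1 y' - pYZC μ y z c), 1, by simp, by simp, fun x y' => ?_,
    by simp, by simp, fun x => ?_, by simp⟩
  · by_cases h : x = (c, z)
    · simpa [h] using
        abs_indicator_sub_le (fun y => (hμ.pYZC_pos y z c).le) (hμ.hasSum_pYZC z c) y y'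
    · simp [h]
  · by_cases h : x = (c, z)
    · simpa [h] using hasSum_centred (hμ.hasSum_pYZC z c) y
    · simp [h]

section orthogonality

variable {f : Obs 𝒞 𝒜 𝒵 𝒴 → ℝ} (hf : MemLp f 2 μ)
  (hort : ∀ S, IsTilt μ S → ∫ x, S x * f x ∂μ = 0)

include hf hort

/-- Orthogonality forces E(f|C,A) = E f; the two analogues below force E(f|A,Z) = E(f|A) and
E(f|C,Z,Y) = E(f|C,Z). Each component of φ then pairs to zero with f by its own centring. -/
theorem setIntegral_CA_of_orthogonal (v : 𝒞 × 𝒜) :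
    ∫ x in (fun x => (x.1, x.2.1)) ⁻¹' {v}, f x ∂μ = pC μ v.1 * pAC μ v.2 v.1 * ∫ x, f x ∂μ := by
  have := hμ.isProbabilityMeasure
  have h := hort _ (hμ.isTilt_CA v.1 v.2)
  rw [integral_indicator_sub_mul (E := (fun x => (x.1, x.2.1)) ⁻¹' {v}) (E' := Set.univ)
    (hf.integrable one_le_two) (pC μ v.1 * pAC μ v.2 v.1) fun x => ?_, setIntegral_univ] at h
  · linarith
  · by_cases hx : (x.1, x.2.1) = v <;> simp [Set.indicator, hx]

theorem setIntegral_AZ_of_orthogonal (a : 𝒜) (z : 𝒵) :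
    ∫ x in (fun x => (x.2.1, x.2.2.1)) ⁻¹' {(a, z)}, f x ∂μ = pZA μ z a * ∫ x in evA a, f x ∂μ := by
  have := hμ.isProbabilityMeasure
  have h := hort _ (hμ.isTilt_AZ a z)
  rw [integral_indicator_sub_mul (E := (fun x => (x.2.1, x.2.2.1)) ⁻¹' {(a, z)}) (E' := evA a)
    (hf.integrable one_le_two) (pZA μ z a) fun x => ?_] at h
  · linarith
  · by_cases h1 : x.2.1 = a <;> by_cases h2 : x.2.2.1 = z <;> simp [Set.indicator, evA, h1, h2]

theorem setIntegral_CZY_of_orthogonal (c : 𝒞) (z : 𝒵) (y : 𝒴) :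
    ∫ x in (fun x => (x.1, x.2.2.1, x.2.2.2)) ⁻¹' {(c, z, y)}, f x ∂μ =
      pYZC μ y z c * ∫ x in evZ z ∩ evC c, f x ∂μ := by
  have := hμ.isProbabilityMeasure
  have h := hort _ (hμ.isTilt_CZY c z y)
  rw [integral_indicator_sub_mul (E := (fun x => (x.1, x.2.2.1, x.2.2.2)) ⁻¹' {(c, z, y)})
    (E' := evZ z ∩ evC c) (hf.integrable one_le_two) (pYZC μ y z c) fun x => ?_] at h
  · linarith
  · obtain ⟨c', a', z', y'⟩ := x
    by_cases h1 : c' = c <;> by_cases h2 : z' = z <;> by_cases h3 : y' = y <;>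
      simp [Set.indicator, evC, evZ, h1, h2, h3]

theorem integral_phiC_mul_of_orthogonal {b : 𝒜} (hb : PotSq μ b) :
    ∫ x, phiC b μ x.1 * f x ∂μ = 0 := by
  have := hμ.isProbabilityMeasure
  have h := hasSum_integral_fiber (ν := μ) (fun x => (x.1, x.2.1))
    (fun v : 𝒞 × 𝒜 => phiC b μ v.1) ((hμ.memLp_phiC hb).integrable_mul hf)
  have h0 := integral_comp_eq_tsum (μ := μ) (X := fun x : Obs 𝒞 𝒜 𝒵 𝒴 => (x.1, x.2.1))
    .of_discrete (fun v : 𝒞 × 𝒜 => phiC b μ v.1)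
  have hreal : ∀ v : 𝒞 × 𝒜, μ.real ((fun x => (x.1, x.2.1)) ⁻¹' {v}) =
      pC μ v.1 * pAC μ v.2 v.1 := by
    intro v
    rw [← hμ.real_evC_evA]
    congr 1
    ext x
    simp [evC, evA, Prod.ext_iff]
  simp only [hreal] at h0
  rw [hμ.integral_phiC hb] at h0
  rw [← h.tsum_eq]
  simp only [hμ.setIntegral_CA_of_orthogonal hf hort, ← mul_assoc] at h0 ⊢
  rw [tsum_mul_right]
  simp only [mul_assoc] at h0 ⊢
  rw [← h0, zero_mul]

theorem integral_phiZ_mul_of_orthogonal {b : 𝒜} (hb : PotSq μ b) :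
    ∫ x, phiZ b μ x.2.1 x.2.2.1 * f x ∂μ = 0 := by
  have h := hasSum_integral_fiber (ν := μ) (fun x => (x.2.1, x.2.2.1))
    (fun v : 𝒜 × 𝒵 => phiZ b μ v.1 v.2) ((hμ.memLp_phiZ hb).integrable_mul hf)
  refine (h.prod_fiberwise (g := fun _ => 0) fun a => ?_).unique hasSum_zero
  have h1 := (hμ.hasSum_phiZ_mul hb a).mul_right (∫ x in evA a, f x ∂μ)
  rw [zero_mul] at h1
  refine h1.congr_fun fun z => ?_
  rw [hμ.setIntegral_AZ_of_orthogonal hf hort, mul_assoc]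

theorem integral_phiY_mul_of_orthogonal {as a : 𝒜} (has : PotSq μ as)
    (hfin : Summable fun zc : 𝒵 × 𝒞 => boundSummand as a μ zc.1 zc.2) :
    ∫ x, phiY as a μ x.1 x.2.2.1 x.2.2.2 * f x ∂μ = 0 := by
  have h := hasSum_integral_fiber (ν := μ) (fun x => (x.1, x.2.2.1, x.2.2.2))
    (fun v : 𝒞 × 𝒵 × 𝒴 => phiY as a μ v.1 v.2.1 v.2.2)
    ((hμ.memLp_phiY has hfin).integrable_mul hf)
  have h' := (Equiv.prodAssoc 𝒞 𝒵 𝒴).hasSum_iff.2 h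
  refine (h'.prod_fiberwise (g := fun _ => 0) fun x => ?_).unique hasSum_zero
  have h1 := (hμ.hasSum_phiY_mul (as := as) (a := a) has x.1 x.2).mul_right
    (∫ x in evZ x.2 ∩ evC x.1, f x ∂μ)
  rw [zero_mul] at h1
  refine h1.congr_fun fun y => ?_
  simp only [Function.comp, Equiv.prodAssoc_apply,
    hμ.setIntegral_CZY_of_orthogonal hf hort, mul_assoc]

end orthogonality

variable {as a : 𝒜} (hne : as ≠ a) (has : PotSq μ as) (ha : PotSq μ a)
  (hfin : Summable fun zc : 𝒵 × 𝒞 => boundSummand as a μ zc.1 zc.2)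

include has ha

theorem tiltSpace_le : tiltSpace μ ≤ Submodule.span ℝ {f : Lp ℝ 2 μ |
    ∃ Q S, IsRegularSubmodel as a μ Q S ∧ f =ᵐ[μ] S} := by
  rintro f ⟨S, hS, hf⟩
  obtain ⟨Q, hQ⟩ := hS.exists_isRegularSubmodel hμ has ha
  exact Submodule.subset_span ⟨Q, S, hQ, hf⟩

include hne hfin

/-- In a Hilbert space the closure is the double orthogonal complement, so it suffices that φ pairs
to zero with everything orthogonal to the tilts. -/
theorem phi_mem_closure :
    (hμ.memLp_phi hne has ha hfin).toLp ∈ (tiltSpace μ).topologicalClosure := by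
  have := hμ.isProbabilityMeasure
  rw [← Submodule.orthogonal_orthogonal_eq_closure, Submodule.mem_orthogonal]
  intro f hf
  have hfL := Lp.memLp f
  have hort : ∀ S, IsTilt μ S → ∫ x, S x * f x ∂μ = 0 := by
    intro S hS
    have h := hf hS.memLp.toLp ⟨S, hS, MemLp.coeFn_toLp _⟩
    rwa [inner_eq_integral (MemLp.coeFn_toLp _) (ae_eq_refl _)] at h
  rw [real_inner_comm, inner_eq_integral (MemLp.coeFn_toLp _) (ae_eq_refl _)]
  have i1 := (hμ.memLp_phiY has hfin).integrable_mul hfL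
  have i2 := (hμ.memLp_phiZ has).integrable_mul hfL
  have i3 := (hμ.memLp_phiZ ha).integrable_mul hfL
  have i4 := (hμ.memLp_phiC has).integrable_mul hfL
  have i5 := (hμ.memLp_phiC ha).integrable_mul hfL
  have hexp : ∀ x, phi as a μ (potMean μ as - potMean μ a) x * f x =
      phiY as a μ x.1 x.2.2.1 x.2.2.2 * f x + phiZ as μ x.2.1 x.2.2.1 * f x
        - phiZ a μ x.2.1 x.2.2.1 * f x + phiC as μ x.1 * f x - phiC a μ x.1 * f x := by
    intro x
    rw [hμ.phi_eq_fun hne has ha]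
    ring
  simp only [hexp]
  simp only [Pi.mul_def] at i1 i2 i3 i4 i5
  rw [integral_sub (by fun_prop) i5, integral_add (by fun_prop) i4,
    integral_sub (by fun_prop) i3, integral_add i1 i2,
    hμ.integral_phiY_mul_of_orthogonal hfL hort has hfin,
    hμ.integral_phiZ_mul_of_orthogonal hfL hort has,
    hμ.integral_phiZ_mul_of_orthogonal hfL hort ha,
    hμ.integral_phiC_mul_of_orthogonal hfL hort has,
    hμ.integral_phiC_mul_of_orthogonal hfL hort ha]
  ring

/-- `φ_{bd,fd,td}` is the efficient influence function. -/
theorem isEfficientInfluenceFunction_phi :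
    IsEfficientInfluenceFunction as a μ (hμ.memLp_phi hne has ha hfin).toLp := by
  -- φ is its own projection: it is a gradient and already lies in the tangent space.
  refine ⟨(hμ.memLp_phi hne has ha hfin).toLp, fun Q S hQ => ?_,
    Submodule.topologicalClosure_mono (hμ.tiltSpace_le has ha)
      (hμ.phi_mem_closure hne has ha hfin), by rw [sub_self]; exact Submodule.zero_mem _⟩
  refine (hQ.hasDerivAt_ace hne has ha hfin).congr_deriv (integral_congr_ae ?_)
  filter_upwards [(hμ.memLp_phi hne has ha hfin).coeFn_toLp] with x hx
  rw [hx]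

/-- The variance of the influence function is the semiparametric efficiency bound. -/
theorem isEfficiencyBound_integral_sq : IsEfficiencyBound as a μ
    (∫ x, phi as a μ (potMean μ as - potMean μ a) x ^ 2 ∂μ) := by
  classical
  have := hμ.isProbabilityMeasure
  set φ := phi as a μ (potMean μ as - potMean μ a)
  have hφ : MemLp φ 2 μ := hμ.memLp_phi hne has ha hfin
  have hsq : ∀ {S : Obs 𝒞 𝒜 𝒵 𝒴 → ℝ} {f : Lp ℝ 2 μ}, f =ᵐ[μ] S →
      ‖f‖ ^ 2 = ∫ x, S x ^ 2 ∂μ := by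
    intro S f hf
    rw [← real_inner_self_eq_norm_sq, inner_eq_integral hf hf]
    simp only [sq]
  have hnorm : ‖hφ.toLp‖ ^ 2 = ∫ x, φ x ^ 2 ∂μ := hsq hφ.coeFn_toLp
  constructor
  · rintro v ⟨Q, S, d, hQ, hpos, hd, rfl⟩
    have hS := hQ.memLp
    rw [hd.unique (hQ.hasDerivAt_ace hne has ha hfin), div_le_iff₀ hpos, ← hnorm,
      ← hsq hS.coeFn_toLp, ← inner_eq_integral hφ.coeFn_toLp hS.coeFn_toLp, ← mul_pow]
    exact sq_le_sq' (neg_le_of_abs_le (abs_real_inner_le_norm _ _)) (real_inner_le_norm _ _)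
  · intro B hB
    have hmem : ∀ S, IsTilt μ S → 0 < ∫ x, S x ^ 2 ∂μ →
        (∫ x, φ x * S x ∂μ) ^ 2 / ∫ x, S x ^ 2 ∂μ ≤ B := by
      intro S hS hpos
      obtain ⟨Q, hQ⟩ := hS.exists_isRegularSubmodel hμ has ha
      exact hB ⟨Q, S, _, hQ, hpos, hQ.hasDerivAt_ace hne has ha hfin, rfl⟩
    -- The bound on tilts, cleared of denominators, is a closed condition and so passes to the
    -- closure; evaluated at φ it reads ‖φ‖⁴ ≤ B‖φ‖².
    have hle : ∀ f ∈ (tiltSpace μ).topologicalClosure, inner ℝ hφ.toLp f ^ 2 ≤ B * ‖f‖ ^ 2 := by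
      have hcl : IsClosed {f : Lp ℝ 2 μ | inner ℝ hφ.toLp f ^ 2 ≤ B * ‖f‖ ^ 2} :=
        isClosed_le (by fun_prop) (by fun_prop)
      refine fun f hf => closure_minimal (s := (tiltSpace μ : Set (Lp ℝ 2 μ))) ?_ hcl hf
      rintro g ⟨S, hS, hg⟩
      rw [Set.mem_ofPred_eq]
      rcases eq_or_ne g 0 with rfl | h0
      · simp
      · have hpos : 0 < ∫ x, S x ^ 2 ∂μ := by
          rw [← hsq hg]
          have := norm_pos_iff.2 h0
          positivity
        have h1 := hmem S hS hpos
        rwa [div_le_iff₀ hpos, ← hsq hg, ← inner_eq_integral hφ.coeFn_toLp hg] at h1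
    have h1 := hle _ (hμ.phi_mem_closure hne has ha hfin)
    rw [real_inner_self_eq_norm_sq, hnorm] at h1
    rcases (integral_nonneg fun x => sq_nonneg (φ x) : 0 ≤ ∫ x, φ x ^ 2 ∂μ).eq_or_lt with h0 | h0
    -- If φ = 0 nothing can be cancelled, and B ≥ 0 must come from some submodel with nonzero
    -- information. The centred indicator of (c, a⋆) works: its vanishing would give that cell mass
    -- one, while (c, a) also has positive mass.
    · obtain ⟨c, -, z, y⟩ := hμ.nonempty
      have hS := hμ.isTilt_CA c as
      refine h0.symm.le.trans (le_trans ?_ (hmem _ hS ?_))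
      · exact div_nonneg (sq_nonneg _) (integral_nonneg fun x => sq_nonneg _)
      · refine (integral_nonneg fun x => sq_nonneg _).lt_of_ne fun h => ?_
        have h2 := (integral_eq_zero_iff_of_nonneg (fun x => sq_nonneg _)
          hS.memLp.integrable_sq).1 h.symm
        have h3 := (hμ.ae_iff.1 h2) (c, as, z, y)
        have h4 : 0 < pC μ c * pAC μ a c := mul_pos (hμ.pC_pos c) (hμ.pAC_pos a c)
        have h5 := hμ.hasSum_pC_mul_pAC.summable.sum_le_tsum ({(c, as), (c, a)} : Finset (𝒞 × 𝒜))
          fun x _ => (mul_pos (hμ.pC_pos _) (hμ.pAC_pos _ _)).le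
        rw [hμ.hasSum_pC_mul_pAC.tsum_eq, Finset.sum_pair (by simp [hne])] at h5
        simp only [Set.mem_singleton_iff, Set.indicator_of_mem, Pi.one_apply, Pi.zero_apply] at h3
        have h6 := pow_eq_zero_iff (two_ne_zero) |>.1 h3
        linarith
    · rw [sq] at h1
      exact le_of_mul_le_mul_right h1 h0

end Factorizes

end tangent_space

end Causal

end

/-! ### Assembly of the four claims. -/

theorem proposition8 {𝒞 𝒜 𝒵 : Type*} {𝒴 : Set ℝ}
    [Countable 𝒞] [MeasurableSpace 𝒞] [MeasurableSingletonClass 𝒞]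
    [Countable 𝒜] [MeasurableSpace 𝒜] [MeasurableSingletonClass 𝒜]
    [Countable 𝒵] [MeasurableSpace 𝒵] [MeasurableSingletonClass 𝒵]
    [Countable 𝒴]
    (P : Measure (Table 𝒞 𝒜 𝒵 𝒴)) (hP : InModel P)
    (as a : 𝒜) (hne : as ≠ a)
    (hYas : MemLp (fun ω => (potY as ω : ℝ)) 2 P)
    (hYa : MemLp (fun ω => (potY a ω : ℝ)) 2 P)
    (hfin : Summable fun zc : 𝒵 × 𝒞 => boundSummand as a (obsLaw P) zc.1 zc.2) :
    -- the observed density factorizes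
    (∀ c a' z y, (obsLaw P).real {(c, a', z, y)} =
      pC (obsLaw P) c * pAC (obsLaw P) a' c * pZA (obsLaw P) z a' * pYZC (obsLaw P) y z c) ∧
    -- the explicit function is the efficient influence function
    (∃ hφ : MemLp (phi as a (obsLaw P) (ace as a P)) 2 (obsLaw P),
      IsEfficientInfluenceFunction as a (obsLaw P) hφ.toLp) ∧
    -- its variance is the explicit efficiency bound
    variance (phi as a (obsLaw P) (ace as a P)) (obsLaw P) =
      bound as a (obsLaw P) (ace as a P) ∧
    IsEfficiencyBound as a (obsLaw P) (bound as a (obsLaw P) (ace as a P)) ∧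
    -- it coincides with the Rotnitzky–Smucler formula
    (∀ x, phi as a (obsLaw P) (ace as a P) x = rsEIF as a (obsLaw P) x) := by
  have hμ := hP.factorizes
  have has := (hP.memLp_potY_iff as).1 hYas
  have ha := (hP.memLp_potY_iff a).1 hYa
  rw [hP.ace_eq as a]
  have hφ := hμ.memLp_phi hne has ha hfin
  refine ⟨fun c a' z y => hμ.real_singleton c a' z y,
    ⟨hφ, hμ.isEfficientInfluenceFunction_phi hne has ha hfin⟩,
    hμ.variance_phi hne has ha hfin, ?_, hμ.phi_eq_rsEIF hne has ha⟩
  rw [← hμ.variance_phi hne has ha hfin, variance_of_integral_eq_zero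
    hφ.aestronglyMeasurable.aemeasurable (hμ.integral_phi hne has ha hfin)]
  exact hμ.isEfficiencyBound_integral_sq hne has ha hfin
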